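/- Let $\mathcal O$ be a discrete valuation ring with finite residue field (for instance the ring of integers of a non-archimedean local field), $\mathfrak m$ its maximal ideal, $q=|\mathcal O/\mathfrak m|$, and let $\ell,m,n\ge 0$ be integers with $2m\le n$. For a partition $\lambda$ put $\mathcal O_\lambda=\bigoplus_i\mathcal O/\mathfrak m^{\lambda_i}$; a module isomorphic to $\mathcal O_\lambda$ is said to have type $\lambda$. Put $\phi=(\ell^m)$, $\Phi=(\ell^n)$, $E=\mathcal O_\Phi=(\mathcal O/\mathfrak m^\ell)^n$, let $X_\lambda$ be the set of submodules of $E$ of type $\lambda$, $\mathcal F_\lambda=\mathbb C(X_\lambda)$ the space of complex functions on it, and $\mathcal H_\phi=\mathrm{End}_{\mathrm{Aut}(E)}(\mathcal F_\phi)$. Order partitions by inclusion of Young diagrams. For $\lambda\le\phi$ let $c_\lambda\in\mathcal H_\phi$ be the composite of $\mathcal F_\phi\to\mathcal F_\lambda$, $h\mapsto\bigl(x\mapsto\sum_{y\supseteq x}h(y)\bigr)$, with $\mathcal F_\lambda\to\mathcal F_\phi$, $h\mapsto\bigl(y\mapsto\sum_{x\subseteq y}h(x)\bigr)$. Put $\mathcal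 H^\lambda=\mathrm{Span}\{c_\mu:\mu\le\lambda\}$, $\mathcal H^{\lambda^-}=\mathrm{Span}\{c_\mu:\mu<\lambda\}$. There is exactly one family $(e_\lambda)_{\lambda\le\phi}$ in which $e_\lambda$ is the idempotent of $\mathcal H_\phi$ corresponding to $\mathcal K_\lambda=\mathcal H^\lambda/\mathcal H^{\lambda^-}$, that is, $e_\lambda\in\mathcal H_\phi$ is idempotent and left multiplication by it induces the identity on $\mathcal K_\lambda$ and zero on $\mathcal K_\mu$ for all $\mu\le\phi$, $\mu\neq\lambda$. For this family there is exactly one matrix $(A_{\lambda\kappa})_{\lambda,\kappa\le\phi}$ with $A_{\lambda\kappa}=0$ unless $\kappa\le\lambda$, and $$c_\lambda=\sum_{\kappa\le\lambda}A_{\lambda\kappa}\,e_\kappa\qquad(\lambda\le\phi).$$ For all $\kappa\le\lambda\le\phi$, $$A_{\lambda\kappa}=q^{\langle\phi'-\lambda',\,\Phi'-\phi'+\lambda'-\kappa'\rangle}\begin{bmatrix}\phi'_1-\kappa'_1\\ \phi'_1-\lambda'_1\end{bmatrix}_q\begin{bmatrix}\Phi'_1-\lambda'_1-\kappa'_1\\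 \phi'_1-\lambda'_1\end{bmatrix}_q\prod_{i\ge1}\begin{bmatrix}\lambda'_i-\kappa'_{i+1}\\ \lambda'_i-\lambda'_{i+1}\end{bmatrix}_q .$$ Here $\lambda'_j=|\{i:\lambda_i\ge j\}|$ for $j\ge1$, $\langle\alpha,\beta\rangle=\sum_{i\ge1}\alpha_i\beta_i$, and $\begin{bmatrix}a\\ b\end{bmatrix}_q=\dfrac{[a]_q!}{[b]_q!\,[a-b]_q!}$ for $0\le b\le a$, where $[k]_q!=\prod_{i=1}^k(1-q^{-i})$. -/

import Mathlib

noncomputable section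

namespace Grassmann

open IsLocalRing

/-! ### Partitions -/

/-- Partitions with at most `m` parts, all of them at most `ℓ`, ordered by inclusion of Young
diagrams (the pointwise order).  These are the types `λ ≤ (ℓ^m)`. -/
abbrev BoxPartition (m ℓ : ℕ) : Type := {l : Fin m → Fin (ℓ + 1) // Antitone l}

/-- The parts `λ_1 ≥ λ_2 ≥ ⋯ ≥ λ_m` of `λ`, as natural numbers. -/
def parts {m ℓ : ℕ} (l : BoxPartition m ℓ) : Fin m → ℕ := fun i => (l.1 i : ℕ)

/-- The rectangular partition `(ℓ^r) = (ℓ, …, ℓ)`. -/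
def rect (ℓ r : ℕ) : Fin r → ℕ := fun _ => ℓ

/-- The `j`-th part `λ'_j = |{i : λ_i ≥ j}|` of the transposed partition (used for `j ≥ 1`). -/
def conj {r : ℕ} (l : Fin r → ℕ) (j : ℕ) : ℕ := (Finset.univ.filter fun i => j ≤ l i).card

/-! ### `q`-factorials and `q`-binomial coefficients, normalized by `[n]_q = 1 - q^{-n}` -/

/-- `[k]_q! = [k]_q [k-1]_q ⋯ [1]_q`, where `[i]_q = 1 - q^{-i}`. -/
def qFactorial (q k : ℕ) : ℂ := ∏ i ∈ Finset.Icc 1 k, (1 - ((q : ℂ) ^ i)⁻¹)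

/-- `[a choose b]_q = [a]_q! / ([b]_q! [a-b]_q!)` for `0 ≤ b ≤ a` (and `0` if `a < b`). -/
def qBinom (q a b : ℕ) : ℂ :=
  if b ≤ a then qFactorial q a / (qFactorial q b * qFactorial q (a - b)) else 0

/-! ### Modules, types and Grassmannians -/

variable (O : Type*) [CommRing O] [IsDomain O] [IsDiscreteValuationRing O]

/-- The `O`-module `O_λ = ⊕ᵢ O/𝔪^{λ_i}`. -/
abbrev TypeModule {r : ℕ} (l : Fin r → ℕ) : Type _ := (i : Fin r) → O ⧸ (maximalIdeal O) ^ (l i)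

/-- The ambient module `E = O_Φ = (O/𝔪^ℓ)^n`, with `Φ = (ℓ^n)`. -/
abbrev Ambient (ℓ n : ℕ) : Type _ := Fin n → O ⧸ (maximalIdeal O) ^ ℓ

/-- `M` has type `λ`, i.e. `τ(M) = λ`: `M ≃ O_λ`. -/
def HasType {r : ℕ} (l : Fin r → ℕ) (M : Type*) [AddCommGroup M] [Module O M] : Prop :=
  Nonempty (M ≃ₗ[O] TypeModule O l)

/-- `X_λ = Gr(λ, E)`: the submodules of `E` of type `λ`.  (The `O`-submodules of `E` are the
same as its `O/𝔪^ℓ`-submodules.) -/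
abbrev Gr (ℓ n : ℕ) {r : ℕ} (l : Fin r → ℕ) : Type _ :=
  {x : Submodule O (Ambient O ℓ n) // HasType O l x}

/-- `F_λ = ℂ(X_λ)`. -/
abbrev FF (ℓ n : ℕ) {r : ℕ} (l : Fin r → ℕ) : Type _ := Gr O ℓ n l → ℂ

variable {O} in
/-- The action of an automorphism of `E` on `X_λ`. -/
def Gr.map {ℓ n r : ℕ} {l : Fin r → ℕ} (g : Ambient O ℓ n ≃ₗ[O] Ambient O ℓ n)
    (x : Gr O ℓ n l) : Gr O ℓ n l :=
  ⟨x.1.map (g : Ambient O ℓ n →ₗ[O] Ambient O ℓ n),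
    x.2.map fun e => (g.submoduleMap x.1).symm.trans e⟩

/-- The representation of `GL_n(O/𝔪^ℓ) = Aut(E)` on `F_λ`: `(g · h)(x) = h(g⁻¹ x)`. -/
def rep (ℓ n : ℕ) {r : ℕ} (l : Fin r → ℕ) (g : Ambient O ℓ n ≃ₗ[O] Ambient O ℓ n) :
    Module.End ℂ (FF O ℓ n l) :=
  LinearMap.funLeft ℂ ℂ (Gr.map g.symm)

/-- The Hecke algebra `H_φ = End_{GL_n(O/𝔪^ℓ)}(F_φ)`, with `φ = (ℓ^m)`. -/
def Hecke (ℓ n m : ℕ) : Subalgebra ℂ (Module.End ℂ (FF O ℓ n (rect ℓ m))) :=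
  Subalgebra.centralizer ℂ (Set.range (rep O ℓ n (rect ℓ m)))

variable [Finite (ResidueField O)]

instance finite_quotient (k : ℕ) : Finite (O ⧸ (maximalIdeal O) ^ k) :=
  haveI : Finite (O ⧸ maximalIdeal O) := ‹Finite (ResidueField O)›
  Ideal.finite_quotient_pow (IsNoetherian.noetherian (maximalIdeal O)) k

instance finite_submodule (ℓ n : ℕ) : Finite (Submodule O (Ambient O ℓ n)) :=
  Finite.of_injective (fun x => (x : Set (Ambient O ℓ n))) SetLike.coe_injective

instance fintypeGr (ℓ n : ℕ) {r : ℕ} (l : Fin r → ℕ) : Fintype (Gr O ℓ n l) :=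
  Fintype.ofFinite _

open Classical in
/-- The operator `F_λ → F_μ`, `h ↦ (y ↦ ∑_{x ⊂ y} h(x))`. -/
def up (ℓ n : ℕ) {r s : ℕ} (l : Fin r → ℕ) (u : Fin s → ℕ) : FF O ℓ n l →ₗ[ℂ] FF O ℓ n u where
  toFun h y := ∑ x : Gr O ℓ n l with x.1 ≤ y.1, h x
  map_add' h k := by ext y; simp [Finset.sum_add_distrib]
  map_smul' c h := by ext y; simp [Finset.mul_sum]

open Classical in
/-- The operator `F_μ → F_λ`, `h ↦ (x ↦ ∑_{y ⊃ x} h(y))`. -/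
def down (ℓ n : ℕ) {r s : ℕ} (u : Fin s → ℕ) (l : Fin r → ℕ) : FF O ℓ n u →ₗ[ℂ] FF O ℓ n l where
  toFun h x := ∑ y : Gr O ℓ n u with x.1 ≤ y.1, h y
  map_add' h k := by ext y; simp [Finset.sum_add_distrib]
  map_smul' c h := by ext y; simp [Finset.mul_sum]

/-! ### The cellular basis, the ideals `H_φ^λ` and the algebraic basis -/

/-- The cellular operator `c_λ : F_φ → F_λ → F_φ`. -/
def cellular (ℓ n m : ℕ) (l : BoxPartition m ℓ) : Module.End ℂ (FF O ℓ n (rect ℓ m)) :=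
  up O ℓ n (parts l) (rect ℓ m) ∘ₗ down O ℓ n (rect ℓ m) (parts l)

/-- `H_φ^λ = span {c_μ | μ ≤ λ}`. -/
def cellLE (ℓ n m : ℕ) (l : BoxPartition m ℓ) :
    Submodule ℂ (Module.End ℂ (FF O ℓ n (rect ℓ m))) :=
  Submodule.span ℂ (cellular O ℓ n m '' {u | u ≤ l})

/-- `H_φ^{λ⁻} = span {c_μ | μ < λ}`. -/
def cellLT (ℓ n m : ℕ) (l : BoxPartition m ℓ) :
    Submodule ℂ (Module.End ℂ (FF O ℓ n (rect ℓ m))) :=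
  Submodule.span ℂ (cellular O ℓ n m '' {u | u < l})

/-- `e` is the idempotent of `H_φ` corresponding to the irreducible representation
`K_λ = H_φ^λ / H_φ^{λ⁻}`: it acts as the identity on `K_λ` and as zero on `K_μ` for `μ ≠ λ`. -/
structure IsIdempotentOf (ℓ n m : ℕ) (l : BoxPartition m ℓ)
    (e : Module.End ℂ (FF O ℓ n (rect ℓ m))) : Prop where
  mem_hecke : e ∈ Hecke O ℓ n m
  idem : e * e = e
  act_self : ∀ h ∈ cellLE O ℓ n m l, e * h - h ∈ cellLT O ℓ n m l
  act_other : ∀ u : BoxPartition m ℓ, u ≠ l → ∀ h ∈ cellLE O ℓ n m u, e * h ∈ cellLT O ℓ n m u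

/-- `(e_λ)_{λ ≤ φ}` is the algebraic basis: `e_λ` is the idempotent corresponding to `K_λ`. -/
def IsAlgebraicBasis (ℓ n m : ℕ)
    (e : BoxPartition m ℓ → Module.End ℂ (FF O ℓ n (rect ℓ m))) : Prop :=
  ∀ l, IsIdempotentOf O ℓ n m l (e l)

/-- `A` is the transition matrix from the cellular basis to `(e_λ)`: it is lower triangular and
`c_λ = ∑_{κ ≤ λ} A_{λκ} e_κ`. -/
def IsTransitionMatrix (ℓ n m : ℕ)
    (e : BoxPartition m ℓ → Module.End ℂ (FF O ℓ n (rect ℓ m)))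
    (A : Matrix (BoxPartition m ℓ) (BoxPartition m ℓ) ℂ) : Prop :=
  (∀ l k, ¬ k ≤ l → A l k = 0) ∧ ∀ l, cellular O ℓ n m l = ∑ k, A l k • e k

/-! ### The closed form -/

/-- The pairing `⟨φ' - λ', Φ' - φ' + λ' - κ'⟩ = ∑_{i ≥ 1} (φ'_i - λ'_i)(Φ'_i - φ'_i + λ'_i - κ'_i)`
(all terms with `i > ℓ` vanish). -/
def exponent (ℓ n m : ℕ) (l k : BoxPartition m ℓ) : ℤ :=
  ∑ i ∈ Finset.Icc 1 ℓ, ((conj (rect ℓ m) i : ℤ) - conj (parts l) i) *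
    ((conj (rect ℓ n) i : ℤ) - conj (rect ℓ m) i + conj (parts l) i - conj (parts k) i)

/-- The product `∏_{i ≥ 1} [λ'_i - κ'_{i+1} choose λ'_i - λ'_{i+1}]_q` (all factors with `i > ℓ`
are `1`; for `κ ≤ λ` no subtraction is truncated). -/
def binomProd (q m ℓ : ℕ) (l k : BoxPartition m ℓ) : ℂ :=
  ∏ i ∈ Finset.Icc 1 ℓ, qBinom q (conj (parts l) i - conj (parts k) (i + 1))
    (conj (parts l) i - conj (parts l) (i + 1))

end Grassmann

end

/-!
The transition matrix is the matrix of eigenvalues of the cellular operators. Suppose that for each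
`κ ≤ φ` there is a nonzero function `h_κ` on `X_φ` with `c_λ h_κ = A_{λκ} h_κ` for every `λ`, where
`A` is lower triangular with nonzero diagonal. Triangularity makes the `c_λ` linearly independent.
On the other hand, two pairs of members of `X_φ` are conjugate under `Aut(E)` as soon as the
intersections are isomorphic, because `E` and the members of `X_φ` are injective modules over
`O/𝔪^ℓ`; hence the dimension of the Hecke algebra is at most the number of partitions `λ ≤ φ`
(`finrank_hecke_le`), and the `c_λ` form a basis of it. An element of the Hecke algebra is then
determined by its eigenvalues on the `h_κ`, so the algebra is `ℂ^{λ ≤ φ}`, the `e_κ` are its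
coordinate idempotents, and `c_λ = ∑ A_{λκ} e_κ` (`IsEigensystem.algebraicBasis`).

The eigenvectors are character sums. As `2 m ≤ n`, the module `E` contains a submodule `Z` of type
`κ` and a disjoint copy `C` of its socle. A homomorphism `t : Z → C` gives the twisted submodule
`Z_t = {z + t z}`, again of type `κ`. For a character `ψ` of `Hom(Z, C)` put
`h_κ(y) = ∑_t ψ(t) [Z_t ⊆ y]`. Choose `ψ` nondegenerate: nontrivial on the homomorphisms killing
any given proper submodule of `Z`, and on those with values in any given nonzero submodule of `C`
(`exists_isNondegenerate`). The second property makes `h_κ(y)` vanish when `y` meets `C`. Let `x`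
be a submodule disjoint from `C`, and sum `h_κ` over the `y ⊇ x` in `X_φ`. If `x` contains no
twist of `Z`, then the part `S` of `Z` lying in `x + C` is proper; every `d : Z → C` killing `S`
comes from a shear of `E` which fixes `x` and `C` and carries each `Z_t` to `Z_{t+d}`
(`exists_shear`), so the first property makes the sum vanish. If `x` does contain a twist of `Z`,
then the twists in a `y` disjoint from `C` are those in `x`, and the sum is `h_κ(x)` times the
number of such `y` (`sum_charSum_above`). Summing this over the `x` of type `λ` in a given `y`
shows that the eigenvalue is the number of `y ∈ X_φ` which contain a given `x` of type `λ` and are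
disjoint from `C`, times the number of `x` of type `λ` between a given copy of `Z` and a given `y`
(`cellular_charSum`).

Both numbers come from counting incident pairs of submodules in two ways (`ncard_free_above`,
`ncard_between`), which reduces them to numbers of embeddings. An embedding of `O_μ` is a tuple of
independent generators of prescribed orders, and such tuples are counted one generator at a time
(`card_tup`). The resulting quotient of products is the closed form (`eigenvalue_eq`).
-/

noncomputable section

set_option linter.unusedSectionVars false

namespace Grassmann

open IsLocalRing

/-! ### The Hecke algebra from a system of eigenvectors -/

section Eigenvectors

variable {O : Type*} [CommRing O] [IsDomain O] [IsDiscreteValuationRing O]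
  [Finite (ResidueField O)] {ℓ n m : ℕ}

/-- A system of common eigenvectors of the cellular operators whose eigenvalues form a triangular
matrix with nonzero diagonal. -/
structure IsEigensystem (A : BoxPartition m ℓ → BoxPartition m ℓ → ℂ)
    (h : BoxPartition m ℓ → FF O ℓ n (rect ℓ m)) : Prop where
  ne_zero : ∀ k, h k ≠ 0
  eigen : ∀ l k, cellular O ℓ n m l (h k) = A l k • h k
  triangular : ∀ l k, ¬ k ≤ l → A l k = 0
  diag_ne_zero : ∀ k, A k k ≠ 0

namespace IsEigensystem

variable {A : BoxPartition m ℓ → BoxPartition m ℓ → ℂ} {h : BoxPartition m ℓ → FF O ℓ n (rect ℓ m)}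

/-- Triangularity makes the rows of the matrix of eigenvalues independent. -/
theorem coeff_eq_zero (H : IsEigensystem A h) (b : BoxPartition m ℓ → ℂ)
    (hb : ∀ k, ∑ l, b l * A l k = 0) : b = 0 := by
  by_contra hne
  obtain ⟨k, hk⟩ := Function.ne_iff.1 hne
  -- a maximal index with nonzero coefficient contributes a single term
  obtain ⟨k, hkmax⟩ := Set.Finite.exists_maximal (Set.toFinite {k | b k ≠ 0}) ⟨k, hk⟩
  have := hb k
  rw [Finset.sum_eq_single k] at this
  · rcases mul_eq_zero.1 this with h1 | h1
    · exact hkmax.1 h1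
    · exact H.diag_ne_zero k h1
  · intro l _ hl
    by_cases hkl : k ≤ l
    · by_cases hbl : b l = 0
      · rw [hbl, zero_mul]
      · exact absurd (le_antisymm (hkmax.2 hbl hkl) hkl) hl
    · rw [H.triangular l k hkl, mul_zero]
  · simp

theorem linearIndependent (H : IsEigensystem A h) :
    LinearIndependent ℂ (cellular O ℓ n m) := by
  rw [Fintype.linearIndependent_iff]
  intro b hb l
  refine congrFun (H.coeff_eq_zero b fun k => ?_) l
  have h1 := congrArg (fun T : Module.End ℂ (FF O ℓ n (rect ℓ m)) => T (h k)) hb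
  simp only [LinearMap.sum_apply, LinearMap.smul_apply, H.eigen, smul_smul, ← Finset.sum_smul,
    LinearMap.zero_apply] at h1
  exact (smul_eq_zero.1 h1).resolve_right (H.ne_zero k)

theorem hecke_le_span (H : IsEigensystem A h) (hmem : ∀ l, cellular O ℓ n m l ∈ Hecke O ℓ n m)
    (hdim : Module.finrank ℂ (Hecke O ℓ n m) ≤ Fintype.card (BoxPartition m ℓ)) :
    Subalgebra.toSubmodule (Hecke O ℓ n m) ≤
      Submodule.span ℂ (Set.range (cellular O ℓ n m)) := by
  refine (Submodule.eq_of_le_of_finrank_le ?_ ?_).ge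
  · rw [Submodule.span_le]
    rintro _ ⟨l, rfl⟩
    exact hmem l
  · rw [finrank_span_eq_card H.linearIndependent]
    exact hdim

/-- The eigenvectors separate the elements of the Hecke algebra. -/
theorem eq_of_apply_eq (H : IsEigensystem A h) (hmem : ∀ l, cellular O ℓ n m l ∈ Hecke O ℓ n m)
    (hdim : Module.finrank ℂ (Hecke O ℓ n m) ≤ Fintype.card (BoxPartition m ℓ))
    {S T : Module.End ℂ (FF O ℓ n (rect ℓ m))} (hS : S ∈ Hecke O ℓ n m)
    (hT : T ∈ Hecke O ℓ n m) (hST : ∀ k, S (h k) = T (h k)) : S = T := by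
  have h1 : S - T ∈ Submodule.span ℂ (Set.range (cellular O ℓ n m)) :=
    H.hecke_le_span hmem hdim (sub_mem hS hT)
  obtain ⟨b, hb⟩ := (Submodule.mem_span_range_iff_exists_fun ℂ).1 h1
  have hb0 : b = 0 := by
    refine H.coeff_eq_zero b fun k => ?_
    have h1 := congrArg (fun T : Module.End ℂ (FF O ℓ n (rect ℓ m)) => T (h k)) hb
    simp only [LinearMap.sum_apply, LinearMap.smul_apply, H.eigen, smul_smul, ← Finset.sum_smul,
      LinearMap.sub_apply, hST, sub_self] at h1
    exact (smul_eq_zero.1 h1).resolve_right (H.ne_zero k)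
  rw [← sub_eq_zero, ← hb, hb0]
  simp

theorem exists_eigenvalue (H : IsEigensystem A h) (hmem : ∀ l, cellular O ℓ n m l ∈ Hecke O ℓ n m)
    (hdim : Module.finrank ℂ (Hecke O ℓ n m) ≤ Fintype.card (BoxPartition m ℓ))
    {S : Module.End ℂ (FF O ℓ n (rect ℓ m))} (hS : S ∈ Hecke O ℓ n m)
    (k : BoxPartition m ℓ) : ∃ x : ℂ, S (h k) = x • h k := by
  obtain ⟨b, rfl⟩ := (Submodule.mem_span_range_iff_exists_fun ℂ).1 (H.hecke_le_span hmem hdim hS)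
  exact ⟨∑ l, b l * A l k, by
    simp only [LinearMap.sum_apply, LinearMap.smul_apply, H.eigen, smul_smul, ← Finset.sum_smul]⟩

/-- The inverse of the matrix of eigenvalues produces elements of the Hecke algebra acting on the
eigenvectors as coordinate projections. -/
theorem exists_projections (H : IsEigensystem A h)
    (hmem : ∀ l, cellular O ℓ n m l ∈ Hecke O ℓ n m) :
    ∃ e : BoxPartition m ℓ → Module.End ℂ (FF O ℓ n (rect ℓ m)),
      (∀ l, e l ∈ Hecke O ℓ n m) ∧ ∀ l k, e l (h k) = if l = k then h k else 0 := by
  classical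
  have hA : IsUnit (Matrix.of A) := by
    rw [← Matrix.vecMul_injective_iff_isUnit]
    refine (injective_iff_map_eq_zero (Matrix.of A).vecMulLinear).2 fun b hb => ?_
    exact H.coeff_eq_zero b fun k => congrFun hb k
  refine ⟨fun l => ∑ u, (Matrix.of A)⁻¹ l u • cellular O ℓ n m u,
    fun l => sum_mem fun u _ => (Hecke O ℓ n m).smul_mem (hmem u) _, fun l k => ?_⟩
  have h1 : ∑ u, (Matrix.of A)⁻¹ l u * A u k = if l = k then 1 else 0 := by
    have := congrFun₂ (Matrix.nonsing_inv_mul (Matrix.of A)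
      ((Matrix.isUnit_iff_isUnit_det _).1 hA)) l k
    rwa [Matrix.mul_apply, Matrix.one_apply] at this
  simp only [LinearMap.sum_apply, LinearMap.smul_apply, H.eigen, smul_smul, ← Finset.sum_smul, h1]
  split_ifs <;> simp

theorem apply_of_mem_cellLT (H : IsEigensystem A h) {k : BoxPartition m ℓ}
    {T : Module.End ℂ (FF O ℓ n (rect ℓ m))} (hT : T ∈ cellLT O ℓ n m k) : T (h k) = 0 := by
  induction hT using Submodule.span_induction with
  | mem T hT =>
    obtain ⟨u, hu, rfl⟩ := hT
    rw [H.eigen, H.triangular u k (not_le_of_gt hu), zero_smul]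
  | zero => rfl
  | add S T _ _ hS hT => rw [LinearMap.add_apply, hS, hT, add_zero]
  | smul a T _ hT => rw [LinearMap.smul_apply, hT, smul_zero]

/-- An eigensystem determines the algebraic basis and identifies the transition matrix with the
matrix of eigenvalues. -/
theorem algebraicBasis (H : IsEigensystem A h)
    (hmem : ∀ l, cellular O ℓ n m l ∈ Hecke O ℓ n m)
    (hdim : Module.finrank ℂ (Hecke O ℓ n m) ≤ Fintype.card (BoxPartition m ℓ)) :
    (∃! e, IsAlgebraicBasis O ℓ n m e) ∧ ∀ e, IsAlgebraicBasis O ℓ n m e →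
      ∀ B, IsTransitionMatrix O ℓ n m e B ↔ B = Matrix.of A := by
  classical
  obtain ⟨e, heH, he⟩ := H.exists_projections hmem
  have expand : ∀ l, cellular O ℓ n m l = ∑ k, A l k • e k := by
    intro l
    refine H.eq_of_apply_eq hmem hdim (hmem l)
      (sum_mem fun u _ => (Hecke O ℓ n m).smul_mem (heH u) _) fun k => ?_
    simp only [LinearMap.sum_apply, LinearMap.smul_apply, H.eigen, he, smul_ite, smul_zero,
      Finset.sum_ite_eq', Finset.mem_univ, if_true]
  have hmono : ∀ {k l : BoxPartition m ℓ}, k < l → cellLE O ℓ n m k ≤ cellLT O ℓ n m l :=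
    fun hkl => Submodule.span_mono (Set.image_mono fun u hu => lt_of_le_of_lt hu hkl)
  -- the part of the expansion below the diagonal
  have lower : ∀ l, (∀ k < l, e k ∈ cellLE O ℓ n m k) →
      A l l • e l - cellular O ℓ n m l ∈ cellLT O ℓ n m l := by
    intro l ih
    have : A l l • e l - cellular O ℓ n m l = -∑ k ∈ Finset.univ.erase l, A l k • e k := by
      rw [expand l, ← Finset.add_sum_erase _ _ (Finset.mem_univ l)]
      abel
    rw [this]
    refine neg_mem (sum_mem fun k hk => ?_)
    by_cases hkl : k ≤ l
    · have hlt := lt_of_le_of_ne hkl (Finset.ne_of_mem_erase hk)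
      exact Submodule.smul_mem _ _ (hmono hlt (ih k hlt))
    · rw [H.triangular l k hkl, zero_smul]
      exact zero_mem _
  have hLTLE : ∀ l : BoxPartition m ℓ, cellLT O ℓ n m l ≤ cellLE O ℓ n m l :=
    fun l => Submodule.span_mono (Set.image_mono fun u (hu : u < l) => hu.le)
  have hcell : ∀ l, cellular O ℓ n m l ∈ cellLE O ℓ n m l :=
    fun l => Submodule.subset_span ⟨l, le_refl l, rfl⟩
  have hmemLE : ∀ l, e l ∈ cellLE O ℓ n m l := by
    intro l
    induction l using WellFoundedLT.induction with
    | ind l ih =>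
      have h1 := add_mem (hLTLE l (lower l ih)) (hcell l)
      rw [sub_add_cancel] at h1
      exact (Submodule.smul_mem_iff _ (H.diag_ne_zero l)).1 h1
  have mulc : ∀ l u, e l * cellular O ℓ n m u = A u l • e l := by
    intro l u
    refine H.eq_of_apply_eq hmem hdim (mul_mem (heH l) (hmem u))
      ((Hecke O ℓ n m).smul_mem (heH l) _) fun k => ?_
    simp only [Module.End.mul_apply, H.eigen, map_smul, LinearMap.smul_apply, he]
    split_ifs with hlk
    · rw [hlk]
    · simp
  have basis : IsAlgebraicBasis O ℓ n m e := by
    intro l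
    refine ⟨heH l, ?_, ?_, ?_⟩
    · refine H.eq_of_apply_eq hmem hdim (mul_mem (heH l) (heH l)) (heH l) fun k => ?_
      simp only [Module.End.mul_apply, he]
      split_ifs with hlk
      · rw [he, if_pos hlk]
      · simp
    · intro T hT
      induction hT using Submodule.span_induction with
      | mem T hT =>
        obtain ⟨u, hu, rfl⟩ := hT
        rw [mulc]
        rcases eq_or_lt_of_le (show u ≤ l from hu) with rfl | hlt
        · exact lower u fun k _ => hmemLE k
        · rw [H.triangular u l (not_le_of_gt hlt), zero_smul, zero_sub]
          exact neg_mem (hmono hlt (hcell u))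
      | zero => simp
      | add S T _ _ hS hT =>
        rw [mul_add, add_sub_add_comm]
        exact add_mem hS hT
      | smul a T _ hT =>
        rw [mul_smul_comm, ← smul_sub]
        exact Submodule.smul_mem _ _ hT
    · intro u hul T hT
      induction hT using Submodule.span_induction with
      | mem T hT =>
        obtain ⟨v, hv, rfl⟩ := hT
        rw [mulc]
        by_cases hlv : l ≤ v
        · exact Submodule.smul_mem _ _
            (hmono (lt_of_le_of_ne (hlv.trans hv) (Ne.symm hul)) (hmemLE l))
        · rw [H.triangular v l hlv, zero_smul]
          exact zero_mem _
      | zero => simp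
      | add S T _ _ hS hT =>
        rw [mul_add]
        exact add_mem hS hT
      | smul a T _ hT =>
        rw [mul_smul_comm]
        exact Submodule.smul_mem _ _ hT
  have unique : ∀ f, IsAlgebraicBasis O ℓ n m f → f = e := by
    intro f hf
    funext l
    refine H.eq_of_apply_eq hmem hdim (hf l).mem_hecke (heH l) fun k => ?_
    obtain ⟨x, hx⟩ := H.exists_eigenvalue hmem hdim (hf l).mem_hecke k
    by_cases hlk : l = k
    · subst hlk
      have h1 := H.apply_of_mem_cellLT ((hf l).act_self (e l) (hmemLE l))
      rw [LinearMap.sub_apply, Module.End.mul_apply, he, if_pos rfl, sub_eq_zero] at h1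
      rw [h1, he, if_pos rfl]
    · have h1 := H.apply_of_mem_cellLT ((hf l).act_other k (Ne.symm hlk) (e k) (hmemLE k))
      rw [Module.End.mul_apply, he, if_pos rfl] at h1
      rw [h1, he, if_neg hlk]
  refine ⟨⟨e, basis, unique⟩, fun f hf B => ?_⟩
  obtain rfl := unique f hf
  constructor
  · rintro ⟨-, hB⟩
    ext l k
    have h1 := congrArg (fun T : Module.End ℂ (FF O ℓ n (rect ℓ m)) => T (h k)) (hB l)
    simp only [LinearMap.sum_apply, LinearMap.smul_apply, H.eigen, he, smul_ite, smul_zero,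
      Finset.sum_ite_eq', Finset.mem_univ, if_true] at h1
    exact (smul_left_injective ℂ (H.ne_zero k) h1).symm
  · rintro rfl
    exact ⟨H.triangular, expand⟩

end IsEigensystem

end Eigenvectors

/-! ### Extension of partial maps into uniform modules -/

section Extension

variable {O : Type*} [CommRing O] [IsDomain O] [IsDiscreteValuationRing O] {ϖ : O}
  {M N : Type*} [AddCommGroup M] [Module O M] [AddCommGroup N] [Module O N]

theorem isUnit_or_dvd (hϖ : Irreducible ϖ) (a : O) : IsUnit a ∨ ∃ b, a = b * ϖ := by
  by_cases ha : IsUnit a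
  · exact Or.inl ha
  · right
    have h1 : a ∈ maximalIdeal O := ha
    rw [hϖ.maximalIdeal_eq, Ideal.mem_span_singleton'] at h1
    obtain ⟨b, hb⟩ := h1
    exact ⟨b, hb.symm⟩

theorem smul_mem_iff_of_isUnit {S : Submodule O M} {a : O} (ha : IsUnit a) {x : M} :
    a • x ∈ S ↔ x ∈ S := by
  obtain ⟨u, rfl⟩ := ha
  exact Submodule.smul_mem_iff' S u

theorem exists_pow_smul_notMem {S : Submodule O M} {x : M} (hx : x ∉ S) {k : ℕ}
    (hk : ϖ ^ k • x ∈ S) : ∃ j, ϖ ^ j • x ∉ S ∧ ϖ • ϖ ^ j • x ∈ S := by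
  classical
  have hex : ∃ k, ϖ ^ k • x ∈ S := ⟨k, hk⟩
  rcases hfind : Nat.find hex with _ | j
  · have := Nat.find_spec hex
    rw [hfind, pow_zero, one_smul] at this
    exact absurd this hx
  · refine ⟨j, Nat.find_min hex (by omega), ?_⟩
    have := Nat.find_spec hex
    rwa [hfind, pow_succ', mul_smul] at this

variable (ϖ) in
/-- A module killed by `ϖ ^ ℓ` in which every element killed by `ϖ ^ (ℓ - 1)` is divisible by `ϖ`.
The free modules over `O / (ϖ ^ ℓ)` have this property. -/
structure IsUniform (ℓ : ℕ) (M : Type*) [AddCommGroup M] [Module O M] : Prop where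
  pow_smul : ∀ x : M, ϖ ^ ℓ • x = 0
  exists_smul : ∀ x : M, ϖ ^ (ℓ - 1) • x = 0 → ∃ y, ϖ • y = x

theorem IsUniform.of_equiv {ℓ : ℕ} (h : IsUniform ϖ ℓ M) (e : M ≃ₗ[O] N) : IsUniform ϖ ℓ N where
  pow_smul x := e.symm.injective (by simp [h.pow_smul])
  exists_smul x hx := by
    obtain ⟨y, hy⟩ := h.exists_smul (e.symm x) (by rw [← map_smul, hx, map_zero])
    exact ⟨e y, by rw [← map_smul, hy, e.apply_symm_apply]⟩

/-- Partial linear maps extend by one element `x` with `ϖ • x` in the domain, the value of the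
extension at `x` being any solution `v` of the evident equation. -/
theorem exists_extension_step (hϖ : Irreducible ϖ) (f : M →ₗ.[O] N) {x : M} (hx : x ∉ f.domain)
    (hϖx : ϖ • x ∈ f.domain) {v : N} (hv : ϖ • v = f ⟨ϖ • x, hϖx⟩) :
    ∃ g : M →ₗ.[O] N, f ≤ g ∧ g.domain = f.domain ⊔ Submodule.span O {x} ∧
      ∀ h : x ∈ g.domain, g ⟨x, h⟩ = v := by
  have key : ∀ (c : O) (d : f.domain), (d : M) = c • x → f d = c • v := by
    intro c d hd
    rcases isUnit_or_dvd hϖ c with hc | ⟨b, rfl⟩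
    · exact absurd ((smul_mem_iff_of_isUnit hc).1 (hd ▸ d.2)) hx
    · have : d = b • (⟨ϖ • x, hϖx⟩ : f.domain) := Subtype.ext (by simp [hd, mul_smul])
      rw [this, f.map_smul, ← hv, mul_smul]
  have H : ∀ c : O, c • x = 0 → (RingHom.id O) c • v = 0 := by
    intro c hc
    have := key c 0 (by simp [hc])
    rw [f.map_zero] at this
    exact this.symm
  have agree : ∀ (d : f.domain) (y : (LinearPMap.mkSpanSingleton' x v H).domain),
      (d : M) = y → f d = LinearPMap.mkSpanSingleton' x v H y := by
    rintro d ⟨y, hy⟩ hdy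
    obtain ⟨c, rfl⟩ := Submodule.mem_span_singleton.1 hy
    rw [LinearPMap.mkSpanSingleton'_apply]
    exact key c d hdy
  refine ⟨f.sup _ agree, f.left_le_sup _ agree, rfl, fun h => ?_⟩
  have h1 := (f.right_le_sup _ agree).2 (x := ⟨x, Submodule.mem_span_singleton_self x⟩)
    (y := ⟨x, h⟩) rfl
  rw [← h1]
  exact LinearPMap.mkSpanSingleton'_apply_self x v H _

theorem exists_smul_eq_apply {ℓ : ℕ} (hM : ∀ x : M, ϖ ^ ℓ • x = 0) (hN : IsUniform ϖ ℓ N)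
    (f : M →ₗ.[O] N) {x : M} (hx : ϖ • x ∈ f.domain) : ∃ v, ϖ • v = f ⟨ϖ • x, hx⟩ := by
  refine hN.exists_smul _ ?_
  rcases Nat.eq_zero_or_pos ℓ with rfl | hℓ
  · simpa using hN.pow_smul (f ⟨ϖ • x, hx⟩)
  · rw [← f.map_smul]
    have : ϖ ^ (ℓ - 1) • (⟨ϖ • x, hx⟩ : f.domain) = 0 := by
      ext
      simp only [SetLike.mk_smul_mk, ZeroMemClass.coe_zero, smul_smul]
      rw [← pow_succ, Nat.sub_add_cancel hℓ, hM]
    rw [this, f.map_zero]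

/-- Uniform modules are injective among the modules killed by `ϖ ^ ℓ`. -/
theorem exists_extension [Finite M] (hϖ : Irreducible ϖ) {ℓ : ℕ} (hM : ∀ x : M, ϖ ^ ℓ • x = 0)
    (hN : IsUniform ϖ ℓ N) (f : M →ₗ.[O] N) : ∃ g : M →ₗ[O] N, ∀ x : f.domain, g x = f x := by
  obtain ⟨S, hd⟩ : ∃ S, f.domain = S := ⟨_, rfl⟩
  induction S using WellFoundedGT.induction generalizing f with
  | ind S ih =>
    by_cases htop : f.domain = ⊤
    · exact ⟨f.toFun ∘ₗ LinearMap.codRestrict f.domain LinearMap.id (fun x => htop ▸ trivial),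
        fun x => rfl⟩
    · obtain ⟨x₀, -, hx₀⟩ := SetLike.exists_of_lt (lt_top_iff_ne_top.2 htop)
      obtain ⟨j, hj, hj'⟩ := exists_pow_smul_notMem hx₀ (k := ℓ) (ϖ := ϖ)
        (by rw [hM]; exact zero_mem _)
      obtain ⟨v, hv⟩ := exists_smul_eq_apply hM hN f hj'
      obtain ⟨g, hfg, hgd, -⟩ := exists_extension_step hϖ f hj hj' hv
      obtain ⟨k, hk⟩ := ih g.domain (by
        rw [← hd, hgd]
        exact left_lt_sup.2 fun h => hj (h (Submodule.mem_span_singleton_self _))) g rfl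
      refine ⟨k, fun y => ?_⟩
      rw [hfg.2 (x := y) (y := ⟨y, hfg.1 y.2⟩) rfl]
      exact hk ⟨y, hfg.1 y.2⟩

/-- An injective partial map into a uniform module extends to an injective map if the socle of the
target is large enough: the map is extended to the socle of the source first, after which every
extension is injective. -/
theorem exists_injective_extension [Finite M] [Finite N] (hϖ : Irreducible ϖ) {ℓ : ℕ}
    (hM : ∀ x : M, ϖ ^ ℓ • x = 0) (hN : IsUniform ϖ ℓ N)
    (hcard : Nat.card (Submodule.torsionBy O M ϖ) ≤ Nat.card (Submodule.torsionBy O N ϖ))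
    (f : M →ₗ.[O] N) (hf : ∀ x, f x = 0 → x = 0) :
    ∃ g : M →ₗ[O] N, Function.Injective g ∧ ∀ x : f.domain, g x = f x := by
  obtain ⟨S, hd⟩ : ∃ S, f.domain = S := ⟨_, rfl⟩
  induction S using WellFoundedGT.induction generalizing f with
  | ind S ih =>
    by_cases htop : f.domain = ⊤
    · refine ⟨f.toFun ∘ₗ LinearMap.codRestrict f.domain LinearMap.id (fun x => htop ▸ trivial),
        (injective_iff_map_eq_zero _).2 fun x hx => ?_, fun x => rfl⟩
      exact congrArg Subtype.val (hf ⟨x, htop ▸ trivial⟩ hx)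
    have hfinj : ∀ x y : f.domain, f x = f y → x = y := fun x y hxy =>
      sub_eq_zero.1 (hf _ (by rw [f.map_sub, hxy, sub_self]))
    obtain ⟨x, hx, hϖx, v, hv, hinj⟩ : ∃ x, x ∉ f.domain ∧ ∃ h : ϖ • x ∈ f.domain, ∃ v,
        ϖ • v = f ⟨ϖ • x, h⟩ ∧ ∀ g : M →ₗ.[O] N, f ≤ g →
          g.domain = f.domain ⊔ Submodule.span O {x} → (∀ h : x ∈ g.domain, g ⟨x, h⟩ = v) →
          ∀ y, g y = 0 → y = 0 := by
      by_cases hsoc : Submodule.torsionBy O M ϖ ≤ f.domain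
      · obtain ⟨x₀, -, hx₀⟩ := SetLike.exists_of_lt (lt_top_iff_ne_top.2 htop)
        obtain ⟨j, hj, hj'⟩ := exists_pow_smul_notMem hx₀ (k := ℓ) (ϖ := ϖ)
          (by rw [hM]; exact zero_mem _)
        obtain ⟨v, hv⟩ := exists_smul_eq_apply hM hN f hj'
        refine ⟨_, hj, hj', v, hv, fun g hfg _ _ y hy => ?_⟩
        by_contra hy0
        obtain ⟨i, hi, hi'⟩ := exists_pow_smul_notMem (S := (⊥ : Submodule O g.domain)) (x := y)
          (ϖ := ϖ) (by simpa using hy0) (k := ℓ) (by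
            rw [Submodule.mem_bot]; ext; exact hM y)
        rw [Submodule.mem_bot] at hi hi'
        have hmem : ((ϖ ^ i • y : g.domain) : M) ∈ f.domain := hsoc (by
          rw [Submodule.mem_torsionBy_iff]; exact congrArg Subtype.val hi')
        have h1 := hfg.2 (x := ⟨_, hmem⟩) (y := ϖ ^ i • y) rfl
        rw [g.map_smul, hy, smul_zero] at h1
        exact hi (Subtype.ext (show ((ϖ ^ i • y : g.domain) : M) = 0 from
          congrArg Subtype.val (hf ⟨_, hmem⟩ h1)))
      · obtain ⟨x, hxs, hx⟩ := SetLike.not_le_iff_exists.1 hsoc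
        rw [Submodule.mem_torsionBy_iff] at hxs
        obtain ⟨w, hw, hw'⟩ : ∃ w : N, ϖ • w = 0 ∧ ∀ d, f d ≠ w := by
          by_contra! hcon
          choose d hd using fun w : Submodule.torsionBy O N ϖ => hcon w
            ((Submodule.mem_torsionBy_iff _ _).1 w.2)
          have hdsoc : ∀ w, (d w : M) ∈ Submodule.torsionBy O M ϖ := fun w => by
            rw [Submodule.mem_torsionBy_iff]
            have : ϖ • d w = 0 := hf _ (by
              rw [f.map_smul, hd]; exact (Submodule.mem_torsionBy_iff _ _).1 w.2)
            exact congrArg Subtype.val this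
          have hbij := Function.Injective.bijective_of_nat_card_le
            (f := fun w => (⟨d w, hdsoc w⟩ : Submodule.torsionBy O M ϖ)) (fun w w' hww => by
              have : d w = d w' := Subtype.ext (Subtype.mk.inj hww)
              exact Subtype.ext (by rw [← hd w, ← hd w', this])) hcard
          obtain ⟨w, hw⟩ := hbij.2 ⟨x, (Submodule.mem_torsionBy_iff _ _).2 hxs⟩
          have hdw : (d w : M) = x := congrArg Subtype.val hw
          exact hx (hdw ▸ (d w).2)
        have hx0 : ϖ • x ∈ f.domain := by rw [hxs]; exact zero_mem _
        refine ⟨x, hx, hx0, w, ?_, fun g hfg hgd hgx y hy => ?_⟩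
        · have : (⟨ϖ • x, hx0⟩ : f.domain) = 0 := Subtype.ext hxs
          rw [this, f.map_zero, hw]
        · obtain ⟨y, hyd⟩ := y
          obtain ⟨s, hs, z, hz, rfl⟩ := Submodule.mem_sup.1 (hgd ▸ hyd)
          obtain ⟨c, rfl⟩ := Submodule.mem_span_singleton.1 hz
          have hxd : x ∈ g.domain := hgd ▸ Submodule.mem_sup_right
            (Submodule.mem_span_singleton_self x)
          have h1 : (⟨s + c • x, hyd⟩ : g.domain) = ⟨s, hfg.1 hs⟩ + c • ⟨x, hxd⟩ := rfl
          have h2 := hfg.2 (x := ⟨s, hs⟩) (y := ⟨s, hfg.1 hs⟩) rfl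
          rw [h1, g.map_add, g.map_smul, hgx, ← h2] at hy
          rcases isUnit_or_dvd hϖ c with ⟨u, rfl⟩ | ⟨b, rfl⟩
          · exfalso
            refine hw' (-((u⁻¹ : Oˣ) : O) • ⟨s, hs⟩) ?_
            rw [f.map_smul, eq_neg_of_add_eq_zero_left hy, neg_smul_neg, smul_smul, Units.inv_mul,
              one_smul]
          · rw [mul_smul, hw, smul_zero, add_zero] at hy
            ext
            have h3 := congrArg Subtype.val (hf _ hy)
            simp only [ZeroMemClass.coe_zero] at h3
            simp [h3, mul_smul, hxs]
    obtain ⟨g, hfg, hgd, hgx⟩ := exists_extension_step hϖ f hx hϖx hv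
    obtain ⟨k, hkinj, hk⟩ := ih g.domain (by
      rw [← hd, hgd]
      exact left_lt_sup.2 fun h => hx (h (Submodule.mem_span_singleton_self _))) g
      (hinj g hfg hgd hgx) rfl
    refine ⟨k, hkinj, fun y => ?_⟩
    rw [hfg.2 (x := y) (y := ⟨y, hfg.1 y.2⟩) rfl]
    exact hk ⟨y, hfg.1 y.2⟩

/-- Injective partial endomorphisms of a uniform module extend to automorphisms. -/
theorem exists_equiv_extension [Finite M] (hϖ : Irreducible ϖ) {ℓ : ℕ} (hM : IsUniform ϖ ℓ M)
    (f : M →ₗ.[O] M) (hf : ∀ x, f x = 0 → x = 0) :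
    ∃ g : M ≃ₗ[O] M, ∀ x : f.domain, g x = f x := by
  obtain ⟨g, hg, hgf⟩ := exists_injective_extension hϖ hM.pow_smul hM le_rfl f hf
  exact ⟨LinearEquiv.ofBijective g ⟨hg, Finite.injective_iff_surjective.1 hg⟩, hgf⟩

end Extension

/-! ### Torsion counts and existence of types -/

section Types

variable {O : Type*} [CommRing O] [IsDomain O] [IsDiscreteValuationRing O] {ϖ : O}
  {M N : Type*} [AddCommGroup M] [Module O M] [AddCommGroup N] [Module O N]

theorem mk_eq_zero_iff_pow_dvd (hϖ : Irreducible ϖ) {k : ℕ} {a : O} :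
    (Submodule.Quotient.mk a : O ⧸ maximalIdeal O ^ k) = 0 ↔ ϖ ^ k ∣ a := by
  rw [Submodule.Quotient.mk_eq_zero, hϖ.maximalIdeal_eq, Ideal.span_singleton_pow,
    Ideal.mem_span_singleton]

theorem pow_dvd_of_smul_eq_zero (hϖ : Irreducible ϖ) {e : ℕ} {v : M} (hv : ϖ ^ e • v ≠ 0) {a : O}
    (ha : a • v = 0) : ϖ ^ (e + 1) ∣ a := by
  by_cases ha0 : a = 0
  · rw [ha0]; exact dvd_zero _
  obtain ⟨k, u, rfl⟩ := IsDiscreteValuationRing.eq_unit_mul_pow_irreducible ha0 hϖ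
  have h1 : ϖ ^ k • v = 0 := by
    rw [mul_smul] at ha
    exact (smul_eq_zero_iff_eq u).1 ha
  have hek : e < k := by
    by_contra! hke
    apply hv
    rw [← Nat.sub_add_cancel hke, pow_add, mul_smul, h1, smul_zero]
  exact Dvd.dvd.mul_left (pow_dvd_pow _ hek) _

theorem pow_smul_quotient (hϖ : Irreducible ϖ) (k : ℕ) (x : O ⧸ maximalIdeal O ^ k) :
    ϖ ^ k • x = 0 := by
  obtain ⟨a, rfl⟩ := Submodule.Quotient.mk_surjective _ x
  rw [← Submodule.Quotient.mk_smul, mk_eq_zero_iff_pow_dvd hϖ]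
  exact dvd_mul_right _ _

/-- The linear map `O / (ϖ ^ k) → M` sending `1` to an element `w` killed by `ϖ ^ k`. -/
def cyclicMap (hϖ : Irreducible ϖ) {k : ℕ} (w : M) (hw : ϖ ^ k • w = 0) :
    (O ⧸ maximalIdeal O ^ k) →ₗ[O] M :=
  Submodule.liftQ _ (LinearMap.toSpanSingleton O M w) fun a ha => by
    rw [← Submodule.Quotient.mk_eq_zero, mk_eq_zero_iff_pow_dvd hϖ] at ha
    obtain ⟨b, rfl⟩ := ha
    rw [LinearMap.mem_ker, LinearMap.toSpanSingleton_apply, mul_comm, mul_smul, hw, smul_zero]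

theorem cyclicMap_mk (hϖ : Irreducible ϖ) {k : ℕ} (w : M) (hw : ϖ ^ k • w = 0) (a : O) :
    cyclicMap hϖ w hw (Submodule.Quotient.mk a) = a • w := rfl

theorem isUniform_quotient (hϖ : Irreducible ϖ) (k : ℕ) :
    IsUniform ϖ k (O ⧸ maximalIdeal O ^ k) where
  pow_smul := pow_smul_quotient hϖ k
  exists_smul x hx := by
    obtain ⟨a, rfl⟩ := Submodule.Quotient.mk_surjective _ x
    rcases k with _ | k
    · exact ⟨0, by rw [smul_zero, eq_comm, mk_eq_zero_iff_pow_dvd hϖ, pow_zero]; exact one_dvd _⟩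
    · rw [← Submodule.Quotient.mk_smul, mk_eq_zero_iff_pow_dvd hϖ, Nat.add_sub_cancel, pow_succ,
        smul_eq_mul] at hx
      obtain ⟨b, rfl⟩ := (mul_dvd_mul_iff_left (pow_ne_zero k hϖ.ne_zero)).1 hx
      exact ⟨Submodule.Quotient.mk b, rfl⟩

theorem isUniform_pi {ι : Type*} {k : ℕ} {Q : ι → Type*} [∀ i, AddCommGroup (Q i)]
    [∀ i, Module O (Q i)] (h : ∀ i, IsUniform ϖ k (Q i)) : IsUniform ϖ k (∀ i, Q i) where
  pow_smul x := funext fun i => (h i).pow_smul (x i)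
  exists_smul x hx := by
    choose y hy using fun i => (h i).exists_smul (x i) (congrFun hx i)
    exact ⟨y, funext hy⟩

theorem isUniform_ambient (hϖ : Irreducible ϖ) (ℓ r : ℕ) : IsUniform ϖ ℓ (Ambient O ℓ r) :=
  isUniform_pi fun _ => isUniform_quotient hϖ ℓ

theorem HasType.isUniform (hϖ : Irreducible ϖ) {ℓ r : ℕ} (h : HasType O (rect ℓ r) M) :
    IsUniform ϖ ℓ M :=
  (isUniform_ambient hϖ ℓ r).of_equiv h.some.symm

theorem HasType.congr {r : ℕ} {l : Fin r → ℕ} (h : HasType O l M) (e : M ≃ₗ[O] N) :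
    HasType O l N :=
  ⟨e.symm.trans h.some⟩

theorem pow_smul_typeModule (hϖ : Irreducible ϖ) {r k : ℕ} {l : Fin r → ℕ} (hl : ∀ i, l i ≤ k)
    (x : TypeModule O l) : ϖ ^ k • x = 0 := by
  funext i
  rw [Pi.smul_apply, ← Nat.sub_add_cancel (hl i), pow_add, mul_smul, pow_smul_quotient hϖ,
    smul_zero, Pi.zero_apply]

theorem card_quotient_pow (k : ℕ) :
    Nat.card (O ⧸ maximalIdeal O ^ k) = Nat.card (ResidueField O) ^ k := by
  have h1 := cardQuot_pow_of_prime (P := maximalIdeal O) (i := k)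
    (IsDiscreteValuationRing.not_a_field O)
  rwa [Submodule.cardQuot_apply, Submodule.cardQuot_apply] at h1

/-- The `ϖ ^ j`-torsion of `O / (ϖ ^ k)` is the image of `ϖ ^ (k - j)`. -/
theorem card_torsionBy_quotient (hϖ : Irreducible ϖ) (j k : ℕ) :
    Nat.card (Submodule.torsionBy O (O ⧸ maximalIdeal O ^ k) (ϖ ^ j)) =
      Nat.card (ResidueField O) ^ min j k := by
  rcases le_total k j with hkj | hjk
  · rw [min_eq_right hkj, ← card_quotient_pow]
    refine Nat.card_congr (Equiv.subtypeUnivEquiv fun x => ?_)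
    rw [Submodule.mem_torsionBy_iff, ← Nat.sub_add_cancel hkj, pow_add, mul_smul,
      pow_smul_quotient hϖ, smul_zero]
  · rw [min_eq_left hjk, ← card_quotient_pow]
    let f : O →ₗ[O] O ⧸ maximalIdeal O ^ k :=
      Submodule.mkQ _ ∘ₗ LinearMap.mulLeft O (ϖ ^ (k - j))
    have hf : ∀ a, f a = Submodule.Quotient.mk (ϖ ^ (k - j) * a) := fun a => rfl
    have hpow : ϖ ^ k = ϖ ^ (k - j) * ϖ ^ j := by rw [← pow_add, Nat.sub_add_cancel hjk]
    have hker : LinearMap.ker f = maximalIdeal O ^ j := by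
      ext a
      rw [LinearMap.mem_ker, hf, mk_eq_zero_iff_pow_dvd hϖ, hpow,
        mul_dvd_mul_iff_left (pow_ne_zero _ hϖ.ne_zero), ← mk_eq_zero_iff_pow_dvd hϖ,
        Submodule.Quotient.mk_eq_zero]
    have hrange : LinearMap.range f = Submodule.torsionBy O _ (ϖ ^ j) := by
      ext x
      rw [Submodule.mem_torsionBy_iff]
      constructor
      · rintro ⟨a, rfl⟩
        rw [hf, ← Submodule.Quotient.mk_smul, mk_eq_zero_iff_pow_dvd hϖ, smul_eq_mul,
          mul_left_comm, ← mul_assoc, ← hpow]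
        exact dvd_mul_right _ _
      · obtain ⟨a, rfl⟩ := Submodule.Quotient.mk_surjective _ x
        intro hx
        rw [← Submodule.Quotient.mk_smul, mk_eq_zero_iff_pow_dvd hϖ, hpow, smul_eq_mul,
          mul_comm (ϖ ^ j), mul_dvd_mul_iff_right (pow_ne_zero _ hϖ.ne_zero)] at hx
        obtain ⟨b, rfl⟩ := hx
        exact ⟨b, rfl⟩
    rw [← hrange, ← hker]
    exact Nat.card_congr f.quotKerEquivRange.symm.toEquiv

theorem card_torsionBy_congr (e : M ≃ₗ[O] N) (a : O) :
    Nat.card (Submodule.torsionBy O M a) = Nat.card (Submodule.torsionBy O N a) := by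
  refine Nat.card_congr (e.toEquiv.subtypeEquiv fun x => ?_)
  simp only [Submodule.mem_torsionBy_iff, LinearEquiv.coe_toEquiv, ← map_smul,
    LinearEquiv.map_eq_zero_iff]

theorem card_torsionBy_prod (a : O) :
    Nat.card (Submodule.torsionBy O (M × N) a) =
      Nat.card (Submodule.torsionBy O M a) * Nat.card (Submodule.torsionBy O N a) := by
  rw [← Nat.card_prod]
  refine Nat.card_congr ⟨fun x => (⟨x.1.1, ?_⟩, ⟨x.1.2, ?_⟩), fun x => ⟨(x.1.1, x.2.1), ?_⟩,
    fun x => rfl, fun x => rfl⟩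
  · exact congrArg Prod.fst ((Submodule.mem_torsionBy_iff _ _).1 x.2)
  · exact congrArg Prod.snd ((Submodule.mem_torsionBy_iff _ _).1 x.2)
  · exact (Submodule.mem_torsionBy_iff _ _).2 (Prod.ext x.1.2 x.2.2)

theorem card_torsionBy_pi {ι : Type*} [Fintype ι] {Q : ι → Type*} [∀ i, AddCommGroup (Q i)]
    [∀ i, Module O (Q i)] (a : O) :
    Nat.card (Submodule.torsionBy O (∀ i, Q i) a) =
      ∏ i, Nat.card (Submodule.torsionBy O (Q i) a) := by
  rw [← Nat.card_pi]
  refine Nat.card_congr ⟨fun x i => ⟨x.1 i, ?_⟩, fun x => ⟨fun i => (x i).1, ?_⟩,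
    fun x => rfl, fun x => rfl⟩
  · exact congrFun ((Submodule.mem_torsionBy_iff _ _).1 x.2) i
  · exact (Submodule.mem_torsionBy_iff _ _).2 (funext fun i => (x i).2)

theorem sum_min_eq_sum_conj {r : ℕ} (l : Fin r → ℕ) (j : ℕ) :
    ∑ i, min j (l i) = ∑ k ∈ Finset.Icc 1 j, conj l k := by
  simp only [conj, Finset.card_filter]
  rw [Finset.sum_comm]
  refine Finset.sum_congr rfl fun i _ => ?_
  rw [← Finset.card_filter]
  have : (Finset.Icc 1 j).filter (fun k => k ≤ l i) = Finset.Icc 1 (min j (l i)) := by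
    ext k; simp only [Finset.mem_filter, Finset.mem_Icc]; omega
  rw [this, Nat.card_Icc, Nat.add_sub_cancel]

theorem HasType.card_torsionBy (hϖ : Irreducible ϖ) {r : ℕ} {l : Fin r → ℕ} (h : HasType O l M)
    (j : ℕ) : Nat.card (Submodule.torsionBy O M (ϖ ^ j)) =
      Nat.card (ResidueField O) ^ ∑ k ∈ Finset.Icc 1 j, conj l k := by
  rw [card_torsionBy_congr h.some, card_torsionBy_pi]
  simp only [card_torsionBy_quotient hϖ, Finset.prod_pow_eq_pow_sum, sum_min_eq_sum_conj]

/-- An element of maximal order `ϖ ^ e` splits off a cyclic summand. -/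
theorem nonempty_equiv_quotient_prod_ker [Finite M] (hϖ : Irreducible ϖ) {e : ℕ}
    (hM : ∀ x : M, ϖ ^ (e + 1) • x = 0) {v : M} (hv : ϖ ^ e • v ≠ 0) :
    ∃ K : Submodule O M, Nonempty (M ≃ₗ[O] (O ⧸ maximalIdeal O ^ (e + 1)) × K) := by
  let f : M →ₗ.[O] O ⧸ maximalIdeal O ^ (e + 1) :=
    LinearPMap.mkSpanSingleton' v (Submodule.Quotient.mk 1) fun a ha => by
      rw [RingHom.id_apply, ← Submodule.Quotient.mk_smul, mk_eq_zero_iff_pow_dvd hϖ, smul_eq_mul,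
        mul_one]
      exact pow_dvd_of_smul_eq_zero hϖ hv ha
  obtain ⟨ρ, hρ⟩ := exists_extension hϖ hM (isUniform_quotient hϖ (e + 1)) f
  have hρv : ρ v = Submodule.Quotient.mk 1 := by
    rw [hρ ⟨v, Submodule.mem_span_singleton_self v⟩]
    exact LinearPMap.mkSpanSingleton'_apply_self _ _ _ _
  let s : (O ⧸ maximalIdeal O ^ (e + 1)) →ₗ[O] M := cyclicMap hϖ v (hM v)
  have hs : ∀ a : O, s (Submodule.Quotient.mk a) = a • v := fun a => rfl
  have hρs : ∀ x, ρ (s x) = x := fun x => by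
    obtain ⟨a, rfl⟩ := Submodule.Quotient.mk_surjective _ x
    rw [hs, map_smul, hρv, ← Submodule.Quotient.mk_smul, smul_eq_mul, mul_one]
  refine ⟨LinearMap.ker ρ, ⟨(LinearEquiv.ofBijective (s.coprod (LinearMap.ker ρ).subtype)
    ⟨(injective_iff_map_eq_zero _).2 ?_, fun x => ?_⟩).symm⟩⟩
  · rintro ⟨x, k, hk⟩ h
    rw [LinearMap.coprod_apply] at h
    have h1 := congrArg ρ h
    rw [map_add, hρs, map_zero, Submodule.subtype_apply, LinearMap.mem_ker.1 hk, add_zero] at h1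
    simp only at h1
    subst h1
    simp only [map_zero, zero_add, Submodule.subtype_apply] at h
    exact Prod.ext rfl (Subtype.ext h)
  · refine ⟨(ρ x, ⟨x - s (ρ x), ?_⟩), ?_⟩
    · rw [LinearMap.mem_ker, map_sub, hρs, sub_self]
    · simp

/-- A finite module killed by `ϖ ^ ℓ` whose socle has length at most `r` has a type contained in
the rectangle `(ℓ ^ r)`. -/
theorem exists_hasType [Finite (ResidueField O)] [Finite M] (hϖ : Irreducible ϖ) {ℓ r : ℕ}
    (hM : ∀ x : M, ϖ ^ ℓ • x = 0)
    (hcard : Nat.card (Submodule.torsionBy O M ϖ) ≤ Nat.card (ResidueField O) ^ r) :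
    ∃ l : BoxPartition r ℓ, HasType O (parts l) M := by
  classical
  induction r generalizing ℓ M with
  | zero =>
    refine ⟨⟨fun i => i.elim0, fun i => i.elim0⟩, ⟨?_⟩⟩
    have : Subsingleton M := by
      refine ⟨fun x y => ?_⟩
      by_contra hxy
      obtain ⟨j, hj, hj'⟩ := exists_pow_smul_notMem (S := (⊥ : Submodule O M)) (x := x - y)
        (ϖ := ϖ) (by simpa [sub_eq_zero] using hxy) (k := ℓ) (by rw [hM]; exact zero_mem _)
      have h1 : Subsingleton (Submodule.torsionBy O M ϖ) :=
        (Finite.card_le_one_iff_subsingleton).1 (by simpa using hcard)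
      exact hj (congrArg Subtype.val (h1.elim ⟨ϖ ^ j • (x - y), hj'⟩ 0))
    exact 0
  | succ r ih =>
    by_cases hsub : ∀ x : M, x = 0
    · refine ⟨⟨fun _ => 0, fun _ _ _ => le_rfl⟩, ⟨LinearEquiv.ofBijective 0
        ⟨fun x y _ => by rw [hsub x, hsub y], fun y => ⟨0, funext fun i => ?_⟩⟩⟩⟩
      obtain ⟨a, ha⟩ := Submodule.Quotient.mk_surjective _ (y i)
      rw [LinearMap.zero_apply, ← ha, eq_comm]
      exact (mk_eq_zero_iff_pow_dvd hϖ).2 (by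
        rw [show parts (⟨fun _ => 0, fun _ _ _ => le_rfl⟩ : BoxPartition (r + 1) ℓ) i = 0 from rfl,
          pow_zero]
        exact one_dvd _)
    · have hex : ∃ e, ∀ x : M, ϖ ^ e • x = 0 := ⟨ℓ, hM⟩
      rcases hfind : Nat.find hex with _ | e
      · exact absurd (fun x => by simpa [hfind] using Nat.find_spec hex x) hsub
      have he : ∀ x : M, ϖ ^ (e + 1) • x = 0 := hfind ▸ Nat.find_spec hex
      have heℓ : e + 1 ≤ ℓ := hfind ▸ Nat.find_min' hex hM
      obtain ⟨v, hv⟩ : ∃ v : M, ϖ ^ e • v ≠ 0 := by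
        by_contra! hcon
        exact Nat.find_min hex (m := e) (by omega) hcon
      obtain ⟨K, ⟨eK⟩⟩ := nonempty_equiv_quotient_prod_ker hϖ he hv
      have hq : 0 < Nat.card (ResidueField O) := Nat.card_pos
      have hKcard : Nat.card (Submodule.torsionBy O K ϖ) ≤ Nat.card (ResidueField O) ^ r := by
        have h1 := card_torsionBy_quotient hϖ 1 (e + 1)
        rw [pow_one, min_eq_left (by omega), pow_one] at h1
        rw [card_torsionBy_congr eK, card_torsionBy_prod, h1, pow_succ'] at hcard
        exact Nat.le_of_mul_le_mul_left hcard hq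
      obtain ⟨l, ⟨el⟩⟩ := ih (M := K) (ℓ := e + 1) (fun x => Subtype.ext (he x)) hKcard
      let l' : Fin (r + 1) → Fin (ℓ + 1) :=
        Fin.cons ⟨e + 1, by omega⟩ fun i => ⟨l.1 i, by have := (l.1 i).2; omega⟩
      have hl' : Antitone l' := by
        intro i j hij
        induction j using Fin.cases with
        | zero => rw [Fin.le_zero_iff.1 hij]
        | succ j =>
          induction i using Fin.cases with
          | zero => exact Fin.mk_le_mk.2 (by have := (l.1 j).2; omega)
          | succ i => exact l.2 (Fin.succ_le_succ_iff.1 hij)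
      exact ⟨⟨l', hl'⟩, ⟨eK.trans (((LinearEquiv.refl O _).prodCongr el).trans
        (Fin.consLinearEquiv O fun i => O ⧸ maximalIdeal O ^ ((l' i : ℕ))))⟩⟩

end Types

/-! ### Homogeneity of the ambient module -/

section Homogeneity

variable {O : Type*} [CommRing O] [IsDomain O] [IsDiscreteValuationRing O] {ϖ : O}
  {M N : Type*} [AddCommGroup M] [Module O M] [AddCommGroup N] [Module O N]

/-- The partial endomorphism of `M` given by an isomorphism of submodules. -/
def partialMap {S T : Submodule O M} (θ : S ≃ₗ[O] T) : M →ₗ.[O] M :=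
  ⟨S, T.subtype ∘ₗ θ.toLinearMap⟩

/-- Two partial maps which take equal values exactly on equal arguments glue to an injective partial
map. -/
theorem sup_apply_eq_zero {f g : M →ₗ.[O] N}
    (H : ∀ (x : f.domain) (y : g.domain), (x : M) = y → f x = g y)
    (H' : ∀ (x : f.domain) (y : g.domain), f x = g y → (x : M) = y)
    (z : (f.sup g H).domain) (hz : f.sup g H z = 0) : z = 0 := by
  obtain ⟨z, hzd⟩ := z
  obtain ⟨x, hx, y, hy, rfl⟩ := Submodule.mem_sup.1 hzd
  replace hz := (LinearPMap.sup_apply H ⟨x, hx⟩ ⟨y, hy⟩ ⟨x + y, hzd⟩ rfl).symm.trans hz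
  have h1 := H' ⟨x, hx⟩ (-⟨y, hy⟩) (by rw [g.map_neg]; exact eq_neg_of_add_eq_zero_left hz)
  ext
  simp only [NegMemClass.coe_neg] at h1
  simp [h1]

/-- Gluing two isomorphisms of submodules to an automorphism of a uniform module. -/
theorem exists_equiv_of_glue [Finite M] (hϖ : Irreducible ϖ) {ℓ : ℕ} (hM : IsUniform ϖ ℓ M)
    {S S' T T' : Submodule O M} (θ : S ≃ₗ[O] S') (τ : T ≃ₗ[O] T')
    (H : ∀ (x : S) (y : T), (x : M) = y ↔ (θ x : M) = τ y) :
    ∃ σ : M ≃ₗ[O] M, (∀ x : S, σ x = θ x) ∧ ∀ y : T, σ y = τ y := by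
  have H1 : ∀ (x : (partialMap θ).domain) (y : (partialMap τ).domain), (x : M) = y →
      partialMap θ x = partialMap τ y := fun x y h => (H x y).1 h
  obtain ⟨σ, hσ⟩ := exists_equiv_extension hϖ hM ((partialMap θ).sup (partialMap τ) H1)
    (sup_apply_eq_zero H1 fun x y h => (H x y).2 h)
  refine ⟨σ, fun x => ?_, fun y => ?_⟩
  · have h1 := ((partialMap θ).left_le_sup (partialMap τ) H1).1 x.2
    rw [hσ ⟨x, h1⟩]
    exact (((partialMap θ).left_le_sup (partialMap τ) H1).2 (x := x) (y := ⟨x, h1⟩) rfl).symm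
  · have h1 := ((partialMap θ).right_le_sup (partialMap τ) H1).1 y.2
    rw [hσ ⟨y, h1⟩]
    exact (((partialMap θ).right_le_sup (partialMap τ) H1).2 (x := y) (y := ⟨y, h1⟩) rfl).symm

theorem map_eq_of_forall {S T : Submodule O M} (θ : S ≃ₗ[O] T) (σ : M ≃ₗ[O] M)
    (h : ∀ x : S, σ x = θ x) : S.map (σ : M →ₗ[O] M) = T := by
  ext y
  rw [Submodule.mem_map]
  constructor
  · rintro ⟨x, hx, rfl⟩
    rw [LinearEquiv.coe_coe, h ⟨x, hx⟩]
    exact (θ _).2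
  · intro hy
    refine ⟨θ.symm ⟨y, hy⟩, (θ.symm ⟨y, hy⟩).2, ?_⟩
    rw [LinearEquiv.coe_coe, h, θ.apply_symm_apply]

/-- An isomorphism of submodules of two isomorphic uniform submodules extends to these. -/
theorem exists_equiv_extending [Finite M] (hϖ : Irreducible ϖ) {ℓ : ℕ}
    {S S' T T' : Submodule O M} (hS : S ≤ T) (hS' : S' ≤ T') (hT' : IsUniform ϖ ℓ T')
    (e : T ≃ₗ[O] T') (θ : S ≃ₗ[O] S') :
    ∃ τ : T ≃ₗ[O] T', ∀ x : S, (τ ⟨x, hS x.2⟩ : M) = θ x := by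
  let f : T →ₗ.[O] T' := ⟨S.comap T.subtype, Submodule.inclusion hS' ∘ₗ θ.toLinearMap ∘ₗ
    LinearMap.restrict T.subtype (fun _ hx => hx)⟩
  obtain ⟨g, hg, hgf⟩ := exists_injective_extension hϖ (hT'.of_equiv e.symm).pow_smul hT'
    (card_torsionBy_congr e ϖ).le f (fun x hx => by
      have h1 : θ ⟨x.1.1, x.2⟩ = 0 := Subtype.ext (show ((f x : T') : M) = 0 by
        rw [hx, ZeroMemClass.coe_zero])
      have h2 : x.1.1 = 0 := congrArg Subtype.val ((LinearEquiv.map_eq_zero_iff θ).1 h1)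
      exact Subtype.ext (Subtype.ext h2))
  refine ⟨LinearEquiv.ofBijective g (hg.bijective_of_nat_card_le
    (Nat.card_congr e.toEquiv).ge), fun x => ?_⟩
  exact congrArg Subtype.val (hgf ⟨⟨x, hS x.2⟩, x.2⟩)

/-- Pairs of free submodules are conjugate as soon as their intersections are isomorphic. -/
theorem exists_equiv_map_pair [Finite M] (hϖ : Irreducible ϖ) {ℓ : ℕ} (hM : IsUniform ϖ ℓ M)
    {S T S' T' : Submodule O M} (hS' : IsUniform ϖ ℓ S') (hT' : IsUniform ϖ ℓ T')
    (eS : S ≃ₗ[O] S') (eT : T ≃ₗ[O] T')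
    (θ : (S ⊓ T : Submodule O M) ≃ₗ[O] (S' ⊓ T' : Submodule O M)) :
    ∃ σ : M ≃ₗ[O] M, S.map (σ : M →ₗ[O] M) = S' ∧ T.map (σ : M →ₗ[O] M) = T' := by
  obtain ⟨α, hα⟩ := exists_equiv_extending hϖ inf_le_left inf_le_left hS' eS θ
  obtain ⟨β, hβ⟩ := exists_equiv_extending hϖ inf_le_right inf_le_right hT' eT θ
  obtain ⟨σ, h1, h2⟩ := exists_equiv_of_glue hϖ hM α β fun x y => by
    constructor
    · intro hxy
      have hx : (x : M) ∈ S ⊓ T := ⟨x.2, hxy ▸ y.2⟩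
      have h3 := hα ⟨x, hx⟩
      have h4 := hβ ⟨x, hx⟩
      rw [show x = ⟨_, hx.1⟩ from rfl, h3, ← h4]
      congr 2
      exact Subtype.ext hxy
    · intro hxy
      have hx : (α x : M) ∈ S' ⊓ T' := ⟨(α x).2, hxy ▸ (β y).2⟩
      have h3 := hα (θ.symm ⟨α x, hx⟩)
      have h4 := hβ (θ.symm ⟨α x, hx⟩)
      rw [θ.apply_symm_apply] at h3 h4
      have h5 := α.injective (Subtype.ext h3)
      have h6 := β.injective (Subtype.ext (h4.trans hxy))
      exact (congrArg Subtype.val h5).symm.trans (congrArg Subtype.val h6)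
  exact ⟨σ, map_eq_of_forall α σ h1, map_eq_of_forall β σ h2⟩

/-- Flags `S ≤ T` with `T` free are conjugate as soon as their members are isomorphic. -/
theorem exists_equiv_map_flag [Finite M] (hϖ : Irreducible ϖ) {ℓ : ℕ} (hM : IsUniform ϖ ℓ M)
    {S T S' T' : Submodule O M} (hS : S ≤ T) (hS' : S' ≤ T') (hT' : IsUniform ϖ ℓ T')
    (eT : T ≃ₗ[O] T') (θ : S ≃ₗ[O] S') :
    ∃ σ : M ≃ₗ[O] M, S.map (σ : M →ₗ[O] M) = S' ∧ T.map (σ : M →ₗ[O] M) = T' := by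
  obtain ⟨β, hβ⟩ := exists_equiv_extending hϖ hS hS' hT' eT θ
  obtain ⟨σ, h1⟩ := exists_equiv_extension hϖ hM (partialMap β) fun x hx =>
    (LinearEquiv.map_eq_zero_iff β).1 (Subtype.ext hx)
  exact ⟨σ, map_eq_of_forall θ σ fun x => (h1 ⟨x, hS x.2⟩).trans (hβ x),
    map_eq_of_forall β σ h1⟩

/-- Isomorphic submodules disjoint from `C` are conjugate under the pointwise stabilizer of `C`. -/
theorem exists_equiv_map_disjoint [Finite M] (hϖ : Irreducible ϖ) {ℓ : ℕ} (hM : IsUniform ϖ ℓ M)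
    {S S' C : Submodule O M} (hS : Disjoint S C) (hS' : Disjoint S' C) (θ : S ≃ₗ[O] S') :
    ∃ σ : M ≃ₗ[O] M, S.map (σ : M →ₗ[O] M) = S' ∧ C.map (σ : M →ₗ[O] M) = C := by
  obtain ⟨σ, h1, h2⟩ := exists_equiv_of_glue hϖ hM θ (LinearEquiv.refl O C) fun x y => by
    constructor
    · intro h
      have hx : (x : M) = 0 := Submodule.disjoint_def.1 hS x x.2 (h ▸ y.2)
      have hy : (y : M) = 0 := h ▸ hx
      rw [show x = 0 from Subtype.ext hx, map_zero, ZeroMemClass.coe_zero]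
      exact hy.symm
    · intro h
      have hx : (θ x : M) = 0 := Submodule.disjoint_def.1 hS' (θ x) (θ x).2 (h ▸ y.2)
      have hx' : x = 0 := (LinearEquiv.map_eq_zero_iff θ).1 (Subtype.ext hx)
      rw [hx', ZeroMemClass.coe_zero]
      exact hx.symm.trans h
  exact ⟨σ, map_eq_of_forall θ σ h1, map_eq_of_forall (LinearEquiv.refl O C) σ h2⟩

end Homogeneity

/-! ### The dimension of the Hecke algebra -/

section HeckeDimension

variable {O : Type*} [CommRing O] [IsDomain O] [IsDiscreteValuationRing O]
  [Finite (ResidueField O)] {ϖ : O} {ℓ n m : ℕ}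

theorem Gr.le_map_iff {r s : ℕ} {l : Fin r → ℕ} {u : Fin s → ℕ}
    (g : Ambient O ℓ n ≃ₗ[O] Ambient O ℓ n) (x : Gr O ℓ n l) (y : Gr O ℓ n u) :
    x.1 ≤ (Gr.map g y).1 ↔ (Gr.map g.symm x).1 ≤ y.1 := by
  change x.1 ≤ y.1.map (g : Ambient O ℓ n →ₗ[O] Ambient O ℓ n) ↔
    x.1.map (g.symm : Ambient O ℓ n →ₗ[O] Ambient O ℓ n) ≤ y.1
  rw [Submodule.map_le_iff_le_comap]
  congr! 1
  ext z
  simp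

theorem Gr.map_symm_map {r : ℕ} {l : Fin r → ℕ} (g : Ambient O ℓ n ≃ₗ[O] Ambient O ℓ n)
    (x : Gr O ℓ n l) : Gr.map g.symm (Gr.map g x) = x := by
  refine Subtype.ext ?_
  change (x.1.map (g : Ambient O ℓ n →ₗ[O] Ambient O ℓ n)).map
    (g.symm : Ambient O ℓ n →ₗ[O] Ambient O ℓ n) = x.1
  ext z
  simp

/-- The permutation of `X_λ` induced by an automorphism of the ambient module. -/
def Gr.mapEquiv {r : ℕ} (l : Fin r → ℕ) (g : Ambient O ℓ n ≃ₗ[O] Ambient O ℓ n) :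
    Gr O ℓ n l ≃ Gr O ℓ n l where
  toFun := Gr.map g
  invFun := Gr.map g.symm
  left_inv := Gr.map_symm_map g
  right_inv := Gr.map_symm_map g.symm

theorem up_rep {r s : ℕ} (l : Fin r → ℕ) (u : Fin s → ℕ)
    (g : Ambient O ℓ n ≃ₗ[O] Ambient O ℓ n) (h : FF O ℓ n l) :
    up O ℓ n l u (rep O ℓ n l g h) = rep O ℓ n u g (up O ℓ n l u h) := by
  classical
  funext y
  change ∑ x : Gr O ℓ n l with x.1 ≤ y.1, h (Gr.map g.symm x) =
    ∑ x : Gr O ℓ n l with x.1 ≤ (Gr.map g.symm y).1, h x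
  rw [Finset.sum_filter, Finset.sum_filter]
  refine Fintype.sum_equiv (Gr.mapEquiv l g.symm) _ _ fun x => ?_
  congr 1
  rw [Gr.le_map_iff]
  exact propext (by rw [show Gr.mapEquiv l g.symm x = Gr.map g.symm x from rfl,
    Gr.map_symm_map g.symm])

theorem down_rep {r s : ℕ} (l : Fin r → ℕ) (u : Fin s → ℕ)
    (g : Ambient O ℓ n ≃ₗ[O] Ambient O ℓ n) (h : FF O ℓ n u) :
    down O ℓ n u l (rep O ℓ n u g h) = rep O ℓ n l g (down O ℓ n u l h) := by
  classical
  funext x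
  change ∑ y : Gr O ℓ n u with x.1 ≤ y.1, h (Gr.map g.symm y) =
    ∑ y : Gr O ℓ n u with (Gr.map g.symm x).1 ≤ y.1, h y
  rw [Finset.sum_filter, Finset.sum_filter]
  refine Fintype.sum_equiv (Gr.mapEquiv u g.symm) _ _ fun y => ?_
  congr 1
  rw [← Gr.le_map_iff]
  exact propext (by rw [show Gr.mapEquiv u g.symm y = Gr.map g.symm y from rfl,
    show Gr.map g (Gr.map g.symm y) = y from Gr.map_symm_map g.symm y])

theorem cellular_mem_hecke (l : BoxPartition m ℓ) : cellular O ℓ n m l ∈ Hecke O ℓ n m := by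
  rw [Hecke, Subalgebra.mem_centralizer_iff]
  rintro _ ⟨g, rfl⟩
  refine LinearMap.ext fun h => ?_
  simp only [cellular, Module.End.mul_apply, LinearMap.comp_apply, down_rep, up_rep]

open Classical in
/-- The matrix entries of a Hecke operator are invariant under automorphisms of the ambient
module. -/
theorem hecke_entry_map {T : Module.End ℂ (FF O ℓ n (rect ℓ m))} (hT : T ∈ Hecke O ℓ n m)
    (g : Ambient O ℓ n ≃ₗ[O] Ambient O ℓ n) (y z : Gr O ℓ n (rect ℓ m)) :
    T (Pi.single (Gr.map g z) 1) (Gr.map g y) = T (Pi.single z 1) y := by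
  have h1 := (Subalgebra.mem_centralizer_iff ℂ).1 hT _ ⟨g, rfl⟩
  have h2 := congrFun (congrArg (fun S : Module.End ℂ (FF O ℓ n (rect ℓ m)) =>
    S (Pi.single z 1)) h1) (Gr.map g y)
  have h3 : rep O ℓ n (rect ℓ m) g (Pi.single z 1) = Pi.single (Gr.map g z) 1 := by
    funext x
    change (Pi.single z 1 : FF O ℓ n (rect ℓ m)) (Gr.map g.symm x) = _
    rw [Pi.single_apply, Pi.single_apply]
    congr 1
    exact propext ((Gr.mapEquiv (rect ℓ m) g).symm_apply_eq)
  simp only [Module.End.mul_apply] at h2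
  rw [h3] at h2
  rw [← h2]
  change T (Pi.single z 1) (Gr.map g.symm (Gr.map g y)) = _
  rw [Gr.map_symm_map]

theorem Gr.exists_hasType_inf (hϖ : Irreducible ϖ) (y z : Gr O ℓ n (rect ℓ m)) :
    ∃ l : BoxPartition m ℓ, HasType O (parts l) (y.1 ⊓ z.1 : Submodule O (Ambient O ℓ n)) := by
  refine exists_hasType hϖ (fun x => Subtype.ext ((isUniform_ambient hϖ ℓ n).pow_smul x)) ?_
  have h1 := y.2.card_torsionBy hϖ 1
  rw [pow_one] at h1
  calc _ ≤ Nat.card (Submodule.torsionBy O y.1 ϖ) := by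
        refine Nat.card_le_card_of_injective
          (fun x => ⟨⟨x.1.1, x.1.2.1⟩, ?_⟩) fun x x' h => ?_
        · have h2 : ϖ • (x.1 : Ambient O ℓ n) = 0 :=
            congrArg Subtype.val ((Submodule.mem_torsionBy_iff ϖ x.1).1 x.2)
          exact (Submodule.mem_torsionBy_iff _ _).2 (Subtype.ext h2)
        · exact Subtype.ext (Subtype.ext
            (congrArg (fun t : Submodule.torsionBy O y.1 ϖ => t.1.1) h))
    _ ≤ _ := by
        rw [h1, Finset.Icc_self, Finset.sum_singleton]
        refine Nat.pow_le_pow_right Nat.card_pos ((Finset.card_filter_le _ _).trans ?_)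
        rw [Finset.card_univ, Fintype.card_fin]

/-- A Hecke operator is determined by its entries at one pair of free submodules for each type of
intersection. -/
theorem finrank_hecke_le (hϖ : Irreducible ϖ) :
    Module.finrank ℂ (Hecke O ℓ n m) ≤ Fintype.card (BoxPartition m ℓ) := by
  classical
  let P : BoxPartition m ℓ → Gr O ℓ n (rect ℓ m) × Gr O ℓ n (rect ℓ m) → Prop := fun l p =>
    HasType O (parts l) (p.1.1 ⊓ p.2.1 : Submodule O (Ambient O ℓ n))
  let Θ : Hecke O ℓ n m →ₗ[ℂ] (BoxPartition m ℓ → ℂ) := LinearMap.pi fun l =>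
    if h : ∃ p, P l p then
      LinearMap.proj h.choose.1 ∘ₗ LinearMap.applyₗ (Pi.single h.choose.2 1) ∘ₗ
        (Hecke O ℓ n m).val.toLinearMap
    else 0
  have hΘ : Function.Injective Θ := by
    refine (injective_iff_map_eq_zero _).2 fun T hT => Subtype.ext ?_
    refine LinearMap.pi_ext' fun z => LinearMap.ext_ring (funext fun y => ?_)
    obtain ⟨l, hl⟩ := Gr.exists_hasType_inf hϖ y z
    have h : ∃ p, P l p := ⟨(y, z), hl⟩
    have h1 : T.1 (Pi.single h.choose.2 1) h.choose.1 = 0 := by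
      have := congrFun hT l
      simp only [Θ, LinearMap.pi_apply, dif_pos h] at this
      exact this
    obtain ⟨σ, hσ1, hσ2⟩ := exists_equiv_map_pair hϖ (isUniform_ambient hϖ ℓ n)
      (y.2.isUniform hϖ) (z.2.isUniform hϖ) (h.choose.1.2.some.trans y.2.some.symm)
      (h.choose.2.2.some.trans z.2.some.symm) (h.choose_spec.some.trans hl.some.symm)
    have h2 := hecke_entry_map T.2 σ h.choose.1 h.choose.2
    rw [show Gr.map σ h.choose.1 = y from Subtype.ext hσ1,
      show Gr.map σ h.choose.2 = z from Subtype.ext hσ2, h1] at h2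
    exact h2
  calc _ ≤ Module.finrank ℂ (BoxPartition m ℓ → ℂ) := LinearMap.finrank_le_finrank_of_injective hΘ
    _ = _ := Module.finrank_fintype_fun_eq_card ℂ

end HeckeDimension

/-! ### Counting independent tuples -/

section QFactorial

theorem qFactorial_succ (q k : ℕ) :
    qFactorial q (k + 1) = qFactorial q k * (1 - ((q : ℂ) ^ (k + 1))⁻¹) := by
  rw [qFactorial, qFactorial, Finset.prod_Icc_succ_top (by omega)]

theorem qFactorial_zero (q : ℕ) : qFactorial q 0 = 1 := by
  simp [qFactorial]

theorem qFactorial_ne_zero {q : ℕ} (hq : 1 < q) (k : ℕ) : qFactorial q k ≠ 0 := by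
  refine Finset.prod_ne_zero_iff.2 fun i hi => ?_
  rw [sub_ne_zero, ne_eq, eq_comm, inv_eq_one]
  have h1 : 1 < q ^ i := Nat.one_lt_pow (by have := (Finset.mem_Icc.1 hi).1; omega) hq
  exact_mod_cast h1.ne'

theorem conj_succ {r : ℕ} (l : Fin (r + 1) → ℕ) (j : ℕ) :
    conj l j = (if j ≤ l 0 then 1 else 0) + conj (Fin.tail l) j := by
  rw [conj, Fin.card_filter_univ_succ']
  rfl

theorem conj_eq_zero {r : ℕ} {l : Fin r → ℕ} {j : ℕ} (h : ∀ i, l i < j) : conj l j = 0 := by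
  rw [conj, Finset.card_eq_zero, Finset.filter_eq_empty_iff]
  exact fun i _ => not_le_of_gt (h i)

/-- The number of embeddings of a module of type `μ` into a module whose type has the transpose `g`,
with image disjoint from a subspace of dimension `b` of the socle.  `L` is a bound for the parts of
`μ`.  The formula is the cardinality only under the hypotheses of `card_tup`. -/
def embeddingCount (q L : ℕ) (g : ℕ → ℕ) (b : ℕ) {r : ℕ} (μ : Fin r → ℕ) : ℂ :=
  (q : ℂ) ^ (∑ j ∈ Finset.Icc 1 L, g j * conj μ j) *
    ∏ j ∈ Finset.Icc 1 L,
      qFactorial q (g j - b - conj μ (j + 1)) / qFactorial q (g j - b - conj μ j)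

theorem embeddingCount_ne_zero {q : ℕ} (hq : 1 < q) (L : ℕ) (g : ℕ → ℕ) (b : ℕ) {r : ℕ}
    (μ : Fin r → ℕ) : embeddingCount q L g b μ ≠ 0 := by
  refine mul_ne_zero (pow_ne_zero _ (by exact_mod_cast (by omega : q ≠ 0)))
    (Finset.prod_ne_zero_iff.2 fun j _ => div_ne_zero ?_ ?_) <;> exact qFactorial_ne_zero hq _

theorem embeddingCount_of_eq_zero {q : ℕ} (hq : 1 < q) (L : ℕ) (g : ℕ → ℕ) (b : ℕ) {r : ℕ}
    {μ : Fin r → ℕ} (hμ : ∀ i, μ i = 0) : embeddingCount q L g b μ = 1 := by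
  have h0 : ∀ j ∈ Finset.Icc 1 L, conj μ j = 0 := fun j hj =>
    conj_eq_zero fun i => by rw [hμ]; exact (Finset.mem_Icc.1 hj).1
  have h1 : ∀ j, conj μ (j + 1) = 0 := fun j => conj_eq_zero fun i => by rw [hμ]; omega
  rw [embeddingCount, Finset.sum_eq_zero fun j hj => by rw [h0 j hj, mul_zero], pow_zero, one_mul]
  refine Finset.prod_eq_one fun j hj => ?_
  rw [h0 j hj, h1, div_self (qFactorial_ne_zero hq _)]

/-- The recursion for the removal of the largest part `e + 1` of `μ`; the first factor is the number
of choices for a generator of order `ϖ ^ (e + 1)`. -/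
theorem embeddingCount_succ {q : ℕ} (hq : 1 < q) {L : ℕ} {g : ℕ → ℕ} {b : ℕ} {r : ℕ}
    {μ : Fin (r + 1) → ℕ} (hμ : Antitone μ) {e : ℕ} (he : μ 0 = e + 1) (heL : e + 1 ≤ L)
    (hb : b < g (e + 1)) :
    embeddingCount q L g b μ =
      ((q : ℂ) ^ (∑ j ∈ Finset.Icc 1 (e + 1), g j) -
        (q : ℂ) ^ (∑ j ∈ Finset.Icc 1 e, g j) * (q : ℂ) ^ b) *
      embeddingCount q L g (b + 1) (Fin.tail μ) := by
  have hq0 : (q : ℂ) ≠ 0 := by exact_mod_cast (by omega : q ≠ 0)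
  have hle : ∀ i, μ i ≤ e + 1 := fun i => he ▸ hμ (Fin.zero_le i)
  have hc : ∀ j, conj μ j = (if j ≤ e + 1 then 1 else 0) + conj (Fin.tail μ) j := fun j => by
    rw [conj_succ, he]
  have hc0 : ∀ j, e + 1 < j → conj (Fin.tail μ) j = 0 := fun j hj =>
    conj_eq_zero fun i => lt_of_le_of_lt (hle i.succ) hj
  have hsum : ∑ j ∈ Finset.Icc 1 L, g j * conj μ j =
      ∑ j ∈ Finset.Icc 1 (e + 1), g j + ∑ j ∈ Finset.Icc 1 L, g j * conj (Fin.tail μ) j := by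
    simp only [hc, mul_add, Finset.sum_add_distrib, mul_ite, mul_one, mul_zero]
    rw [← Finset.sum_filter]
    congr 2
    ext j; simp only [Finset.mem_filter, Finset.mem_Icc]; omega
  have hfac : (q : ℂ) ^ (∑ j ∈ Finset.Icc 1 (e + 1), g j) -
      (q : ℂ) ^ (∑ j ∈ Finset.Icc 1 e, g j) * (q : ℂ) ^ b =
      (q : ℂ) ^ (∑ j ∈ Finset.Icc 1 (e + 1), g j) * (1 - ((q : ℂ) ^ (g (e + 1) - b))⁻¹) := by
    rw [Finset.sum_Icc_succ_top (by omega), mul_sub, mul_one, pow_add, sub_right_inj, mul_assoc]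
    congr 1
    rw [eq_mul_inv_iff_mul_eq₀ (pow_ne_zero _ hq0), ← pow_add, Nat.add_sub_cancel' hb.le]
  have hprod : ∀ j ∈ Finset.Icc 1 L,
      qFactorial q (g j - b - conj μ (j + 1)) / qFactorial q (g j - b - conj μ j) =
      (if j = e + 1 then 1 - ((q : ℂ) ^ (g (e + 1) - b))⁻¹ else 1) *
      (qFactorial q (g j - (b + 1) - conj (Fin.tail μ) (j + 1)) /
        qFactorial q (g j - (b + 1) - conj (Fin.tail μ) j)) := by
    intro j _
    rcases lt_trichotomy j (e + 1) with hj | rfl | hj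
    · rw [if_neg hj.ne, one_mul, hc, hc, if_pos (by omega), if_pos (by omega)]
      congr 2 <;> omega
    · rw [if_pos rfl, hc, hc, if_neg (by omega), if_pos le_rfl, hc0 _ (Nat.lt_succ_self _),
        ← mul_div_assoc]
      congr 1
      · obtain ⟨k, hk⟩ : ∃ k, g (e + 1) - b = k + 1 := ⟨g (e + 1) - b - 1, by omega⟩
        rw [show g (e + 1) - b - (0 + 0) = k + 1 by omega,
          show g (e + 1) - (b + 1) - 0 = k by omega, hk, qFactorial_succ, mul_comm]
      · congr 1; omega
    · rw [if_neg hj.ne', one_mul, hc, hc, if_neg (by omega), if_neg (by omega), hc0 _ hj,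
        hc0 _ (by omega), div_self (qFactorial_ne_zero hq _), div_self (qFactorial_ne_zero hq _)]
  rw [embeddingCount, hsum, Finset.prod_congr rfl hprod, Finset.prod_mul_distrib,
    Finset.prod_ite_eq', if_pos (Finset.mem_Icc.2 ⟨by omega, heL⟩), hfac, embeddingCount, pow_add]
  ring

end QFactorial

section Tuples

variable {O : Type*} [CommRing O] [IsDomain O] [IsDiscreteValuationRing O] {ϖ : O}
  {M : Type*} [AddCommGroup M] [Module O M]

variable (ϖ) in
/-- The tuples of elements `v i` of `N`, of order `ϖ ^ μ i`, which generate a direct sum of cyclic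
modules disjoint from `C`.  They correspond to the embeddings of a module of type `μ` into `N` with
image disjoint from `C`. -/
def Tup {r : ℕ} (μ : Fin r → ℕ) (N C : Submodule O M) : Set (Fin r → M) :=
  {v | (∀ i, v i ∈ N) ∧ (∀ i, ϖ ^ μ i • v i = 0) ∧
    ∀ a : Fin r → O, ∑ i, a i • v i ∈ C → ∀ i, ϖ ^ μ i ∣ a i}

/-- The first generator enters the condition on the others only through its socle. -/
theorem mem_tup_succ (hϖ : Irreducible ϖ) {r : ℕ} {μ : Fin (r + 1) → ℕ} {N C : Submodule O M}
    (hC : ∀ c ∈ C, ϖ • c = 0) {e : ℕ} (he : μ 0 = e + 1) (v : Fin (r + 1) → M) :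
    v ∈ Tup ϖ μ N C ↔ (v 0 ∈ N ∧ ϖ ^ (e + 1) • v 0 = 0 ∧ ϖ ^ e • v 0 ∉ C) ∧
      Fin.tail v ∈ Tup ϖ (Fin.tail μ) N (C ⊔ Submodule.span O {ϖ ^ e • v 0}) := by
  constructor
  · rintro ⟨hN, hord, hind⟩
    refine ⟨⟨hN 0, he ▸ hord 0, fun hmem => ?_⟩, fun i => hN i.succ, fun i => hord i.succ,
      fun a ha i => ?_⟩
    · have h1 := hind (Pi.single 0 (ϖ ^ e)) (by
        rw [Fin.sum_univ_succ, Pi.single_eq_same]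
        simpa using hmem) 0
      rw [he, Pi.single_eq_same, pow_succ] at h1
      exact hϖ.not_isUnit (isUnit_of_dvd_one
        ((mul_dvd_mul_iff_left (pow_ne_zero e hϖ.ne_zero)).1 (by simpa using h1)))
    · obtain ⟨c, hc, w, hw, hcw⟩ := Submodule.mem_sup.1 ha
      obtain ⟨b, rfl⟩ := Submodule.mem_span_singleton.1 hw
      have h1 := hind (Fin.cons (-(b * ϖ ^ e)) a) (by
        rw [Fin.sum_univ_succ, Fin.cons_zero]
        simp only [Fin.cons_succ]
        have h2 : ∑ i, a i • v i.succ = c + b • ϖ ^ e • v 0 := hcw.symm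
        rw [h2, neg_smul, mul_smul, add_comm c, neg_add_cancel_left]
        exact hc) i.succ
      simpa [Fin.tail] using h1
  · rintro ⟨⟨hN0, hord0, hv0⟩, hN, hord, hind⟩
    refine ⟨fun i => Fin.cases hN0 hN i, fun i => Fin.cases (he ▸ hord0) hord i, fun a ha => ?_⟩
    -- the case in which the first coefficient is divisible by `ϖ ^ e`
    have key : ∀ b : O, ∀ a' : Fin r → O, (b * ϖ ^ e) • v 0 + ∑ i, a' i • v i.succ ∈ C →
        ϖ ∣ b ∧ ∀ i, ϖ ^ μ i.succ ∣ a' i := by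
      intro b a' h
      have h1 := hind a' (by
        have h2 : ∑ i, a' i • Fin.tail v i = ((b * ϖ ^ e) • v 0 + ∑ i, a' i • v i.succ) +
            (-b) • ϖ ^ e • v 0 := by
          rw [neg_smul, mul_smul, add_comm (b • _), add_neg_cancel_right]; rfl
        rw [h2]
        exact Submodule.add_mem_sup h
          (Submodule.smul_mem _ _ (Submodule.mem_span_singleton_self _)))
      refine ⟨?_, h1⟩
      have h3 : ∑ i, a' i • v i.succ = 0 := Finset.sum_eq_zero fun i _ => by
        obtain ⟨d, hd⟩ := h1 i
        rw [hd, mul_comm, mul_smul, show ϖ ^ Fin.tail μ i • v i.succ = 0 from hord i, smul_zero]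
      rw [h3, add_zero, mul_smul] at h
      rcases isUnit_or_dvd hϖ b with hb | ⟨d, rfl⟩
      · exact absurd ((smul_mem_iff_of_isUnit hb).1 h) hv0
      · exact dvd_mul_left _ _
    rw [Fin.sum_univ_succ] at ha
    by_cases h0 : ϖ ^ e ∣ a 0
    · obtain ⟨b, hb⟩ := h0
      obtain ⟨h1, h2⟩ := key b (fun i => a i.succ) (by rwa [mul_comm, ← hb])
      refine fun i => Fin.cases ?_ h2 i
      rw [he, hb, pow_succ]
      exact mul_dvd_mul_left _ h1
    · -- otherwise multiply by a power of `ϖ`, which kills `C`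
      exfalso
      obtain ⟨k, u, hk⟩ := IsDiscreteValuationRing.eq_unit_mul_pow_irreducible
        (x := a 0) (fun h => h0 (h ▸ dvd_zero _)) hϖ
      have hke : k < e := by
        by_contra! hcon
        exact h0 (hk ▸ Dvd.dvd.mul_left (pow_dvd_pow _ hcon) _)
      have h1 : ϖ ^ (e - k) • (a 0 • v 0 + ∑ i, a (Fin.succ i) • v i.succ) = 0 := by
        obtain ⟨d, hd⟩ : ∃ d, e - k = d + 1 := ⟨e - k - 1, by omega⟩
        rw [hd, pow_succ, mul_smul, hC _ ha, smul_zero]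
      obtain ⟨h2, -⟩ := key u (fun i => ϖ ^ (e - k) * a i.succ) (by
        rw [smul_add, Finset.smul_sum, smul_smul, hk, mul_left_comm, ← pow_add,
          Nat.sub_add_cancel hke.le] at h1
        simp only [smul_smul] at h1
        rw [h1]
        exact zero_mem _)
      exact hϖ.not_isUnit (isUnit_of_dvd_unit h2 u.isUnit)

theorem card_sup_span_singleton (hϖ : Irreducible ϖ) {C : Submodule O M} {w : M} (hw : ϖ • w = 0)
    (hwC : w ∉ C) : Nat.card (C ⊔ Submodule.span O {w} : Submodule O M) =
      Nat.card C * Nat.card (ResidueField O) := by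
  let s : (O ⧸ maximalIdeal O ^ 1) →ₗ[O] M := cyclicMap hϖ w (by rwa [pow_one])
  have hs : ∀ a : O, s (Submodule.Quotient.mk a) = a • w := fun a => rfl
  have hrange : LinearMap.range (C.subtype.coprod s) = C ⊔ Submodule.span O {w} := by
    rw [LinearMap.range_coprod, Submodule.range_subtype,
      show LinearMap.range s = _ from Submodule.range_liftQ _ _ _,
      LinearMap.range_toSpanSingleton]
  have hinj : Function.Injective (C.subtype.coprod s) := by
    refine (injective_iff_map_eq_zero _).2 ?_
    rintro ⟨c, x⟩ h
    obtain ⟨a, rfl⟩ := Submodule.Quotient.mk_surjective _ x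
    rw [LinearMap.coprod_apply, hs, Submodule.subtype_apply] at h
    rcases isUnit_or_dvd hϖ a with ha | ⟨b, rfl⟩
    · exact absurd ((smul_mem_iff_of_isUnit ha).1
        ((eq_neg_of_add_eq_zero_right h) ▸ neg_mem c.2)) hwC
    · rw [mul_smul, hw, smul_zero, add_zero] at h
      refine Prod.ext (Subtype.ext h) ((mk_eq_zero_iff_pow_dvd hϖ).2 ?_)
      rw [pow_one]
      exact dvd_mul_left _ _
  have hq := card_quotient_pow (O := O) 1
  rw [pow_one (Nat.card _)] at hq
  rw [← hrange, ← hq, ← Nat.card_prod]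
  exact (Nat.card_congr (LinearEquiv.ofInjective _ hinj).toEquiv).symm

/-- The choices for the first generator: of the elements killed by `ϖ ^ (e + 1)`, those are excluded
which `ϖ ^ e` maps into `C`, and they form an extension of `C` by the `ϖ ^ e`-torsion. -/
theorem card_first_generator [Finite M] {N C : Submodule O M}
    (hC : ∀ c ∈ C, ϖ • c = 0) {e : ℕ} (hdiv : ∀ c ∈ C, ∃ w ∈ N, ϖ ^ e • w = c) :
    Nat.card {v : M // v ∈ N ∧ ϖ ^ (e + 1) • v = 0 ∧ ϖ ^ e • v ∉ C} +
      Nat.card (Submodule.torsionBy O N (ϖ ^ e)) * Nat.card C =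
    Nat.card (Submodule.torsionBy O N (ϖ ^ (e + 1))) := by
  let B : Submodule O N := C.comap (ϖ ^ e • N.subtype)
  have hBmem : ∀ v : N, v ∈ B ↔ ϖ ^ e • (v : M) ∈ C := fun v => Iff.rfl
  have hBle : B ≤ Submodule.torsionBy O N (ϖ ^ (e + 1)) := fun v hv => by
    rw [Submodule.mem_torsionBy_iff]
    ext
    rw [pow_succ', mul_smul]
    exact hC _ hv
  let f : B →ₗ[O] C := (ϖ ^ e • N.subtype).restrict fun _ hv => hv
  have hf : Function.Surjective f := by
    rintro ⟨c, hc⟩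
    obtain ⟨w, hw, hwc⟩ := hdiv c hc
    exact ⟨⟨⟨w, hw⟩, (hBmem _).2 (by rw [hwc]; exact hc)⟩, Subtype.ext hwc⟩
  have hB : Nat.card B = Nat.card (Submodule.torsionBy O N (ϖ ^ e)) * Nat.card C := by
    rw [Submodule.card_eq_card_quotient_mul_card (LinearMap.ker f)]
    congr 1
    · refine Nat.card_congr ⟨fun x => ⟨x.1.1, ?_⟩, fun x => ⟨⟨x.1, ?_⟩, ?_⟩, fun x => rfl,
        fun x => rfl⟩
      · have h1 : ϖ ^ e • (x.1.1 : M) = 0 := congrArg Subtype.val (LinearMap.mem_ker.1 x.2)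
        exact (Submodule.mem_torsionBy_iff _ _).2 (Subtype.ext h1)
      · have h1 : ϖ ^ e • (x.1 : M) = 0 :=
          congrArg Subtype.val ((Submodule.mem_torsionBy_iff _ _).1 x.2)
        rw [hBmem, h1]
        exact zero_mem _
      · have h1 : ϖ ^ e • (x.1 : M) = 0 :=
          congrArg Subtype.val ((Submodule.mem_torsionBy_iff _ _).1 x.2)
        exact LinearMap.mem_ker.2 (Subtype.ext h1)
    · exact Nat.card_congr (f.quotKerEquivOfSurjective hf).toEquiv
  have hA : Nat.card {v : M // v ∈ N ∧ ϖ ^ (e + 1) • v = 0 ∧ ϖ ^ e • v ∉ C} =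
      ((Submodule.torsionBy O N (ϖ ^ (e + 1)) : Set N) \ (B : Set N)).ncard := by
    rw [← Nat.card_coe_set_eq]
    refine Nat.card_congr ⟨fun v => ⟨⟨v.1, v.2.1⟩, Subtype.ext v.2.2.1, v.2.2.2⟩,
      fun v => ⟨v.1.1, v.1.2, congrArg Subtype.val v.2.1, v.2.2⟩, fun x => rfl, fun x => rfl⟩
  rw [hA, ← hB]
  exact Set.ncard_sdiff_add_ncard_of_subset hBle

/-- The number of independent tuples.  The hypothesis `hdiv` says that the elements of `C` are as
divisible in `N` as the socle of the span of a tuple; the condition `hb` says that there is room for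
a tuple, so that no subtraction in `embeddingCount` is truncated. -/
theorem card_tup [Finite (ResidueField O)] [Finite M] (hϖ : Irreducible ϖ) {q : ℕ}
    (hq : q = Nat.card (ResidueField O)) (hq1 : 1 < q) {r L : ℕ} {μ : Fin r → ℕ} (hμ : Antitone μ)
    (hL : ∀ i, μ i ≤ L) {N C : Submodule O M} {g : ℕ → ℕ} {b : ℕ}
    (hN : ∀ j, Nat.card (Submodule.torsionBy O N (ϖ ^ j)) = q ^ ∑ k ∈ Finset.Icc 1 j, g k)
    (hC : ∀ c ∈ C, ϖ • c = 0) (hCb : Nat.card C = q ^ b)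
    (hdiv : ∀ i, ∀ c ∈ C, ∃ w ∈ N, ϖ ^ (μ i - 1) • w = c)
    (hb : ∀ j, 1 ≤ j → 1 ≤ conj μ j → b + conj μ j ≤ g j) :
    (Nat.card (Tup ϖ μ N C) : ℂ) = embeddingCount q L g b μ := by
  induction r generalizing C b with
  | zero =>
    rw [embeddingCount_of_eq_zero hq1 L g b fun i => i.elim0]
    have : Nat.card (Tup ϖ μ N C) = 1 := Nat.card_eq_one_iff_exists.2
      ⟨⟨fun i => i.elim0, fun i => i.elim0, fun i => i.elim0, fun _ _ i => i.elim0⟩,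
        fun v => Subtype.ext (funext fun i => i.elim0)⟩
    rw [this, Nat.cast_one]
  | succ r ih =>
    rcases he : μ 0 with _ | e
    · have h0 : ∀ i, μ i = 0 := fun i => Nat.le_zero.1 (he ▸ hμ (Fin.zero_le i))
      rw [embeddingCount_of_eq_zero hq1 L g b h0]
      have : Nat.card (Tup ϖ μ N C) = 1 := Nat.card_eq_one_iff_exists.2
        ⟨⟨0, fun i => zero_mem _, fun i => smul_zero _, fun _ _ i => by
          rw [h0, pow_zero]; exact one_dvd _⟩, fun v => Subtype.ext (funext fun i => by
            have := v.2.2.1 i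
            rwa [h0, pow_zero, one_smul] at this)⟩
      rw [this, Nat.cast_one]
    · have htail : Antitone (Fin.tail μ) := fun i j hij => hμ (Fin.succ_le_succ_iff.2 hij)
      have hbe : b < g (e + 1) := by
        have h1 : 1 ≤ conj μ (e + 1) := by rw [conj_succ, he, if_pos le_rfl]; omega
        have := hb (e + 1) (by omega) h1
        omega
      have hfirst := card_first_generator (N := N) hC (e := e) (by
        have := hdiv 0
        rwa [he, Nat.add_sub_cancel] at this)
      rw [hN, hN, hCb] at hfirst
      have hrest : ∀ w : {v : M // v ∈ N ∧ ϖ ^ (e + 1) • v = 0 ∧ ϖ ^ e • v ∉ C},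
          (Nat.card (Tup ϖ (Fin.tail μ) N (C ⊔ Submodule.span O {ϖ ^ e • w.1})) : ℂ) =
            embeddingCount q L g (b + 1) (Fin.tail μ) := by
        rintro ⟨w, hwN, hwe, hwC⟩
        have hw : ϖ • ϖ ^ e • w = 0 := by rw [smul_smul, ← pow_succ', hwe]
        refine ih htail (fun i => hL i.succ) ?_ ?_ ?_ ?_
        · intro x hx
          obtain ⟨c, hc, y, hy, rfl⟩ := Submodule.mem_sup.1 hx
          obtain ⟨a, rfl⟩ := Submodule.mem_span_singleton.1 hy
          rw [smul_add, hC c hc, smul_comm, hw, smul_zero, add_zero]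
        · rw [card_sup_span_singleton hϖ hw hwC, hCb, ← hq, pow_succ]
        · intro i x hx
          obtain ⟨c, hc, y, hy, rfl⟩ := Submodule.mem_sup.1 hx
          obtain ⟨a, rfl⟩ := Submodule.mem_span_singleton.1 hy
          obtain ⟨z, hz, rfl⟩ := hdiv i.succ c hc
          have hie : Fin.tail μ i - 1 ≤ e := by
            have : μ i.succ ≤ μ 0 := hμ (Fin.zero_le _)
            simp only [Fin.tail]
            omega
          refine ⟨z + a • ϖ ^ (e - (Fin.tail μ i - 1)) • w,
            add_mem hz (N.smul_mem _ (N.smul_mem _ hwN)), ?_⟩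
          rw [smul_add, smul_comm _ a, smul_smul (ϖ ^ _) (ϖ ^ _), ← pow_add,
            Nat.add_sub_cancel' hie]
          rfl
        · intro j hj hj'
          have h1 : j ≤ e + 1 := by
            by_contra! hcon
            rw [conj_eq_zero fun i => lt_of_le_of_lt (he ▸ hμ (Fin.zero_le i.succ)) hcon] at hj'
            omega
          have h2 := conj_succ μ j
          rw [he, if_pos h1] at h2
          have h3 := hb j hj (by omega)
          omega
      have := Fintype.ofFinite {v : M // v ∈ N ∧ ϖ ^ (e + 1) • v = 0 ∧ ϖ ^ e • v ∉ C}
      have hequiv : Nat.card (Tup ϖ μ N C) =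
          ∑ w : {v : M // v ∈ N ∧ ϖ ^ (e + 1) • v = 0 ∧ ϖ ^ e • v ∉ C},
            Nat.card (Tup ϖ (Fin.tail μ) N (C ⊔ Submodule.span O {ϖ ^ e • w.1})) := by
        rw [← Nat.card_sigma]
        refine Nat.card_congr ⟨fun v => ⟨⟨v.1 0, ((mem_tup_succ hϖ hC he v.1).1 v.2).1⟩,
          ⟨Fin.tail v.1, ((mem_tup_succ hϖ hC he v.1).1 v.2).2⟩⟩,
          fun w => ⟨Fin.cons w.1.1 w.2.1, (mem_tup_succ hϖ hC he _).2 ⟨w.1.2, w.2.2⟩⟩,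
          fun v => Subtype.ext (Fin.cons_self_tail v.1), fun w => rfl⟩
      rw [hequiv, Nat.cast_sum, Finset.sum_congr rfl fun w _ => hrest w, Finset.sum_const,
        nsmul_eq_mul, Finset.card_univ, ← Nat.card_eq_fintype_card,
        embeddingCount_succ hq1 hμ he (he ▸ hL 0) hbe]
      congr 1
      rw [eq_sub_iff_add_eq]
      exact_mod_cast hfirst

end Tuples

/-! ### Counting submodules of a given type -/

section Submodules

variable {O : Type*} [CommRing O] [IsDomain O] [IsDiscreteValuationRing O] {ϖ : O}
  {M : Type*} [AddCommGroup M] [Module O M]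

/-- The linear map from `O_μ` sending the standard generators to a given tuple. -/
def tupMap (hϖ : Irreducible ϖ) {r : ℕ} {μ : Fin r → ℕ} (v : Fin r → M)
    (hv : ∀ i, ϖ ^ μ i • v i = 0) : TypeModule O μ →ₗ[O] M :=
  ∑ i, cyclicMap hϖ (v i) (hv i) ∘ₗ LinearMap.proj i

theorem tupMap_mk (hϖ : Irreducible ϖ) {r : ℕ} {μ : Fin r → ℕ} (v : Fin r → M)
    (hv : ∀ i, ϖ ^ μ i • v i = 0) (a : Fin r → O) :
    tupMap hϖ v hv (fun i => Submodule.Quotient.mk (a i)) = ∑ i, a i • v i := by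
  rw [tupMap, LinearMap.sum_apply]
  rfl

theorem typeModule_exists_rep {r : ℕ} {μ : Fin r → ℕ} (x : TypeModule O μ) :
    ∃ a : Fin r → O, x = fun i => Submodule.Quotient.mk (a i) := by
  choose a ha using fun i => Submodule.Quotient.mk_surjective _ (x i)
  exact ⟨a, funext fun i => (ha i).symm⟩

theorem range_tupMap (hϖ : Irreducible ϖ) {r : ℕ} {μ : Fin r → ℕ} (v : Fin r → M)
    (hv : ∀ i, ϖ ^ μ i • v i = 0) :
    LinearMap.range (tupMap hϖ v hv) = Submodule.span O (Set.range v) := by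
  ext y
  rw [Submodule.mem_span_range_iff_exists_fun]
  constructor
  · rintro ⟨x, rfl⟩
    obtain ⟨a, rfl⟩ := typeModule_exists_rep x
    exact ⟨a, (tupMap_mk hϖ v hv a).symm⟩
  · rintro ⟨a, rfl⟩
    exact ⟨_, tupMap_mk hϖ v hv a⟩

theorem Tup.eq_zero_of_mem (hϖ : Irreducible ϖ) {r : ℕ} {μ : Fin r → ℕ} {N C : Submodule O M}
    {v : Fin r → M} (hv : v ∈ Tup ϖ μ N C) {x : TypeModule O μ} (hx : tupMap hϖ v hv.2.1 x ∈ C) :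
    x = 0 := by
  obtain ⟨a, rfl⟩ := typeModule_exists_rep x
  rw [tupMap_mk] at hx
  exact funext fun i => (mk_eq_zero_iff_pow_dvd hϖ).2 (hv.2.2 a hx i)

theorem Tup.injective (hϖ : Irreducible ϖ) {r : ℕ} {μ : Fin r → ℕ} {N C : Submodule O M}
    {v : Fin r → M} (hv : v ∈ Tup ϖ μ N C) : Function.Injective (tupMap hϖ v hv.2.1) :=
  (injective_iff_map_eq_zero _).2 fun x hx => Tup.eq_zero_of_mem hϖ hv (by
    rw [hx]; exact zero_mem C)

theorem Tup.hasType (hϖ : Irreducible ϖ) {r : ℕ} {μ : Fin r → ℕ} {N C : Submodule O M}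
    {v : Fin r → M} (hv : v ∈ Tup ϖ μ N C) : HasType O μ (Submodule.span O (Set.range v)) :=
  ⟨((LinearEquiv.ofInjective _ (Tup.injective hϖ hv)).trans
    (LinearEquiv.ofEq _ _ (range_tupMap hϖ v hv.2.1))).symm⟩

theorem Tup.disjoint (hϖ : Irreducible ϖ) {r : ℕ} {μ : Fin r → ℕ} {N C : Submodule O M}
    {v : Fin r → M} (hv : v ∈ Tup ϖ μ N C) : Disjoint (Submodule.span O (Set.range v)) C := by
  rw [← range_tupMap hϖ v hv.2.1, Submodule.disjoint_def]
  rintro _ ⟨x, rfl⟩ hx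
  rw [Tup.eq_zero_of_mem hϖ hv hx, map_zero]

theorem Tup.span_le {r : ℕ} {μ : Fin r → ℕ} {N C : Submodule O M}
    {v : Fin r → M} (hv : v ∈ Tup ϖ μ N C) : Submodule.span O (Set.range v) ≤ N :=
  Submodule.span_le.2 (by rintro _ ⟨i, rfl⟩; exact hv.1 i)

variable (O) in
/-- The submodules of `N` of type `μ` which are disjoint from `C`. -/
def subsOfType {r : ℕ} (μ : Fin r → ℕ) (N C : Submodule O M) : Set (Submodule O M) :=
  {x | x ≤ N ∧ HasType O μ x ∧ Disjoint x C}

theorem finite_submodule_of_finite [Finite M] : Finite (Submodule O M) :=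
  Finite.of_injective (fun x => (x : Set M)) SetLike.coe_injective

/-- Every submodule of type `μ` is generated by equally many independent tuples. -/
theorem card_tup_eq_mul [Finite M] (hϖ : Irreducible ϖ) {r : ℕ} {μ : Fin r → ℕ}
    {N C : Submodule O M} {A : ℕ}
    (hA : ∀ x : Submodule O M, HasType O μ x → Nat.card (Tup ϖ μ x ⊥) = A) :
    Nat.card (Tup ϖ μ N C) = (subsOfType O μ N C).ncard * A := by
  have := finite_submodule_of_finite (O := O) (M := M)
  have := Fintype.ofFinite (subsOfType O μ N C)
  let f : Tup ϖ μ N C → subsOfType O μ N C := fun v =>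
    ⟨Submodule.span O (Set.range v.1), Tup.span_le v.2, Tup.hasType hϖ v.2, Tup.disjoint hϖ v.2⟩
  have hfib : ∀ x, Nat.card {v // f v = x} = A := by
    rintro ⟨x, hxN, hx, hxC⟩
    rw [← hA x hx]
    refine Nat.card_congr ⟨fun v => ⟨v.1.1, ?_, v.1.2.2.1, fun a ha => ?_⟩,
      fun v => ⟨⟨v.1, fun i => hxN (v.2.1 i), v.2.2.1, fun a ha => ?_⟩, ?_⟩,
      fun v => rfl, fun v => rfl⟩
    · intro i
      have h1 : Submodule.span O (Set.range v.1.1) = x := congrArg Subtype.val v.2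
      exact h1.le (Submodule.subset_span ⟨i, rfl⟩)
    · exact v.1.2.2.2 a (by rw [(Submodule.mem_bot O).1 ha]; exact zero_mem _)
    · refine v.2.2.2 a ?_
      rw [Submodule.mem_bot]
      exact Submodule.disjoint_def.1 hxC _
        (Submodule.sum_mem _ fun i _ => x.smul_mem _ (v.2.1 i)) ha
    · refine Subtype.ext (SetLike.coe_injective (Set.eq_of_subset_of_ncard_le (Tup.span_le v.2) ?_))
      rw [← Nat.card_coe_set_eq, ← Nat.card_coe_set_eq]
      exact (Nat.card_congr (hx.some.trans (Tup.hasType hϖ v.2).some.symm).toEquiv).le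
  rw [Nat.card_congr (Equiv.sigmaFiberEquiv f).symm, Nat.card_sigma,
    Finset.sum_congr rfl fun x _ => hfib x, Finset.sum_const, Finset.card_univ,
    ← Nat.card_eq_fintype_card, Nat.card_coe_set_eq, smul_eq_mul]

variable [Finite (ResidueField O)] [Finite M] {q L : ℕ}

theorem card_tup_of_hasType (hϖ : Irreducible ϖ) (hq : q = Nat.card (ResidueField O)) (hq1 : 1 < q)
    {r s : ℕ} {μ : Fin r → ℕ} (hμ : Antitone μ) (hL : ∀ i, μ i ≤ L) {l : Fin s → ℕ}
    {N : Submodule O M} (hN : HasType O l N) (hle : ∀ j, 1 ≤ j → conj μ j ≤ conj l j) :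
    (Nat.card (Tup ϖ μ N ⊥) : ℂ) = embeddingCount q L (conj l) 0 μ := by
  refine card_tup hϖ hq hq1 hμ hL (fun j => hq ▸ hN.card_torsionBy hϖ j) ?_ ?_ ?_ ?_
  · rintro c hc
    rw [(Submodule.mem_bot O).1 hc, smul_zero]
  · rw [pow_zero]
    exact Nat.card_unique
  · rintro i c hc
    exact ⟨0, zero_mem _, by rw [(Submodule.mem_bot O).1 hc, smul_zero]⟩
  · intro j hj _
    rw [zero_add]
    exact hle j hj

/-- The number of submodules of type `μ` times the number of automorphisms of such a module is the
number of embeddings. -/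
theorem ncard_subsOfType_mul (hϖ : Irreducible ϖ) (hq : q = Nat.card (ResidueField O))
    (hq1 : 1 < q) {r : ℕ} {μ : Fin r → ℕ} (hμ : Antitone μ) (hL : ∀ i, μ i ≤ L)
    {N C : Submodule O M} :
    ((subsOfType O μ N C).ncard : ℂ) * embeddingCount q L (conj μ) 0 μ =
      Nat.card (Tup ϖ μ N C) := by
  by_cases hx : ∃ x : Submodule O M, HasType O μ x
  · obtain ⟨x, hx⟩ := hx
    rw [card_tup_eq_mul hϖ (A := Nat.card (Tup ϖ μ x ⊥)), Nat.cast_mul,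
      card_tup_of_hasType hϖ hq hq1 hμ hL hx fun _ _ => le_rfl]
    intro y hy
    exact_mod_cast (card_tup_of_hasType hϖ hq hq1 hμ hL hy fun _ _ => le_rfl).trans
      (card_tup_of_hasType hϖ hq hq1 hμ hL hx fun _ _ => le_rfl).symm
  · have h1 : subsOfType O μ N C = ∅ := Set.eq_empty_of_forall_notMem fun x h => hx ⟨x, h.2.1⟩
    have h2 : Tup ϖ μ N C = ∅ := Set.eq_empty_of_forall_notMem fun v h => hx ⟨_, Tup.hasType hϖ h⟩
    rw [h1, h2]
    simp

theorem IsUniform.exists_pow_smul {ℓ : ℕ} (hM : IsUniform ϖ ℓ M) {i k : ℕ} {x : M}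
    (hx : ϖ ^ i • x = 0) (hik : i + k ≤ ℓ) : ∃ w, ϖ ^ k • w = x := by
  induction k generalizing i x with
  | zero => exact ⟨x, by rw [pow_zero, one_smul]⟩
  | succ k ih =>
    obtain ⟨y, rfl⟩ := hM.exists_smul x (by
      rw [← Nat.sub_add_cancel (show i ≤ ℓ - 1 by omega), pow_add, mul_smul, hx, smul_zero])
    obtain ⟨w, rfl⟩ := ih (i := i + 1) (x := y) (by rwa [pow_succ, mul_smul]) (by omega)
    exact ⟨w, by rw [pow_succ', mul_smul]⟩

theorem conj_rect {ℓ r j : ℕ} (hj : j ≤ ℓ) : conj (rect ℓ r) j = r := by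
  have h : ∀ i ∈ (Finset.univ : Finset (Fin r)), j ≤ rect ℓ r i := fun _ _ => hj
  rw [conj, Finset.filter_true_of_mem h, Finset.card_univ, Fintype.card_fin]

theorem card_tup_ambient (hϖ : Irreducible ϖ) (hq : q = Nat.card (ResidueField O)) (hq1 : 1 < q)
    {ℓ n r b : ℕ} {μ : Fin r → ℕ} (hμ : Antitone μ) (hL : ∀ i, μ i ≤ ℓ)
    (hM : HasType O (rect ℓ n) M) {C : Submodule O M} (hC : ∀ c ∈ C, ϖ • c = 0)
    (hCb : Nat.card C = q ^ b) (hb : b + r ≤ n) :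
    (Nat.card (Tup ϖ μ ⊤ C) : ℂ) = embeddingCount q ℓ (conj (rect ℓ n)) b μ := by
  have htop : HasType O (rect ℓ n) (⊤ : Submodule O M) := hM.congr Submodule.topEquiv.symm
  refine card_tup hϖ hq hq1 hμ hL (fun j => hq ▸ htop.card_torsionBy hϖ j) hC hCb ?_ ?_
  · intro i c hc
    rcases Nat.lt_or_ge 1 (μ i) with h | h
    · obtain ⟨w, hw⟩ := (hM.isUniform hϖ).exists_pow_smul (i := 1) (k := μ i - 1) (x := c)
        (by rw [pow_one]; exact hC c hc) (by have := hL i; omega)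
      exact ⟨w, trivial, hw⟩
    · exact ⟨c, trivial, by rw [show μ i - 1 = 0 by omega, pow_zero, one_smul]⟩
  · intro j hj hj'
    have h1 : j ≤ ℓ := by
      by_contra! hcon
      rw [conj_eq_zero fun i => lt_of_le_of_lt (hL i) hcon] at hj'
      omega
    rw [conj_rect h1]
    have h2 : conj μ j ≤ r := (Finset.card_filter_le _ _).trans (by simp)
    omega

theorem ncard_mul_eq_ncard_mul {S : Type*} [Finite S] (P Q : Set S) (R : S → S → Prop) {a c : ℕ}
    (ha : ∀ x ∈ P, {y | y ∈ Q ∧ R x y}.ncard = a) (hc : ∀ y ∈ Q, {x | x ∈ P ∧ R x y}.ncard = c) :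
    P.ncard * a = Q.ncard * c := by
  classical
  have := Fintype.ofFinite S
  rw [Set.ncard_eq_toFinset_card' P, Set.ncard_eq_toFinset_card' Q]
  refine Finset.card_mul_eq_card_mul R (fun x hx => ?_) (fun y hy => ?_)
  · rw [← ha x (Set.mem_toFinset.1 hx), Set.ncard_eq_toFinset_card']
    congr 1; ext y; simp [Finset.mem_bipartiteAbove]
  · rw [← hc y (Set.mem_toFinset.1 hy), Set.ncard_eq_toFinset_card']
    congr 1; ext x; simp [Finset.mem_bipartiteBelow]

theorem HasType.map {r : ℕ} {μ : Fin r → ℕ} {x : Submodule O M} (h : HasType O μ x)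
    (σ : M ≃ₗ[O] M) : HasType O μ (x.map (σ : M →ₗ[O] M)) :=
  h.congr (σ.submoduleMap x)

theorem ncard_setOf_map (σ : M ≃ₗ[O] M) {P Q : Submodule O M → Prop}
    (h : ∀ x, P x ↔ Q (x.map (σ : M →ₗ[O] M))) : {x | P x}.ncard = {x | Q x}.ncard := by
  rw [← Nat.card_coe_set_eq, ← Nat.card_coe_set_eq]
  exact Nat.card_congr ((Submodule.orderIsoMapComap σ).toEquiv.subtypeEquiv h)

theorem hasType_map_iff {r : ℕ} {μ : Fin r → ℕ} {x : Submodule O M} (σ : M ≃ₗ[O] M) :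
    HasType O μ (x.map (σ : M →ₗ[O] M)) ↔ HasType O μ x :=
  ⟨fun h => h.congr (σ.submoduleMap x).symm, fun h => h.map σ⟩

theorem map_le_map_equiv {x y : Submodule O M} (σ : M ≃ₗ[O] M) :
    x.map (σ : M →ₗ[O] M) ≤ y.map (σ : M →ₗ[O] M) ↔ x ≤ y :=
  Submodule.map_le_map_iff_of_injective σ.injective _ _

theorem disjoint_map_equiv {x y : Submodule O M} (σ : M ≃ₗ[O] M) :
    Disjoint (x.map (σ : M →ₗ[O] M)) (y.map (σ : M →ₗ[O] M)) ↔ Disjoint x y :=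
  disjoint_map_orderIso_iff (f := Submodule.orderIsoMapComap σ)

/-- The number of free submodules of rank `m` containing `x` and disjoint from `C`, by counting the
pairs of such submodules in two ways. -/
theorem ncard_free_above (hϖ : Irreducible ϖ) (hq : q = Nat.card (ResidueField O)) (hq1 : 1 < q)
    {ℓ n m r b : ℕ} {μ : Fin r → ℕ} (hμ : Antitone μ) (hL : ∀ i, μ i ≤ ℓ) (hrm : r ≤ m)
    (hM : HasType O (rect ℓ n) M) {C : Submodule O M} (hC : ∀ c ∈ C, ϖ • c = 0)
    (hCb : Nat.card C = q ^ b) (hb : b + m ≤ n) {x : Submodule O M} (hx : HasType O μ x)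
    (hxC : Disjoint x C) :
    ({y : Submodule O M | HasType O (rect ℓ m) y ∧ Disjoint y C ∧ x ≤ y}.ncard : ℂ) *
        (embeddingCount q ℓ (conj (rect ℓ m)) 0 (rect ℓ m) *
          embeddingCount q ℓ (conj (rect ℓ n)) b μ) =
      embeddingCount q ℓ (conj (rect ℓ n)) b (rect ℓ m) *
        embeddingCount q ℓ (conj (rect ℓ m)) 0 μ := by
  have := finite_submodule_of_finite (O := O) (M := M)
  have hrect : Antitone (rect ℓ m) := fun _ _ _ => le_rfl
  have hA := embeddingCount_ne_zero hq1 ℓ (conj μ) 0 μ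
  have key : ((subsOfType O μ ⊤ C).ncard : ℂ) *
      ({y : Submodule O M | HasType O (rect ℓ m) y ∧ Disjoint y C ∧ x ≤ y}.ncard : ℂ) =
      (subsOfType O (rect ℓ m) ⊤ C).ncard *
        (embeddingCount q ℓ (conj (rect ℓ m)) 0 μ / embeddingCount q ℓ (conj μ) 0 μ) := by
    rcases Set.eq_empty_or_nonempty (subsOfType O (rect ℓ m) ⊤ C) with he | ⟨y₀, hy₀⟩
    · have h1 : {y : Submodule O M | HasType O (rect ℓ m) y ∧ Disjoint y C ∧ x ≤ y} = ∅ :=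
        Set.eq_empty_of_forall_notMem fun y hy => by
          have : y ∈ subsOfType O (rect ℓ m) ⊤ C := ⟨le_top, hy.1, hy.2.1⟩
          rw [he] at this
          exact this
      rw [he, h1]
      simp
    have hin : ∀ y : Submodule O M, HasType O (rect ℓ m) y →
        ((subsOfType O μ y ⊥).ncard : ℂ) =
          embeddingCount q ℓ (conj (rect ℓ m)) 0 μ / embeddingCount q ℓ (conj μ) 0 μ := by
      intro y hy
      rw [eq_div_iff hA, ncard_subsOfType_mul hϖ hq hq1 hμ hL,
        card_tup_of_hasType hϖ hq hq1 hμ hL hy]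
      intro j hj
      by_cases hjℓ : j ≤ ℓ
      · rw [conj_rect hjℓ]
        exact (Finset.card_filter_le _ _).trans (by simpa using hrm)
      · rw [conj_eq_zero fun i => lt_of_le_of_lt (hL i) (not_le.1 hjℓ)]
        exact Nat.zero_le _
    rw [← hin y₀ hy₀.2.1]
    norm_cast
    refine ncard_mul_eq_ncard_mul _ _ (fun x y => x ≤ y) (fun x' hx' => ?_) fun y hy => ?_
    · obtain ⟨σ, hσx, hσC⟩ := exists_equiv_map_disjoint hϖ (hM.isUniform hϖ) hx'.2.2 hxC
        (hx'.2.1.some.trans hx.some.symm)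
      refine ncard_setOf_map σ fun y => ?_
      rw [hasType_map_iff, ← hσx, map_le_map_equiv]
      nth_rw 2 [← hσC]
      rw [disjoint_map_equiv]
      exact ⟨fun h => ⟨h.1.2.1, h.1.2.2, h.2⟩, fun h => ⟨⟨le_top, h.1, h.2.1⟩, h.2.2⟩⟩
    · have h1 := (hin y hy.2.1).trans (hin y₀ hy₀.2.1).symm
      rw [← Nat.cast_injective h1]
      congr 1
      ext z
      exact ⟨fun h => ⟨h.2, h.1.2.1, disjoint_bot_right⟩,
        fun h => ⟨⟨le_top, h.2.1, hy.2.2.mono_left h.1⟩, h.1⟩⟩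
  have h1 := ncard_subsOfType_mul hϖ hq hq1 hμ hL (N := ⊤) (C := C)
  have h2 := ncard_subsOfType_mul hϖ hq hq1 hrect (fun _ => le_refl ℓ) (N := ⊤) (C := C)
  rw [card_tup_ambient hϖ hq hq1 hμ hL hM hC hCb (by omega)] at h1
  rw [card_tup_ambient hϖ hq hq1 hrect (fun _ => le_refl ℓ) hM hC hCb hb] at h2
  rw [← h1, ← h2]
  rw [mul_div_assoc', eq_div_iff hA] at key
  linear_combination (embeddingCount q ℓ (conj (rect ℓ m)) 0 (rect ℓ m)) * key

/-- The number of submodules of type `μ` between `z` and a free submodule `y`, by counting the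
pairs of such submodules in two ways. -/
theorem ncard_between (hϖ : Irreducible ϖ) (hq : q = Nat.card (ResidueField O)) (hq1 : 1 < q)
    {ℓ m : ℕ} {μ κ : Fin m → ℕ} (hμ : Antitone μ) (hμL : ∀ i, μ i ≤ ℓ) (hκ : Antitone κ)
    (hκL : ∀ i, κ i ≤ ℓ) (hκμ : ∀ i, κ i ≤ μ i) (hM : IsUniform ϖ ℓ M) {z y : Submodule O M}
    (hz : HasType O κ z) (hy : HasType O (rect ℓ m) y) (hzy : z ≤ y) :
    ({x : Submodule O M | HasType O μ x ∧ z ≤ x ∧ x ≤ y}.ncard : ℂ) *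
        (embeddingCount q ℓ (conj μ) 0 μ * embeddingCount q ℓ (conj (rect ℓ m)) 0 κ) =
      embeddingCount q ℓ (conj (rect ℓ m)) 0 μ * embeddingCount q ℓ (conj μ) 0 κ := by
  have := finite_submodule_of_finite (O := O) (M := M)
  have hA := embeddingCount_ne_zero hq1 ℓ (conj κ) 0 κ
  have hmono : ∀ {l : Fin m → ℕ}, (∀ i, l i ≤ ℓ) → ∀ j, 1 ≤ j → conj l j ≤ conj (rect ℓ m) j :=
    fun hl j _ => Finset.card_le_card fun i hi =>
      Finset.mem_filter.2 ⟨Finset.mem_univ _, (Finset.mem_filter.1 hi).2.trans (hl i)⟩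
  have hin : ∀ x : Submodule O M, HasType O μ x → ((subsOfType O κ x ⊥).ncard : ℂ) =
      embeddingCount q ℓ (conj μ) 0 κ / embeddingCount q ℓ (conj κ) 0 κ := by
    intro x hx
    rw [eq_div_iff hA, ncard_subsOfType_mul hϖ hq hq1 hκ hκL,
      card_tup_of_hasType hϖ hq hq1 hκ hκL hx]
    exact fun j _ => Finset.card_le_card fun i hi =>
      Finset.mem_filter.2 ⟨Finset.mem_univ _, (Finset.mem_filter.1 hi).2.trans (hκμ i)⟩
  have key : ((subsOfType O κ y ⊥).ncard : ℂ) *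
      ({x : Submodule O M | HasType O μ x ∧ z ≤ x ∧ x ≤ y}.ncard : ℂ) =
      (subsOfType O μ y ⊥).ncard *
        (embeddingCount q ℓ (conj μ) 0 κ / embeddingCount q ℓ (conj κ) 0 κ) := by
    rcases Set.eq_empty_or_nonempty (subsOfType O μ y ⊥) with he | ⟨x₀, hx₀⟩
    · have h1 : {x : Submodule O M | HasType O μ x ∧ z ≤ x ∧ x ≤ y} = ∅ :=
        Set.eq_empty_of_forall_notMem fun x hx => by
          have : x ∈ subsOfType O μ y ⊥ := ⟨hx.2.2, hx.1, disjoint_bot_right⟩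
          rw [he] at this
          exact this
      rw [he, h1]
      simp
    rw [← hin x₀ hx₀.2.1]
    norm_cast
    refine ncard_mul_eq_ncard_mul _ _ (fun z x => z ≤ x) (fun z' hz' => ?_) fun x hx => ?_
    · obtain ⟨σ, hσz, hσy⟩ := exists_equiv_map_flag hϖ hM hz'.1 hzy (hy.isUniform hϖ)
        (LinearEquiv.refl O y) (hz'.2.1.some.trans hz.some.symm)
      refine ncard_setOf_map σ fun x => ?_
      rw [hasType_map_iff, ← hσz, map_le_map_equiv]
      nth_rw 2 [← hσy]
      rw [map_le_map_equiv]
      exact ⟨fun h => ⟨h.1.2.1, h.2, h.1.1⟩, fun h => ⟨⟨h.2.2, h.1, disjoint_bot_right⟩, h.2.1⟩⟩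
    · have h1 := (hin x hx.2.1).trans (hin x₀ hx₀.2.1).symm
      rw [← Nat.cast_injective h1]
      congr 1
      ext w
      exact ⟨fun h => ⟨h.2, h.1.2⟩, fun h => ⟨⟨h.1.trans hx.1, h.2⟩, h.1⟩⟩
  have h1 := ncard_subsOfType_mul hϖ hq hq1 hμ hμL (N := y) (C := ⊥)
  have h2 := ncard_subsOfType_mul hϖ hq hq1 hκ hκL (N := y) (C := ⊥)
  rw [card_tup_of_hasType hϖ hq hq1 hμ hμL hy (hmono hμL)] at h1
  rw [card_tup_of_hasType hϖ hq hq1 hκ hκL hy (hmono hκL)] at h2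
  rw [← h1, ← h2]
  rw [mul_div_assoc', eq_div_iff hA] at key
  linear_combination (embeddingCount q ℓ (conj μ) 0 μ) * key

end Submodules

/-! ### Nondegenerate characters -/

section Characters

variable {O : Type*} [CommRing O] [IsDomain O] [IsDiscreteValuationRing O] {ϖ : O}

/-- An additive character of `Hom(Z, G)` which is nontrivial on the homomorphisms vanishing on any
given proper submodule of `Z`, and on those with values in any given nonzero submodule of `G`. -/
structure IsNondegenerate {Z G : Type*} [AddCommGroup Z] [Module O Z] [AddCommGroup G] [Module O G]
    (ψ : AddChar (Z →ₗ[O] G) ℂ) : Prop where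
  left : ∀ S : Submodule O Z, S ≠ ⊤ → ∃ d : Z →ₗ[O] G, (∀ s ∈ S, d s = 0) ∧ ψ d ≠ 1
  right : ∀ S : Submodule O G, S ≠ ⊥ → ∃ d : Z →ₗ[O] G, (∀ z, d z ∈ S) ∧ ψ d ≠ 1

/-- The type of the socle of a module of type `μ`. -/
def socleType {r : ℕ} (μ : Fin r → ℕ) : Fin r → ℕ := fun i => min 1 (μ i)

/-- A proper submodule lies in the kernel of a nonzero map to the residue field. -/
theorem exists_residue_functional {Z : Type*} [AddCommGroup Z] [Module O Z]
    [Finite Z] {S : Submodule O Z} (hS : S ≠ ⊤) :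
    ∃ f : Z →ₗ[O] O ⧸ maximalIdeal O ^ 1, f ≠ 0 ∧ ∀ s ∈ S, f s = 0 := by
  obtain ⟨T, hT, hST⟩ := (eq_top_or_exists_le_coatom S).resolve_left hS
  have hsimple : IsSimpleModule O (Z ⧸ T) := isSimpleModule_iff_isCoatom.2 hT
  obtain ⟨I, hI, ⟨e⟩⟩ := isSimpleModule_iff_quot_maximal.1 hsimple
  have hI' : I = maximalIdeal O ^ 1 := by rw [pow_one, IsLocalRing.eq_maximalIdeal hI]
  subst hI'
  refine ⟨e.toLinearMap ∘ₗ T.mkQ, fun h => hT.1 (eq_top_iff.2 fun z _ => ?_), fun s hs => ?_⟩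
  · have h1 : e (T.mkQ z) = 0 := LinearMap.congr_fun h z
    exact (Submodule.Quotient.mk_eq_zero T).1 ((LinearEquiv.map_eq_zero_iff e).1 h1)
  · have h1 : T.mkQ s = 0 := (Submodule.Quotient.mk_eq_zero T).2 (hST hs)
    rw [LinearMap.comp_apply, h1, map_zero]

variable [Finite (ResidueField O)]

/-- The character sends `t` to the product over the standard generators of `Z` of characters of the
diagonal entries of `t`: it is a nontrivial character applied to the trace. -/
theorem exists_isNondegenerate (hϖ : Irreducible ϖ) {r : ℕ} (κ : Fin r → ℕ) :
    ∃ ψ : AddChar (TypeModule O κ →ₗ[O] TypeModule O (socleType κ)) ℂ, IsNondegenerate ψ := by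
  classical
  have hχ : ∀ i, ∃ (χ : AddChar (O ⧸ maximalIdeal O ^ socleType κ i) ℂ) (a : O), κ i ≠ 0 →
      χ (Submodule.Quotient.mk a) ≠ 1 := by
    intro i
    by_cases hi : κ i = 0
    · exact ⟨1, 0, fun h => absurd hi h⟩
    · have h1 : (Submodule.Quotient.mk 1 : O ⧸ maximalIdeal O ^ socleType κ i) ≠ 0 := by
        rw [ne_eq, mk_eq_zero_iff_pow_dvd hϖ, socleType, min_eq_left (by omega), pow_one]
        exact fun h => hϖ.not_isUnit (isUnit_of_dvd_one h)
      obtain ⟨χ, hχ⟩ := AddChar.exists_apply_ne_zero.2 h1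
      exact ⟨χ, 1, fun _ => hχ⟩
  choose χ a hχ using hχ
  let g : ∀ i, TypeModule O κ := fun i => Pi.single i (Submodule.Quotient.mk 1)
  let D : ∀ i, (TypeModule O κ →ₗ[O] TypeModule O (socleType κ)) →ₗ[O]
      O ⧸ maximalIdeal O ^ socleType κ i := fun i => LinearMap.proj i ∘ₗ LinearMap.applyₗ (g i)
  let ψ : AddChar (TypeModule O κ →ₗ[O] TypeModule O (socleType κ)) ℂ :=
    ∏ i, (χ i).compAddMonoidHom (D i).toAddMonoidHom
  have hψ : ∀ d i, κ i ≠ 0 → d (g i) i = Submodule.Quotient.mk (a i) →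
      (∀ j ≠ i, d (g j) j = 0) → ψ d ≠ 1 := by
    intro d i hi hdi hdj
    have h1 : ψ d = ∏ j, χ j (d (g j) j) := AddChar.prod_apply _ _ _
    rw [h1, Finset.prod_eq_single i (fun j _ hj => by rw [hdj j hj, AddChar.map_zero_eq_one])
      (fun h => absurd (Finset.mem_univ i) h), hdi]
    exact hχ i hi
  have hunit : ∀ {u : O}, (Submodule.Quotient.mk u : O ⧸ maximalIdeal O ^ 1) ≠ 0 →
      ∃ w, w * u = 1 := by
    intro u hu
    rw [ne_eq, mk_eq_zero_iff_pow_dvd hϖ, pow_one] at hu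
    rcases isUnit_or_dvd hϖ u with hu' | ⟨b, rfl⟩
    · exact hu'.exists_left_inv
    · exact absurd (dvd_mul_left _ _) hu
  have htors : ∀ x : TypeModule O (socleType κ), ϖ ^ 1 • x = 0 :=
    pow_smul_typeModule hϖ fun i => min_le_left _ _
  refine ⟨ψ, fun S hS => ?_, fun S hS => ?_⟩
  · obtain ⟨f, hf, hfS⟩ := exists_residue_functional hS
    obtain ⟨i, hi⟩ : ∃ i, f (g i) ≠ 0 := by
      by_contra! hcon
      refine hf (LinearMap.pi_ext' fun i => LinearMap.ext fun x => ?_)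
      obtain ⟨b, rfl⟩ := Submodule.Quotient.mk_surjective _ x
      have h1 : (Submodule.Quotient.mk b : O ⧸ maximalIdeal O ^ κ i) =
          b • Submodule.Quotient.mk 1 := by
        rw [← Submodule.Quotient.mk_smul, smul_eq_mul, mul_one]
      rw [h1, map_smul, map_smul]
      have h2 : (f ∘ₗ LinearMap.single O _ i) (Submodule.Quotient.mk 1) = 0 := hcon i
      rw [h2, smul_zero, LinearMap.zero_comp, LinearMap.zero_apply, smul_zero]
    have hκ : κ i ≠ 0 := by
      intro h
      apply hi
      have : g i = 0 := by
        refine Pi.single_eq_zero_iff.2 ((mk_eq_zero_iff_pow_dvd hϖ).2 ?_)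
        rw [h, pow_zero]
      rw [this, map_zero]
    obtain ⟨u, hu⟩ := Submodule.Quotient.mk_surjective _ (f (g i))
    obtain ⟨w, hw⟩ := hunit (hu ▸ hi)
    refine ⟨cyclicMap hϖ (Pi.single i (Submodule.Quotient.mk (w * a i))) (htors _) ∘ₗ f,
      fun s hs => by rw [LinearMap.comp_apply, hfS s hs, map_zero], hψ _ i hκ ?_ fun j hj => ?_⟩
    · rw [LinearMap.comp_apply, ← hu, cyclicMap_mk, Pi.smul_apply, Pi.single_eq_same,
        ← Submodule.Quotient.mk_smul, smul_eq_mul, ← mul_assoc, mul_comm u, hw, one_mul]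
    · obtain ⟨b, hb⟩ := Submodule.Quotient.mk_surjective _ (f (g j))
      rw [LinearMap.comp_apply, ← hb, cyclicMap_mk, Pi.smul_apply, Pi.single_eq_of_ne hj, smul_zero]
  · obtain ⟨c, hcS, hc⟩ := (Submodule.ne_bot_iff S).1 hS
    obtain ⟨i, hi⟩ := Function.ne_iff.1 hc
    obtain ⟨u, hu⟩ := Submodule.Quotient.mk_surjective _ (c i)
    have hκ : κ i ≠ 0 := by
      intro h
      apply hi
      rw [← hu, Pi.zero_apply, mk_eq_zero_iff_pow_dvd hϖ, socleType, h, min_eq_right (by omega),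
        pow_zero]
      exact one_dvd _
    obtain ⟨w, hw⟩ := hunit (u := u) (by
      rw [← hu, Pi.zero_apply, ne_eq, mk_eq_zero_iff_pow_dvd hϖ, socleType,
        min_eq_left (by omega)] at hi
      rwa [ne_eq, mk_eq_zero_iff_pow_dvd hϖ])
    have h1 : ϖ ^ κ i • (Submodule.Quotient.mk 1 : O ⧸ maximalIdeal O ^ 1) = 0 := by
      rw [← Submodule.Quotient.mk_smul, mk_eq_zero_iff_pow_dvd hϖ, smul_eq_mul, mul_one]
      exact pow_dvd_pow _ (by omega)
    have hval : ∀ x : TypeModule O κ, ∀ b : O, x i = Submodule.Quotient.mk b →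
        (cyclicMap hϖ ((w * a i) • c) (htors _) ∘ₗ cyclicMap hϖ _ h1 ∘ₗ LinearMap.proj i) x =
          (b * (w * a i)) • c := by
      intro x b hb
      rw [LinearMap.comp_apply, LinearMap.comp_apply, LinearMap.proj_apply, hb, cyclicMap_mk,
        ← Submodule.Quotient.mk_smul, cyclicMap_mk, smul_eq_mul, mul_one, smul_smul]
    refine ⟨cyclicMap hϖ ((w * a i) • c) (htors _) ∘ₗ cyclicMap hϖ _ h1 ∘ₗ LinearMap.proj i,
      fun z => ?_, hψ _ i hκ ?_ fun j hj => ?_⟩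
    · obtain ⟨b, hb⟩ := Submodule.Quotient.mk_surjective _ (z i)
      rw [hval z b hb.symm]
      exact S.smul_mem _ hcS
    · rw [hval _ 1 (Pi.single_eq_same _ _), Pi.smul_apply, ← hu, ← Submodule.Quotient.mk_smul,
        smul_eq_mul, one_mul, mul_right_comm, hw, one_mul]
    · rw [hval _ 0 (Pi.single_eq_of_ne hj.symm _), zero_mul, zero_smul, Pi.zero_apply]

end Characters

/-! ### The eigenvectors of the cellular operators -/

section CharacterSums

variable {O : Type*} [CommRing O] [IsDomain O] [IsDiscreteValuationRing O] {ϖ : O}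
  {M Z G : Type*} [AddCommGroup M] [Module O M] [AddCommGroup Z] [Module O Z]
  [AddCommGroup G] [Module O G]

/-- The submodule `{ι z + γ (t z)}`, the image of `ι` twisted by a homomorphism `t`. -/
def twist (ι : Z →ₗ[O] M) (γ : G →ₗ[O] M) (t : Z →ₗ[O] G) : Submodule O M :=
  LinearMap.range (ι + γ ∘ₗ t)

theorem twist_le_iff {ι : Z →ₗ[O] M} {γ : G →ₗ[O] M} {t : Z →ₗ[O] G} {y : Submodule O M} :
    twist ι γ t ≤ y ↔ ∀ z, ι z + γ (t z) ∈ y := by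
  constructor
  · exact fun h z => h ⟨z, rfl⟩
  · rintro h _ ⟨z, rfl⟩
    exact h z

theorem nonempty_twist_equiv {ι : Z →ₗ[O] M} {γ : G →ₗ[O] M} (hι : Function.Injective ι)
    (hdisj : Disjoint (LinearMap.range ι) (LinearMap.range γ)) (t : Z →ₗ[O] G) :
    Nonempty (twist ι γ t ≃ₗ[O] Z) := by
  refine ⟨(LinearEquiv.ofInjective _ ((injective_iff_map_eq_zero _).2 fun z hz => ?_)).symm⟩
  have h1 : ι z = γ (-t z) := by
    rw [map_neg]; exact eq_neg_of_add_eq_zero_left hz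
  have h2 := Submodule.disjoint_def.1 hdisj (ι z) ⟨z, rfl⟩ (h1 ▸ ⟨_, rfl⟩)
  exact hι (by rw [h2, map_zero])

/-- The shear `ι z + c ↦ ι z + c + γ (d z)`, where `d` vanishes on the part of `Z` meeting `x`
modulo the range of `γ`, extends to an automorphism fixing `x` and the range of `γ` pointwise. -/
theorem exists_shear [Finite M] (hϖ : Irreducible ϖ) {ℓ : ℕ} (hM : IsUniform ϖ ℓ M)
    {ι : Z →ₗ[O] M} {γ : G →ₗ[O] M} {x : Submodule O M} {d : Z →ₗ[O] G}
    (hd : ∀ z, ι z ∈ x ⊔ LinearMap.range γ → d z = 0) :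
    ∃ σ : M ≃ₗ[O] M, (∀ v ∈ x, σ v = v) ∧ (∀ c ∈ LinearMap.range γ, σ c = c) ∧
      ∀ z, σ (ι z) = ι z + γ (d z) := by
  let K := x ⊔ LinearMap.range γ
  let j : Z →ₗ[O] M ⧸ K := K.mkQ ∘ₗ ι
  have hj : LinearMap.ker j ≤ LinearMap.ker (γ ∘ₗ d) := fun z hz => by
    rw [LinearMap.mem_ker, LinearMap.comp_apply,
      hd z ((Submodule.Quotient.mk_eq_zero K).1 hz), map_zero]
  let f : M ⧸ K →ₗ.[O] M :=
    ⟨LinearMap.range j, (LinearMap.ker j).liftQ (γ ∘ₗ d) hj ∘ₗ j.quotKerEquivRange.symm.toLinearMap⟩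
  have hfin : Finite (M ⧸ K) := Finite.of_surjective _ K.mkQ_surjective
  obtain ⟨δ, hδ⟩ := exists_extension hϖ (M := M ⧸ K) (ℓ := ℓ) (fun y => by
    obtain ⟨y, rfl⟩ := Submodule.Quotient.mk_surjective _ y
    rw [← Submodule.Quotient.mk_smul, hM.pow_smul, Submodule.Quotient.mk_zero]) hM f
  have hδι : ∀ z, δ (K.mkQ (ι z)) = γ (d z) := by
    intro z
    refine (hδ ⟨j z, LinearMap.mem_range_self j z⟩).trans ?_
    change (LinearMap.ker j).liftQ (γ ∘ₗ d) hj
      (j.quotKerEquivRange.symm ⟨j z, LinearMap.mem_range_self j z⟩) = _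
    rw [LinearMap.quotKerEquivRange_symm_apply_image]
    rfl
  have hδK : ∀ v ∈ K, δ (K.mkQ v) = 0 := fun v hv => by
    rw [show K.mkQ v = 0 from (Submodule.Quotient.mk_eq_zero K).2 hv, map_zero]
  let W := K ⊔ LinearMap.range ι
  have hW : W ≤ (LinearMap.range γ).comap (δ ∘ₗ K.mkQ) := by
    refine sup_le (fun v hv => ?_) ?_
    · rw [Submodule.mem_comap, LinearMap.comp_apply, hδK v hv]
      exact zero_mem _
    · rintro _ ⟨z, rfl⟩
      rw [Submodule.mem_comap, LinearMap.comp_apply, hδι]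
      exact ⟨_, rfl⟩
  obtain ⟨σ, hσ⟩ := exists_equiv_extension hϖ hM
    ((LinearMap.id + δ ∘ₗ K.mkQ).toPMap W) fun w hw => by
      have h1 : (w : M) + δ (K.mkQ w) = 0 := hw
      have h2 : (w : M) ∈ K := Submodule.mem_sup_right (by
        rw [eq_neg_of_add_eq_zero_left h1]
        exact neg_mem (hW w.2))
      rw [hδK _ h2, add_zero] at h1
      exact Subtype.ext h1
  have hσ' : ∀ w ∈ W, σ w = w + δ (K.mkQ w) := fun w hw => hσ ⟨w, hw⟩
  refine ⟨σ, fun v hv => ?_, fun c hc => ?_, fun z => ?_⟩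
  · have hvK : v ∈ K := Submodule.mem_sup_left hv
    rw [hσ' v (Submodule.mem_sup_left hvK), hδK v hvK, add_zero]
  · have hcK : c ∈ K := Submodule.mem_sup_right hc
    rw [hσ' c (Submodule.mem_sup_left hcK), hδK c hcK, add_zero]
  · rw [hσ' _ (Submodule.mem_sup_right ⟨z, rfl⟩), hδι]

theorem map_twist {ι : Z →ₗ[O] M} {γ : G →ₗ[O] M} {d : Z →ₗ[O] G} {σ : M ≃ₗ[O] M}
    (hγ : ∀ c ∈ LinearMap.range γ, σ c = c) (hι : ∀ z, σ (ι z) = ι z + γ (d z))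
    (t : Z →ₗ[O] G) : (twist ι γ t).map (σ : M →ₗ[O] M) = twist ι γ (t + d) := by
  rw [twist, ← LinearMap.range_comp, twist]
  congr 1
  ext z
  simp only [LinearMap.comp_apply, LinearMap.add_apply, LinearEquiv.coe_coe, map_add, hι,
    hγ (γ (t z)) ⟨_, rfl⟩]
  abel

variable [Finite Z] [Finite G]

theorem finite_linearMap : Finite (Z →ₗ[O] G) :=
  Finite.of_injective (fun t => (t : Z → G)) DFunLike.coe_injective

attribute [local instance] finite_linearMap

theorem sum_eq_zero_of_shift {A : Type*} [AddCommGroup A] [Fintype A] (ψ : AddChar A ℂ) {f : A → ℂ}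
    {d : A} (hd : ψ d ≠ 1) (hf : ∀ t, f (t + d) = f t) : ∑ t, ψ t * f t = 0 := by
  have h1 : ∑ t, ψ t * f t = ψ d * ∑ t, ψ t * f t := by
    rw [Finset.mul_sum]
    refine (Fintype.sum_equiv (Equiv.addRight d) _ _ fun t => ?_).symm
    rw [Equiv.coe_addRight, AddChar.map_add_eq_mul, hf]
    ring
  have h2 : (1 - ψ d) * ∑ t, ψ t * f t = 0 := by rw [sub_mul, one_mul, ← h1, sub_self]
  exact (mul_eq_zero.1 h2).resolve_left (sub_ne_zero.2 (Ne.symm hd))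

/-- The sum of `ψ t` over the twists of `ι` contained in `y`. -/
def charSum (ι : Z →ₗ[O] M) (γ : G →ₗ[O] M) (ψ : AddChar (Z →ₗ[O] G) ℂ) (y : Submodule O M) : ℂ :=
  haveI := Fintype.ofFinite (Z →ₗ[O] G)
  haveI := Classical.decPred fun t => twist ι γ t ≤ y
  ∑ t, ψ t * if twist ι γ t ≤ y then 1 else 0

open Classical in
theorem charSum_eq_sum [Fintype (Z →ₗ[O] G)] (ι : Z →ₗ[O] M) (γ : G →ₗ[O] M)
    (ψ : AddChar (Z →ₗ[O] G) ℂ) (y : Submodule O M) :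
    charSum ι γ ψ y = ∑ t, ψ t * if twist ι γ t ≤ y then 1 else 0 := by
  rw [charSum]
  convert rfl

/-- If `y` contains a nonzero `γ g`, translating `t` by homomorphisms with values in the preimage of
`y` does not change whether the twist lies in `y`. -/
theorem charSum_eq_zero_of_not_disjoint {ι : Z →ₗ[O] M} {γ : G →ₗ[O] M}
    {ψ : AddChar (Z →ₗ[O] G) ℂ} (hψ : IsNondegenerate ψ) {y : Submodule O M}
    (hy : ¬ Disjoint y (LinearMap.range γ)) : charSum ι γ ψ y = 0 := by
  obtain ⟨d, hdy, hd⟩ := hψ.right (y.comap γ) fun h => hy <| by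
    rw [Submodule.disjoint_def]
    rintro _ hx ⟨g, rfl⟩
    have : g ∈ y.comap γ := hx
    rw [h, Submodule.mem_bot] at this
    rw [this, map_zero]
  have := Fintype.ofFinite (Z →ₗ[O] G)
  rw [charSum_eq_sum]
  refine sum_eq_zero_of_shift ψ hd fun t => ?_
  congr 1
  rw [twist_le_iff, twist_le_iff]
  refine propext (forall_congr' fun z => ?_)
  rw [LinearMap.add_apply, map_add, ← add_assoc]
  exact y.add_mem_iff_left (hdy z)

theorem charSum_eq_zero_of_not_le {ι : Z →ₗ[O] M} {γ : G →ₗ[O] M}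
    {ψ : AddChar (Z →ₗ[O] G) ℂ} {y : Submodule O M} (hy : ∀ t, ¬ twist ι γ t ≤ y) :
    charSum ι γ ψ y = 0 := by
  have := Fintype.ofFinite (Z →ₗ[O] G)
  rw [charSum_eq_sum]
  exact Finset.sum_eq_zero fun t _ => by rw [if_neg (hy t), mul_zero]

/-- Only the trivial twist of `ι` lies in a submodule `y` which contains the range of `ι` and is
disjoint from the range of `γ`. -/
theorem charSum_eq_one {ι : Z →ₗ[O] M} {γ : G →ₗ[O] M} {ψ : AddChar (Z →ₗ[O] G) ℂ}
    (hγ : Function.Injective γ) {y : Submodule O M} (hy : Disjoint y (LinearMap.range γ))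
    (hιy : LinearMap.range ι ≤ y) : charSum ι γ ψ y = 1 := by
  have := Fintype.ofFinite (Z →ₗ[O] G)
  rw [charSum_eq_sum]
  refine (Finset.sum_eq_single 0 (fun t _ ht => ?_) fun h => absurd (Finset.mem_univ _) h).trans ?_
  · rw [if_neg, mul_zero]
    refine fun h => ht (LinearMap.ext fun z => hγ ?_)
    rw [LinearMap.zero_apply, map_zero]
    refine Submodule.disjoint_def.1 hy _ ?_ ⟨_, rfl⟩
    exact (y.add_mem_iff_right (hιy ⟨z, rfl⟩)).1 (twist_le_iff.1 h z)
  · rw [AddChar.map_zero_eq_one, if_pos, mul_one]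
    rw [twist_le_iff]
    intro z
    rw [LinearMap.zero_apply, map_zero, add_zero]
    exact hιy ⟨z, rfl⟩

end CharacterSums

section Eigenvector

variable {O : Type*} [CommRing O] [IsDomain O] [IsDiscreteValuationRing O]
  [Finite (ResidueField O)] {ϖ : O} {Z G : Type*} [AddCommGroup Z] [Module O Z]
  [AddCommGroup G] [Module O G] [Finite Z] [Finite G] {ℓ n m : ℕ}

attribute [local instance] finite_linearMap

open Classical in
/-- Summing the character sums over the submodules of a given type containing `x` gives a multiple
of the character sum of `x`: unless a twist lies in `x`, the contributions are cancelled by a shear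
fixing `x`. -/
theorem sum_charSum_above (hϖ : Irreducible ϖ) {ι : Z →ₗ[O] Ambient O ℓ n}
    {γ : G →ₗ[O] Ambient O ℓ n} {ψ : AddChar (Z →ₗ[O] G) ℂ} (hψ : IsNondegenerate ψ)
    {r : ℕ} (u : Fin r → ℕ) (x : Submodule O (Ambient O ℓ n)) :
    ∑ y : Gr O ℓ n u with x ≤ y.1, charSum ι γ ψ y.1 =
      {y : Submodule O (Ambient O ℓ n) |
        HasType O u y ∧ Disjoint y (LinearMap.range γ) ∧ x ≤ y}.ncard * charSum ι γ ψ x := by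
  by_cases hx : Disjoint x (LinearMap.range γ)
  swap
  · rw [charSum_eq_zero_of_not_disjoint hψ hx, mul_zero]
    refine Finset.sum_eq_zero fun y hy => charSum_eq_zero_of_not_disjoint hψ fun h => hx ?_
    exact h.mono_left (Finset.mem_filter.1 hy).2
  have hsplit : ∑ y : Gr O ℓ n u with x ≤ y.1, charSum ι γ ψ y.1 =
      ∑ y : Gr O ℓ n u with x ≤ y.1 ∧ Disjoint y.1 (LinearMap.range γ), charSum ι γ ψ y.1 := by
    rw [← Finset.filter_filter]
    refine (Finset.sum_filter_of_ne fun y _ hy => ?_).symm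
    by_contra h
    exact hy (charSum_eq_zero_of_not_disjoint hψ h)
  rw [hsplit]
  by_cases hS : (x ⊔ LinearMap.range γ).comap ι = ⊤
  · -- here a twist contained in `y` is already contained in `x`
    have h1 : ∀ y : Gr O ℓ n u, x ≤ y.1 ∧ Disjoint y.1 (LinearMap.range γ) →
        charSum ι γ ψ y.1 = charSum ι γ ψ x := by
      rintro y ⟨hxy, hy⟩
      refine Finset.sum_congr rfl fun t _ => ?_
      congr 2
      refine propext ⟨fun h => twist_le_iff.2 fun z => ?_, fun h => h.trans hxy⟩
      have hz : ι z ∈ x ⊔ LinearMap.range γ := by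
        have : z ∈ (x ⊔ LinearMap.range γ).comap ι := hS ▸ trivial
        exact this
      obtain ⟨v, hv, c, hc, hvc⟩ := Submodule.mem_sup.1 hz
      have h2 : ι z + γ (t z) = v + (c + γ (t z)) := by rw [← hvc, add_assoc]
      have h3 : c + γ (t z) = 0 := by
        refine Submodule.disjoint_def.1 hy _ ?_ (add_mem hc ⟨_, rfl⟩)
        exact (y.1.add_mem_iff_right (hxy hv)).1 (h2 ▸ twist_le_iff.1 h z)
      rw [h2, h3, add_zero]
      exact hv
    rw [Finset.sum_congr rfl fun y hy => h1 y (Finset.mem_filter.1 hy).2, Finset.sum_const,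
      nsmul_eq_mul]
    congr 2
    rw [← Fintype.card_subtype, ← Nat.card_eq_fintype_card, ← Nat.card_coe_set_eq]
    exact Nat.card_congr ⟨fun y => ⟨y.1.1, y.1.2, y.2.2, y.2.1⟩,
      fun y => ⟨⟨y.1, y.2.1⟩, y.2.2.2, y.2.2.1⟩, fun _ => rfl, fun _ => rfl⟩
  · rw [charSum_eq_zero_of_not_le, mul_zero]
    swap
    · refine fun t ht => hS (eq_top_iff.2 fun z _ => ?_)
      have h1 : ι z = (ι z + γ (t z)) + γ (-t z) := by rw [map_neg, add_neg_cancel_right]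
      rw [Submodule.mem_comap, h1]
      exact Submodule.add_mem_sup (twist_le_iff.1 ht z) ⟨_, rfl⟩
    obtain ⟨d, hdS, hd⟩ := hψ.left _ hS
    obtain ⟨σ, hσx, hσγ, hσι⟩ := exists_shear hϖ (isUniform_ambient hϖ ℓ n) (ι := ι) (γ := γ)
      (x := x) (d := d) fun z hz => hdS z hz
    have := Fintype.ofFinite (Z →ₗ[O] G)
    have hswap : ∑ y : Gr O ℓ n u with x ≤ y.1 ∧ Disjoint y.1 (LinearMap.range γ),
        charSum ι γ ψ y.1 = ∑ t, ψ t *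
          ∑ y : Gr O ℓ n u with x ≤ y.1 ∧ Disjoint y.1 (LinearMap.range γ),
            if twist ι γ t ≤ y.1 then 1 else 0 := by
      simp only [Finset.mul_sum]
      rw [Finset.sum_comm]
      refine Finset.sum_congr rfl fun y _ => ?_
      exact charSum_eq_sum ι γ ψ y.1
    rw [hswap]
    refine sum_eq_zero_of_shift ψ hd fun t => ?_
    rw [Finset.sum_filter, Finset.sum_filter]
    refine (Fintype.sum_equiv (Gr.mapEquiv u σ) _ _ fun y => ?_).symm
    have hσx' : x.map (σ : Ambient O ℓ n →ₗ[O] Ambient O ℓ n) = x :=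
      map_eq_of_forall (LinearEquiv.refl O x) σ fun v => hσx v v.2
    have hσγ' : (LinearMap.range γ).map (σ : Ambient O ℓ n →ₗ[O] Ambient O ℓ n) =
        LinearMap.range γ :=
      map_eq_of_forall (LinearEquiv.refl O _) σ fun v => hσγ v v.2
    have e1 : x ≤ (Gr.mapEquiv u σ y).1 ↔ x ≤ y.1 := by
      nth_rw 1 [← hσx']
      exact map_le_map_equiv σ
    have e2 : Disjoint (Gr.mapEquiv u σ y).1 (LinearMap.range γ) ↔
        Disjoint y.1 (LinearMap.range γ) := by
      nth_rw 1 [← hσγ']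
      exact disjoint_map_equiv σ
    have e3 : twist ι γ (t + d) ≤ (Gr.mapEquiv u σ y).1 ↔ twist ι γ t ≤ y.1 := by
      rw [← map_twist hσγ hσι t]
      exact map_le_map_equiv σ
    simp only [e1, e2, e3]

/-- The character sums form an eigenvector of the cellular operators. -/
theorem cellular_charSum (hϖ : Irreducible ϖ) {ι : Z →ₗ[O] Ambient O ℓ n}
    {γ : G →ₗ[O] Ambient O ℓ n} {ψ : AddChar (Z →ₗ[O] G) ℂ} (hψ : IsNondegenerate ψ)
    (l : BoxPartition m ℓ) {α β : ℂ}
    (hα : ∀ x : Submodule O (Ambient O ℓ n), HasType O (parts l) x →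
      Disjoint x (LinearMap.range γ) → ({y : Submodule O (Ambient O ℓ n) |
        HasType O (rect ℓ m) y ∧ Disjoint y (LinearMap.range γ) ∧ x ≤ y}.ncard : ℂ) = α)
    (hβ : ∀ t, ∀ y : Submodule O (Ambient O ℓ n), HasType O (rect ℓ m) y → twist ι γ t ≤ y →
      ({x : Submodule O (Ambient O ℓ n) |
        HasType O (parts l) x ∧ twist ι γ t ≤ x ∧ x ≤ y}.ncard : ℂ) = β) :
    cellular O ℓ n m l (fun y => charSum ι γ ψ y.1) = (α * β) • fun y => charSum ι γ ψ y.1 := by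
  classical
  funext y
  have h1 : ∀ x : Gr O ℓ n (parts l),
      down O ℓ n (rect ℓ m) (parts l) (fun y => charSum ι γ ψ y.1) x = α * charSum ι γ ψ x.1 := by
    intro x
    change ∑ y : Gr O ℓ n (rect ℓ m) with x.1 ≤ y.1, charSum ι γ ψ y.1 = _
    rw [sum_charSum_above hϖ hψ]
    by_cases hx : Disjoint x.1 (LinearMap.range γ)
    · rw [hα x.1 x.2 hx]
    · rw [charSum_eq_zero_of_not_disjoint hψ hx, mul_zero, mul_zero]
  change ∑ x : Gr O ℓ n (parts l) with x.1 ≤ y.1,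
    down O ℓ n (rect ℓ m) (parts l) (fun y => charSum ι γ ψ y.1) x = α * β * charSum ι γ ψ y.1
  simp only [h1]
  rw [← Finset.mul_sum, mul_assoc]
  congr 1
  have := Fintype.ofFinite (Z →ₗ[O] G)
  simp only [charSum_eq_sum]
  rw [Finset.sum_comm, Finset.mul_sum]
  refine Finset.sum_congr rfl fun t _ => ?_
  rw [← Finset.mul_sum, mul_left_comm]
  congr 1
  rw [← Finset.sum_filter, Finset.filter_filter, Finset.sum_const, nsmul_eq_mul, mul_one]
  split_ifs with ht
  · rw [mul_one, ← hβ t y.1 y.2 ht, ← Fintype.card_subtype, ← Nat.card_eq_fintype_card,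
      ← Nat.card_coe_set_eq]
    congr 1
    exact Nat.card_congr ⟨fun x => ⟨x.1.1, x.1.2, x.2.2, x.2.1⟩,
      fun x => ⟨⟨x.1, x.2.1⟩, x.2.2.2, x.2.2.1⟩, fun _ => rfl, fun _ => rfl⟩
  · rw [mul_zero, Nat.cast_eq_zero, Finset.card_eq_zero, Finset.filter_eq_empty_iff]
    exact fun x _ h => ht (h.2.trans h.1)

end Eigenvector

/-! ### Types of submodules -/

section Monotonicity

theorem conj_antitone {r : ℕ} (l : Fin r → ℕ) : Antitone (conj l) := fun _ _ hij =>
  Finset.card_le_card fun _ hi =>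
    Finset.mem_filter.2 ⟨Finset.mem_univ _, hij.trans (Finset.mem_filter.1 hi).2⟩

theorem conj_mono {r : ℕ} {l u : Fin r → ℕ} (h : ∀ i, l i ≤ u i) (j : ℕ) : conj l j ≤ conj u j :=
  Finset.card_le_card fun i hi =>
    Finset.mem_filter.2 ⟨Finset.mem_univ _, (Finset.mem_filter.1 hi).2.trans (h i)⟩

theorem conj_le {r : ℕ} (l : Fin r → ℕ) (j : ℕ) : conj l j ≤ r :=
  (Finset.card_filter_le _ _).trans (by simp)

theorem le_of_conj_le {r : ℕ} {κ μ : Fin r → ℕ} (hκ : Antitone κ) (hμ : Antitone μ)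
    (h : ∀ j, 1 ≤ j → conj κ j ≤ conj μ j) (i : Fin r) : κ i ≤ μ i := by
  by_contra! hi
  have h1 : (i : ℕ) + 1 ≤ conj κ (κ i) := by
    rw [← Fin.card_Iic]
    exact Finset.card_le_card fun i' hi' =>
      Finset.mem_filter.2 ⟨Finset.mem_univ _, hκ (Finset.mem_Iic.1 hi')⟩
  have h2 : conj μ (κ i) ≤ i := by
    rw [← Fin.card_Iio i]
    refine Finset.card_le_card fun i' hi' => Finset.mem_Iio.2 ?_
    by_contra! hle
    have := (Finset.mem_filter.1 hi').2
    have := hμ hle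
    omega
  have := h (κ i) (by omega)
  omega

variable {O : Type*} [CommRing O] [IsDomain O] [IsDiscreteValuationRing O]
  [Finite (ResidueField O)] {ϖ : O} {M : Type*} [AddCommGroup M] [Module O M] [Finite M]

/-- The quotients `z[ϖ ^ (j + 1)] / z[ϖ ^ j]` embed into the corresponding ones of `x`; the
inequality is obtained from addition `z[ϖ ^ (j + 1)] × x[ϖ ^ j] → x[ϖ ^ (j + 1)]`. -/
theorem card_torsionBy_mul_le (z x : Submodule O M) (hzx : z ≤ x) (j : ℕ) :
    Nat.card (Submodule.torsionBy O z (ϖ ^ (j + 1))) * Nat.card (Submodule.torsionBy O x (ϖ ^ j)) ≤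
      Nat.card (Submodule.torsionBy O z (ϖ ^ j)) *
        Nat.card (Submodule.torsionBy O x (ϖ ^ (j + 1))) := by
  let f : (Submodule.torsionBy O z (ϖ ^ (j + 1)) × Submodule.torsionBy O x (ϖ ^ j)) →ₗ[O] x :=
    (Submodule.inclusion hzx ∘ₗ (Submodule.torsionBy O z (ϖ ^ (j + 1))).subtype).coprod
      (Submodule.torsionBy O x (ϖ ^ j)).subtype
  have hf : ∀ p, (f p : M) = p.1.1.1 + p.2.1.1 := fun p => rfl
  rw [← Nat.card_prod, Submodule.card_eq_card_quotient_mul_card (LinearMap.ker f)]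
  refine Nat.mul_le_mul ?_ ?_
  · refine Nat.card_le_card_of_injective (fun p => ⟨p.1.1.1, ?_⟩) fun p p' h => ?_
    · have h1 : (p.1.1.1.1 : M) = -p.1.2.1.1 := by
        have := congrArg Subtype.val (LinearMap.mem_ker.1 p.2)
        rw [hf] at this
        exact eq_neg_of_add_eq_zero_left this
      have h2 : ϖ ^ j • (p.1.2.1.1 : M) = 0 :=
        congrArg Subtype.val ((Submodule.mem_torsionBy_iff _ _).1 p.1.2.2)
      exact (Submodule.mem_torsionBy_iff _ _).2 (Subtype.ext (show ϖ ^ j • (p.1.1.1.1 : M) = 0 by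
        rw [h1, smul_neg, h2, neg_zero]))
    · have h1 : (p.1.1.1 : M) = p'.1.1.1 := congrArg Subtype.val (Subtype.mk.inj h)
      have h2 := congrArg Subtype.val (LinearMap.mem_ker.1 p.2)
      have h3 := congrArg Subtype.val (LinearMap.mem_ker.1 p'.2)
      rw [hf] at h2 h3
      have h4 : (p.1.2.1.1 : M) = p'.1.2.1.1 := by
        rw [eq_neg_of_add_eq_zero_right h2, eq_neg_of_add_eq_zero_right h3, h1]
      exact Subtype.ext (Prod.ext (Subtype.ext (Subtype.ext h1)) (Subtype.ext (Subtype.ext h4)))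
  · rw [Nat.card_congr f.quotKerEquivRange.toEquiv]
    refine Nat.card_mono (Set.toFinite _) ?_
    rintro _ ⟨p, rfl⟩
    have h1 : ϖ ^ (j + 1) • (p.1.1.1 : M) = 0 :=
      congrArg Subtype.val ((Submodule.mem_torsionBy_iff _ _).1 p.1.2)
    have h2 : ϖ ^ j • (p.2.1.1 : M) = 0 :=
      congrArg Subtype.val ((Submodule.mem_torsionBy_iff _ _).1 p.2.2)
    refine (Submodule.mem_torsionBy_iff _ _).2 (Subtype.ext ?_)
    change ϖ ^ (j + 1) • ((p.1.1.1 : M) + p.2.1.1) = 0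
    have h3 : ∀ w : M, ϖ ^ j • w = 0 → ϖ ^ (j + 1) • w = 0 := fun w hw => by
      rw [pow_succ', mul_smul, hw, smul_zero]
    rw [smul_add, h1, h3 _ h2, add_zero]

/-- The type of a submodule is contained in the type of the module. -/
theorem HasType.conj_le_conj (hϖ : Irreducible ϖ) (hq1 : 1 < Nat.card (ResidueField O)) {r s : ℕ}
    {κ : Fin r → ℕ} {μ : Fin s → ℕ} {z x : Submodule O M} (hz : HasType O κ z)
    (hx : HasType O μ x) (hzx : z ≤ x) (j : ℕ) (hj : 1 ≤ j) : conj κ j ≤ conj μ j := by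
  obtain ⟨j, rfl⟩ : ∃ i, j = i + 1 := ⟨j - 1, by omega⟩
  have h1 := card_torsionBy_mul_le (ϖ := ϖ) z x hzx j
  rw [hz.card_torsionBy hϖ, hz.card_torsionBy hϖ, hx.card_torsionBy hϖ, hx.card_torsionBy hϖ,
    ← pow_add, ← pow_add, Nat.pow_le_pow_iff_right hq1, Finset.sum_Icc_succ_top (by omega),
    Finset.sum_Icc_succ_top (by omega)] at h1
  omega

theorem one_lt_card_residueField : 1 < Nat.card (ResidueField O) :=
  Finite.one_lt_card

end Monotonicity

/-! ### The closed form of the eigenvalues -/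

section ClosedForm

theorem prod_Icc_div_succ {f : ℕ → ℂ} (hf : ∀ j, f j ≠ 0) (L : ℕ) :
    ∏ j ∈ Finset.Icc 1 L, f (j + 1) / f j = f (L + 1) / f 1 := by
  induction L with
  | zero => simp [hf]
  | succ L ih =>
    rw [Finset.prod_Icc_succ_top (by omega), ih, div_mul_div_cancel₀' (hf _)]

theorem embeddingCount_rect {q : ℕ} (hq : 1 < q) {ℓ N b r : ℕ} {μ : Fin r → ℕ}
    (hμ : ∀ i, μ i ≤ ℓ) :
    embeddingCount q ℓ (conj (rect ℓ N)) b μ =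
      (q : ℂ) ^ (∑ j ∈ Finset.Icc 1 ℓ, (N * conj μ j : ℤ)) *
        (qFactorial q (N - b) / qFactorial q (N - b - conj μ 1)) := by
  rw [embeddingCount]
  have h0 : conj μ (ℓ + 1) = 0 := conj_eq_zero fun i => Nat.lt_succ_of_le (hμ i)
  congr 1
  · rw [← zpow_natCast]
    congr 1
    push_cast
    exact Finset.sum_congr rfl fun j hj => by rw [conj_rect (Finset.mem_Icc.1 hj).2]
  · have h1 := prod_Icc_div_succ (f := fun j => qFactorial q (N - b - conj μ j))
      (fun j => qFactorial_ne_zero hq _) ℓ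
    rw [h0, Nat.sub_zero] at h1
    rw [← h1]
    exact Finset.prod_congr rfl fun j hj => by rw [conj_rect (Finset.mem_Icc.1 hj).2]

theorem embeddingCount_conj {q ℓ r s : ℕ} (l : Fin s → ℕ) (μ : Fin r → ℕ) :
    embeddingCount q ℓ (conj l) 0 μ =
      (q : ℂ) ^ (∑ j ∈ Finset.Icc 1 ℓ, (conj l j * conj μ j : ℤ)) *
        ∏ j ∈ Finset.Icc 1 ℓ,
          qFactorial q (conj l j - conj μ (j + 1)) / qFactorial q (conj l j - conj μ j) := by
  rw [embeddingCount, ← zpow_natCast]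
  push_cast
  rfl

theorem parts_le {m ℓ : ℕ} (l : BoxPartition m ℓ) (i : Fin m) : parts l i ≤ ℓ :=
  Nat.lt_succ_iff.1 (l.1 i).2

theorem parts_antitone {m ℓ : ℕ} (l : BoxPartition m ℓ) : Antitone (parts l) :=
  fun _ _ hij => l.2 hij

/-- The denominators of the `q`-binomial coefficients telescope. -/
theorem binomProd_eq {q : ℕ} (hq : 1 < q) {m ℓ : ℕ} {l k : BoxPartition m ℓ} (hkl : k ≤ l) :
    binomProd q m ℓ l k =
      (∏ j ∈ Finset.Icc 1 ℓ, qFactorial q (conj (parts l) j - conj (parts k) (j + 1)) /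
        qFactorial q (conj (parts l) j - conj (parts k) j)) /
      (∏ j ∈ Finset.Icc 1 ℓ, qFactorial q (conj (parts l) j - conj (parts l) (j + 1)) /
        qFactorial q (conj (parts l) j - conj (parts l) j)) *
      qFactorial q (conj (parts l) 1 - conj (parts k) 1) := by
  have h0 : conj (parts l) (ℓ + 1) = 0 :=
    conj_eq_zero fun i => Nat.lt_succ_of_le (parts_le l i)
  have h1 := prod_Icc_div_succ
    (f := fun j => (qFactorial q (conj (parts l) j - conj (parts k) j))⁻¹)
    (fun j => inv_ne_zero (qFactorial_ne_zero hq _)) ℓ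
  rw [h0, Nat.zero_sub, qFactorial_zero, inv_one, one_div, inv_inv] at h1
  rw [← h1, ← Finset.prod_div_distrib, ← Finset.prod_mul_distrib, binomProd]
  refine Finset.prod_congr rfl fun j _ => ?_
  have h2 := conj_mono (l := parts k) (u := parts l) hkl (j + 1)
  have h3 := conj_antitone (parts l) (Nat.le_add_right j 1)
  rw [qBinom, if_pos (by omega), Nat.sub_self, qFactorial_zero,
    show conj (parts l) j - conj (parts k) (j + 1) - (conj (parts l) j - conj (parts l) (j + 1)) =
      conj (parts l) (j + 1) - conj (parts k) (j + 1) by omega]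
  have e1 := qFactorial_ne_zero hq (conj (parts l) j - conj (parts k) j)
  have e2 := qFactorial_ne_zero hq (conj (parts l) j - conj (parts l) (j + 1))
  have e3 := qFactorial_ne_zero hq (conj (parts l) (j + 1) - conj (parts k) (j + 1))
  field_simp

/-- The eigenvalue of the cellular operator `c_λ` on the representation indexed by `κ`. -/
def eigenvalue (q ℓ n m : ℕ) (l k : BoxPartition m ℓ) : ℂ :=
  (q : ℂ) ^ exponent ℓ n m l k
    * qBinom q (conj (rect ℓ m) 1 - conj (parts k) 1) (conj (rect ℓ m) 1 - conj (parts l) 1)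
    * qBinom q (conj (rect ℓ n) 1 - conj (parts l) 1 - conj (parts k) 1)
        (conj (rect ℓ m) 1 - conj (parts l) 1)
    * binomProd q m ℓ l k

/-- The number of free submodules of rank `m` containing a given submodule of type `λ` and disjoint
from a given subspace of the socle of dimension `κ'_1`. -/
def aboveCount (q ℓ n m : ℕ) (l k : BoxPartition m ℓ) : ℂ :=
  embeddingCount q ℓ (conj (rect ℓ n)) (conj (parts k) 1) (rect ℓ m) *
      embeddingCount q ℓ (conj (rect ℓ m)) 0 (parts l) /
    (embeddingCount q ℓ (conj (rect ℓ m)) 0 (rect ℓ m) *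
      embeddingCount q ℓ (conj (rect ℓ n)) (conj (parts k) 1) (parts l))

/-- The number of submodules of type `λ` between a submodule of type `κ` and a free module of rank
`m` containing it. -/
def betweenCount (q ℓ m : ℕ) (l k : BoxPartition m ℓ) : ℂ :=
  embeddingCount q ℓ (conj (rect ℓ m)) 0 (parts l) *
      embeddingCount q ℓ (conj (parts l)) 0 (parts k) /
    (embeddingCount q ℓ (conj (parts l)) 0 (parts l) *
      embeddingCount q ℓ (conj (rect ℓ m)) 0 (parts k))

/-- The closed form is the product of the two counts.  For rectangular targets the products in
`embeddingCount` telescope, which leaves the two `q`-binomial coefficients in the first columns. -/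
theorem eigenvalue_eq {q : ℕ} (hq : 1 < q) {ℓ n m : ℕ} (hmn : 2 * m ≤ n) {l k : BoxPartition m ℓ}
    (hkl : k ≤ l) :
    eigenvalue q ℓ n m l k = aboveCount q ℓ n m l k * betweenCount q ℓ m l k := by
  have hq0 : (q : ℂ) ≠ 0 := by exact_mod_cast (by omega : q ≠ 0)
  have hexp : exponent ℓ n m l k =
      ∑ j ∈ Finset.Icc 1 ℓ, (n * conj (rect ℓ m) j : ℤ) +
      ∑ j ∈ Finset.Icc 1 ℓ, (m * conj (parts l) j : ℤ) -
      (∑ j ∈ Finset.Icc 1 ℓ, (m * conj (rect ℓ m) j : ℤ) +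
      ∑ j ∈ Finset.Icc 1 ℓ, (n * conj (parts l) j : ℤ)) +
      (∑ j ∈ Finset.Icc 1 ℓ, (m * conj (parts l) j : ℤ) +
      ∑ j ∈ Finset.Icc 1 ℓ, (conj (parts l) j * conj (parts k) j : ℤ) -
      (∑ j ∈ Finset.Icc 1 ℓ, (conj (parts l) j * conj (parts l) j : ℤ) +
      ∑ j ∈ Finset.Icc 1 ℓ, (m * conj (parts k) j : ℤ))) := by
    simp only [← Finset.sum_add_distrib, ← Finset.sum_sub_distrib]
    refine Finset.sum_congr rfl fun j hj => ?_
    rw [conj_rect (Finset.mem_Icc.1 hj).2, conj_rect (Finset.mem_Icc.1 hj).2]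
    ring
  have hk1 := conj_le (parts k) 1
  have hl1 := conj_le (parts l) 1
  have hkl1 := conj_mono (l := parts k) (u := parts l) hkl 1
  have hP := binomProd_eq hq hkl
  have hbin : ∀ {a b : ℕ}, b ≤ a → qBinom q a b =
      qFactorial q a / (qFactorial q b * qFactorial q (a - b)) := fun h => if_pos h
  rw [eigenvalue, aboveCount, betweenCount,
    embeddingCount_rect hq (μ := rect ℓ m) fun _ => le_refl ℓ,
    embeddingCount_rect hq (μ := rect ℓ m) fun _ => le_refl ℓ, embeddingCount_rect hq (parts_le l),
    embeddingCount_rect hq (parts_le l), embeddingCount_rect hq (parts_le k),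
    embeddingCount_conj, embeddingCount_conj, hP, hexp, zpow_add₀ hq0, zpow_sub₀ hq0,
    zpow_sub₀ hq0, zpow_add₀ hq0, zpow_add₀ hq0, zpow_add₀ hq0, zpow_add₀ hq0]
  have hprod : ∀ (a b : Fin m → ℕ), ∏ j ∈ Finset.Icc 1 ℓ, qFactorial q (conj a j - conj b (j + 1)) /
      qFactorial q (conj a j - conj b j) ≠ 0 := fun a b =>
    Finset.prod_ne_zero_iff.2 fun j _ =>
      div_ne_zero (qFactorial_ne_zero hq _) (qFactorial_ne_zero hq _)
  have e1 := hprod (parts l) (parts k)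
  have e2 := hprod (parts l) (parts l)
  -- the two remaining products occur on both sides and play no further role
  generalize (∏ j ∈ Finset.Icc 1 ℓ, qFactorial q (conj (parts l) j - conj (parts k) (j + 1)) /
      qFactorial q (conj (parts l) j - conj (parts k) j)) = P at e1 ⊢
  generalize (∏ j ∈ Finset.Icc 1 ℓ, qFactorial q (conj (parts l) j - conj (parts l) (j + 1)) /
      qFactorial q (conj (parts l) j - conj (parts l) j)) = Q at e2 ⊢
  have hz : ∀ a : ℤ, (q : ℂ) ^ a ≠ 0 := fun a => zpow_ne_zero a hq0
  have hF := qFactorial_ne_zero hq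
  -- for `ℓ = 0` the first columns of the rectangles are empty as well
  rcases Nat.eq_zero_or_pos ℓ with rfl | hℓ
  · have hz1 : ∀ {r : ℕ} (a : Fin r → ℕ), (∀ i, a i ≤ 0) → conj a 1 = 0 := fun a ha =>
      conj_eq_zero fun i => Nat.lt_succ_of_le (ha i)
    rw [hz1 _ (parts_le l), hz1 _ (parts_le k), hz1 (rect 0 m) fun _ => le_rfl,
      hz1 (rect 0 n) fun _ => le_rfl, hbin le_rfl]
    simp only [Nat.sub_zero, qFactorial_zero]
    simp only [div_self (hF _)]
    simp
  · rw [conj_rect hℓ, conj_rect hℓ, hbin (by omega), hbin (by omega)]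
    simp only [Nat.sub_zero, Nat.sub_self, qFactorial_zero]
    rw [show m - conj (parts k) 1 - (m - conj (parts l) 1) = conj (parts l) 1 - conj (parts k) 1 by
        omega,
      show n - conj (parts l) 1 - conj (parts k) 1 - (m - conj (parts l) 1) =
        n - conj (parts k) 1 - m by omega,
      show n - conj (parts k) 1 - conj (parts l) 1 = n - conj (parts l) 1 - conj (parts k) 1 by
        omega]
    have f1 := hF m
    have f2 := hF (m - conj (parts k) 1)
    have f3 := hF (m - conj (parts l) 1)
    have f4 := hF (conj (parts l) 1 - conj (parts k) 1)
    have f5 := hF (n - conj (parts k) 1 - m)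
    have f6 := hF (n - conj (parts l) 1 - conj (parts k) 1)
    have f7 := hF (n - conj (parts k) 1)
    field_simp [hz]

theorem eigenvalue_ne_zero {q : ℕ} (hq : 1 < q) {ℓ n m : ℕ} (hmn : 2 * m ≤ n)
    {l k : BoxPartition m ℓ} (hkl : k ≤ l) : eigenvalue q ℓ n m l k ≠ 0 := by
  rw [eigenvalue_eq hq hmn hkl, aboveCount, betweenCount]
  refine mul_ne_zero (div_ne_zero (mul_ne_zero ?_ ?_) (mul_ne_zero ?_ ?_))
    (div_ne_zero (mul_ne_zero ?_ ?_) (mul_ne_zero ?_ ?_)) <;>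
  exact embeddingCount_ne_zero hq _ _ _ _

end ClosedForm

/-! ### The eigensystem -/

section Eigensystem

variable {O : Type*} [CommRing O] [IsDomain O] [IsDiscreteValuationRing O]
  [Finite (ResidueField O)] {ϖ : O} {ℓ n m : ℕ}

theorem card_socle_range {r : ℕ} {κ : Fin r → ℕ} {M : Type*} [AddCommGroup M] [Module O M]
    (hϖ : Irreducible ϖ) {z : Submodule O M} (hz : HasType O κ z) :
    Nat.card (z ⊓ Submodule.torsionBy O M ϖ : Submodule O M) =
      Nat.card (ResidueField O) ^ conj κ 1 := by
  have h1 := hz.card_torsionBy hϖ 1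
  rw [pow_one, Finset.Icc_self, Finset.sum_singleton] at h1
  rw [← h1]
  exact Nat.card_congr ⟨
    fun x => ⟨⟨x.1, x.2.1⟩, (Submodule.mem_torsionBy_iff _ _).2 (Subtype.ext x.2.2)⟩,
    fun x => ⟨x.1.1, x.1.2, congrArg Subtype.val ((Submodule.mem_torsionBy_iff _ _).1 x.2)⟩,
    fun _ => rfl, fun _ => rfl⟩

theorem card_typeModule_socleType {r : ℕ} (κ : Fin r → ℕ) :
    Nat.card (TypeModule O (socleType κ)) = Nat.card (ResidueField O) ^ conj κ 1 := by
  rw [Nat.card_pi]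
  simp only [card_quotient_pow, Finset.prod_pow_eq_pow_sum, socleType, sum_min_eq_sum_conj,
    Finset.Icc_self, Finset.sum_singleton]

theorem nonempty_of_natCast_card_ne_zero {α : Type*} (h : (Nat.card α : ℂ) ≠ 0) : Nonempty α := by
  by_contra hα
  rw [not_nonempty_iff] at hα
  simp at h

/-- The ambient module contains a module of type `κ` together with a disjoint copy of its socle. -/
theorem exists_disjoint_embeddings (hϖ : Irreducible ϖ) (hmn : 2 * m ≤ n) (k : BoxPartition m ℓ) :
    ∃ (ι : TypeModule O (parts k) →ₗ[O] Ambient O ℓ n)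
      (γ : TypeModule O (socleType (parts k)) →ₗ[O] Ambient O ℓ n),
      Function.Injective ι ∧ Function.Injective γ ∧
        Disjoint (LinearMap.range ι) (LinearMap.range γ) := by
  have hq1 := one_lt_card_residueField (O := O)
  have hM : HasType O (rect ℓ n) (Ambient O ℓ n) := ⟨LinearEquiv.refl O _⟩
  obtain ⟨v, hv⟩ : Nonempty (Tup ϖ (parts k) ⊤ (⊥ : Submodule O (Ambient O ℓ n))) := by
    apply nonempty_of_natCast_card_ne_zero
    rw [card_tup_ambient hϖ rfl hq1 (b := 0) (parts_antitone k) (parts_le k) hM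
      (fun c hc => by rw [(Submodule.mem_bot O).1 hc, smul_zero])
      (by rw [pow_zero]; exact Nat.card_unique) (by omega)]
    exact embeddingCount_ne_zero hq1 _ _ _ _
  have hι := Tup.injective hϖ hv
  set ι := tupMap hϖ v hv.2.1
  have hz : HasType O (parts k) (LinearMap.range ι) := ⟨(LinearEquiv.ofInjective ι hι).symm⟩
  obtain ⟨w, hw⟩ : Nonempty (Tup ϖ (socleType (parts k)) ⊤
      (LinearMap.range ι ⊓ Submodule.torsionBy O (Ambient O ℓ n) ϖ)) := by
    apply nonempty_of_natCast_card_ne_zero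
    rw [card_tup_ambient (μ := socleType (parts k)) hϖ rfl hq1 (b := conj (parts k) 1)
      (fun i j hij => min_le_min_left 1 (parts_antitone k hij))
      (fun i => (min_le_right _ _).trans (parts_le k i)) hM
      (C := LinearMap.range ι ⊓ Submodule.torsionBy O (Ambient O ℓ n) ϖ)
      (fun c hc => (Submodule.mem_torsionBy_iff ϖ c).1 (Submodule.mem_inf.1 hc).2)
      (card_socle_range hϖ hz) (by have := conj_le (parts k) 1; omega)]
    exact embeddingCount_ne_zero hq1 _ _ _ _
  refine ⟨ι, tupMap hϖ w hw.2.1, hι, Tup.injective hϖ hw, ?_⟩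
  rw [Submodule.disjoint_def]
  rintro _ hx ⟨g, rfl⟩
  have hg : ϖ ^ 1 • g = 0 := pow_smul_typeModule hϖ (fun i => min_le_left _ _) g
  rw [pow_one] at hg
  rw [Tup.eq_zero_of_mem hϖ hw ⟨hx, by
    change ϖ • tupMap hϖ w hw.2.1 g = 0
    rw [← map_smul, hg, map_zero]⟩, map_zero]

open Classical in
/-- The lower triangular matrix of eigenvalues. -/
def eigenvalueMatrix (q ℓ n m : ℕ) (l k : BoxPartition m ℓ) : ℂ :=
  if k ≤ l then eigenvalue q ℓ n m l k else 0

/-- The eigenvector indexed by `κ` is the character sum over the twists of an embedding of `O_κ`.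
It is nonzero because it takes the value `1` on a free submodule containing the image and disjoint
from the range of `γ`. -/
theorem exists_eigenvector (hϖ : Irreducible ϖ) (hmn : 2 * m ≤ n) (k : BoxPartition m ℓ) :
    ∃ h : FF O ℓ n (rect ℓ m), h ≠ 0 ∧ ∀ l, cellular O ℓ n m l h =
      eigenvalueMatrix (Nat.card (ResidueField O)) ℓ n m l k • h := by
  have hq1 := one_lt_card_residueField (O := O)
  have hM : HasType O (rect ℓ n) (Ambient O ℓ n) := ⟨LinearEquiv.refl O _⟩
  have hk1 := conj_le (parts k) 1
  obtain ⟨ι, γ, hι, hγ, hdisj⟩ := exists_disjoint_embeddings (n := n) hϖ hmn k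
  obtain ⟨ψ, hψ⟩ := exists_isNondegenerate hϖ (parts k)
  have hC : ∀ c ∈ LinearMap.range γ, ϖ • c = 0 := by
    rintro _ ⟨g, rfl⟩
    have hg : ϖ ^ 1 • g = 0 := pow_smul_typeModule hϖ (fun i => min_le_left _ _) g
    rw [pow_one] at hg
    rw [← map_smul, hg, map_zero]
  have hCcard : Nat.card (LinearMap.range γ) = Nat.card (ResidueField O) ^ conj (parts k) 1 := by
    rw [← card_typeModule_socleType]
    exact (Nat.card_congr (LinearEquiv.ofInjective γ hγ).toEquiv).symm
  have htwist : ∀ t, HasType O (parts k) (twist ι γ t) := nonempty_twist_equiv hι hdisj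
  have habove : ∀ (l : BoxPartition m ℓ) (x : Submodule O (Ambient O ℓ n)),
      HasType O (parts l) x → Disjoint x (LinearMap.range γ) →
      ({y : Submodule O (Ambient O ℓ n) |
        HasType O (rect ℓ m) y ∧ Disjoint y (LinearMap.range γ) ∧ x ≤ y}.ncard : ℂ) =
        aboveCount (Nat.card (ResidueField O)) ℓ n m l k := by
    intro l x hx hxC
    rw [aboveCount, eq_div_iff (mul_ne_zero (embeddingCount_ne_zero hq1 _ _ _ _)
      (embeddingCount_ne_zero hq1 _ _ _ _))]
    exact ncard_free_above hϖ rfl hq1 (parts_antitone l) (parts_le l) le_rfl hM hC hCcard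
      (by omega) hx hxC
  refine ⟨fun y => charSum ι γ ψ y.1, fun h0 => ?_, fun l => ?_⟩
  · have h1 := habove k (LinearMap.range ι) ⟨(LinearEquiv.ofInjective ι hι).symm⟩ hdisj
    have h2 : aboveCount (Nat.card (ResidueField O)) ℓ n m k k ≠ 0 := fun h =>
      eigenvalue_ne_zero hq1 hmn (le_refl k) (by rw [eigenvalue_eq hq1 hmn le_rfl, h, zero_mul])
    rw [← h1, Nat.cast_ne_zero] at h2
    obtain ⟨y, hy, hyC, hιy⟩ := Set.nonempty_of_ncard_ne_zero h2
    have h3 : charSum ι γ ψ y = 0 := congrFun h0 ⟨y, hy⟩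
    rw [charSum_eq_one hγ hyC hιy] at h3
    exact one_ne_zero h3
  · rw [eigenvalueMatrix]
    split_ifs with hkl
    · rw [eigenvalue_eq hq1 hmn hkl]
      refine cellular_charSum hϖ hψ l (habove l) fun t y hy hty => ?_
      rw [betweenCount, eq_div_iff (mul_ne_zero (embeddingCount_ne_zero hq1 _ _ _ _)
        (embeddingCount_ne_zero hq1 _ _ _ _))]
      exact ncard_between hϖ rfl hq1 (parts_antitone l) (parts_le l) (parts_antitone k) (parts_le k)
        hkl (isUniform_ambient hϖ ℓ n) (htwist t) hy hty
    · rw [← mul_zero (aboveCount (Nat.card (ResidueField O)) ℓ n m l k)]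
      refine cellular_charSum hϖ hψ l (habove l) fun t y _ _ => ?_
      rw [Nat.cast_eq_zero, Set.ncard_eq_zero (Set.toFinite _)]
      refine Set.eq_empty_of_forall_notMem fun x hx => hkl ?_
      exact le_of_conj_le (parts_antitone k) (parts_antitone l)
        ((htwist t).conj_le_conj hϖ hq1 hx.1 hx.2.1)

theorem exists_isEigensystem (hϖ : Irreducible ϖ) (hmn : 2 * m ≤ n) :
    ∃ h : BoxPartition m ℓ → FF O ℓ n (rect ℓ m),
      IsEigensystem (eigenvalueMatrix (Nat.card (ResidueField O)) ℓ n m) h := by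
  choose h hne heigen using exists_eigenvector (O := O) (ℓ := ℓ) hϖ hmn
  refine ⟨h, hne, fun l k => heigen k l, fun l k hkl => if_neg hkl, fun k => ?_⟩
  rw [eigenvalueMatrix, if_pos le_rfl]
  exact eigenvalue_ne_zero one_lt_card_residueField hmn le_rfl

end Eigensystem

end Grassmann
end

theorem mainTheorem4 (O : Type*) [CommRing O] [IsDomain O] [IsDiscreteValuationRing O]
    [Finite (IsLocalRing.ResidueField O)] (ℓ n m q : ℕ) (hmn : 2 * m ≤ n)
    (hq : q = Nat.card (IsLocalRing.ResidueField O)) :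
    (∃! e : Grassmann.BoxPartition m ℓ →
        Module.End ℂ (Grassmann.FF O ℓ n (Grassmann.rect ℓ m)),
      Grassmann.IsAlgebraicBasis O ℓ n m e) ∧
    ∀ e : Grassmann.BoxPartition m ℓ →
        Module.End ℂ (Grassmann.FF O ℓ n (Grassmann.rect ℓ m)),
      Grassmann.IsAlgebraicBasis O ℓ n m e →
      (∃! A, Grassmann.IsTransitionMatrix O ℓ n m e A) ∧
      ∀ A, Grassmann.IsTransitionMatrix O ℓ n m e A →
        ∀ l k : Grassmann.BoxPartition m ℓ, k ≤ l →
          A l k = (q : ℂ) ^ Grassmann.exponent ℓ n m l k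
            * Grassmann.qBinom q
                (Grassmann.conj (Grassmann.rect ℓ m) 1 - Grassmann.conj (Grassmann.parts k) 1)
                (Grassmann.conj (Grassmann.rect ℓ m) 1 - Grassmann.conj (Grassmann.parts l) 1)
            * Grassmann.qBinom q
                (Grassmann.conj (Grassmann.rect ℓ n) 1 - Grassmann.conj (Grassmann.parts l) 1
                  - Grassmann.conj (Grassmann.parts k) 1)
                (Grassmann.conj (Grassmann.rect ℓ m) 1 - Grassmann.conj (Grassmann.parts l) 1)
            * Grassmann.binomProd q m ℓ l k := by
  subst hq
  obtain ⟨ϖ, hϖ⟩ := IsDiscreteValuationRing.exists_irreducible O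
  obtain ⟨h, H⟩ := Grassmann.exists_isEigensystem (O := O) (ℓ := ℓ) hϖ hmn
  obtain ⟨h1, h2⟩ := H.algebraicBasis Grassmann.cellular_mem_hecke (Grassmann.finrank_hecke_le hϖ)
  refine ⟨h1, fun e he => ⟨⟨_, (h2 e he _).2 rfl, fun B hB => (h2 e he B).1 hB⟩, ?_⟩⟩
  intro A hA l k hkl
  rw [(h2 e he A).1 hA, Matrix.of_apply, Grassmann.eigenvalueMatrix, if_pos hkl,
    Grassmann.eigenvalue]
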